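/- Let $\eta_3\in(-2,2)$ and consider in $\mathbb R^4$ the system \[ x_1'=x_2,\qquad x_2'=x_3,\qquad x_3'=x_4,\qquad x_4'=-x_1+\eta_3x_3+x_1^2, \] with flow $\varphi$ and first integral $H(x)=\frac12x_1^2-\frac13x_1^3-\frac{\eta_3}{2}x_2^2+x_2x_4-\frac12x_3^2$. The origin $\mathcal O$ is a bifocal equilibrium; let $W^u(\mathcal O)$ be its two-dimensional unstable manifold, and let \[ W^u_{loc}(\mathcal O)=\{(x_1,x_2,a(x_1,x_2),b(x_1,x_2)):\ x_1^2+x_2^2<\delta^2\} \] be a local unstable manifold contained in $W^u(\mathcal O)$, where $a,b$ are real analytic on that disc. For $0<r^*<\delta$ let $D^u\subset W^u_{loc}(\mathcal O)$ be the closed curve over the circle $x_1^2+x_2^2=(r^*)^2$. Let $S=\{x_2=0\}$ and $C=S\cap\{H=0\}$. In $C$ consider the lines $v_1=\{x_1=x_2=x_3=0\}$ and $v_2=\{x_1=\frac32,\ x_2=x_3=0\}$ and the regions $C_2=\{x\in C: x_1>0,\ x_3>0\}$, $C_3=\{x\in C: x_1>0,\ x_3<0\}$. Let $\Sigma^u_1$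 be the set of first intersections (at positive time) with $S$ of the forward orbits of the points of $D^u$ and, for $k\ge1$, let $\Sigma^u_{k+1}$ be the set of first intersections (at positive time) with $S$ of the forward orbits of the points of $\Sigma^u_k$. Let $\Pi$ denote the Poincaré map from $C$ to $C$ (first return to $S$ at positive time), wherever it is defined. Let $k\ge1$ and let $q=(\frac32,0,0,q_4)\in\Sigma^u_k\cap v_2$ with $q_4>0$. Assume that 1. $W^u(\mathcal O)$ and $v_2$ intersect transversely at $q$ inside $\{H=0\}$, that is, $T_qW^u(\mathcal O)+T_qv_2=T_q\{H=0\}$; 2. the orbit of $q$ meets $D^u$ in exactly one point $p$; 3. the orbit of $q$ does not meet $v_1\cup v_2$ between $p$ and $q$ (so that its crossings with $S$ before $q$ are transverse). Then for every neighbourhood $V$ of $q$ there are an open set $U$ with $q\in U\subset V$ and sets $\Sigma^{u,3}_k$, $\Sigma^{u,2}_{k+1}$ such that * $(\Sigma^u_k\setminus\{q\})\cap U=\Sigma^{u,3}_k\subset C_3$, and $\Sigma^{u,3}_k$ is an open arc having $q$ as an end point; * $\Pi$ is defined on all of $\Sigma^{u,3}_k$, and $\Sigma^{u,2}_{k+1}=\Pi(\Sigma^{u,3}_k)$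 satisfies $\Sigma^{u,2}_{k+1}\subset\Sigma^u_{k+1}\cap C_2\cap V$; * $\Sigma^{u,2}_{k+1}$ is an open arc having $q$ as an end point. Thus $q$ is a common end point of both arcs (a turning point). Here an open arc is an injective continuous image of $[0,1]$ with its two end points removed. -/

import Mathlib

open Set Filter Topology

noncomputable section

namespace LoopCylinder

/-- The phase space `ℝ⁴`; the coordinates `x 0, x 1, x 2, x 3` are `x₁, x₂, x₃, x₄`. -/
abbrev E4 := EuclideanSpace ℝ (Fin 4)

/-- The plane of the coordinates `(x₁, x₂)`. -/
abbrev E2 := EuclideanSpace ℝ (Fin 2)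

/-- The vector field `x₁' = x₂, x₂' = x₃, x₃' = x₄, x₄' = -x₁ + η x₃ + x₁²`. -/
def X (η : ℝ) (x : E4) : E4 :=
  !₂[x 1, x 2, x 3, -x 0 + η * x 2 + x 0 ^ 2]

/-- The first integral of the system. -/
def H (η : ℝ) (x : E4) : ℝ :=
  x 0 ^ 2 / 2 - x 0 ^ 3 / 3 - η / 2 * x 1 ^ 2 + x 1 * x 3 - x 2 ^ 2 / 2

/-- The solution starting at `x` exists between the times `0` and `t` and is at `y` at time `t`,
that is, `φ(t, x) = y` (`t` may be negative). -/
def FlowsTo (η t : ℝ) (x y : E4) : Prop :=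
  ∃ γ : ℝ → E4, IsIntegralCurveOn γ (fun _ => X η) (uIcc 0 t) ∧ γ 0 = x ∧ γ t = y

open Classical in
/-- The (local) flow `φ(t, x)`, with value `0` where the solution does not exist up to time `t`. -/
def flow (η t : ℝ) (x : E4) : E4 :=
  if h : ∃ y, FlowsTo η t x y then h.choose else 0

/-- The orbit through `x`. -/
def orbit (η : ℝ) (x : E4) : Set E4 := {y | ∃ t : ℝ, FlowsTo η t x y}

/-- The open orbit arc from `p` to `q`: points reached from `p` after a positive time, from which
`q` is reached after a positive time. -/
def orbitArc (η : ℝ) (p q : E4) : Set E4 :=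
  {x | ∃ s > 0, ∃ t > 0, FlowsTo η s p x ∧ FlowsTo η t x q}

/-! ### The unstable manifold of the origin -/

/-- `W^u(O)`: the points whose backward orbit exists for all time and converges to the origin. -/
def unstableManifold (η : ℝ) : Set E4 :=
  {x | ∃ γ : ℝ → E4, IsIntegralCurveOn γ (fun _ => X η) (Iic 0) ∧ γ 0 = x ∧
    Tendsto γ atBot (𝓝 0)}

/-- The graph parametrization `(x₁, x₂) ↦ (x₁, x₂, a(x₁, x₂), b(x₁, x₂))`. -/
def graphMap (a b : E2 → ℝ) (u : E2) : E4 := !₂[u 0, u 1, a u, b u]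

/-- Real part of the eigenvalues of the linearization at the origin with positive real part. -/
def rho (η : ℝ) : ℝ := √(η + 2) / 2

/-- Modulus of the imaginary part of the eigenvalues of the linearization at the origin. -/
def omega (η : ℝ) : ℝ := √(-η + 2) / 2

/-- The graph of `(a, b)` over the disc of radius `δ` is a local unstable manifold of the origin. -/
structure IsLocalUnstableGraph (η δ : ℝ) (a b : E2 → ℝ) : Prop where
  analytic_a : AnalyticOnNhd ℝ a (Metric.ball 0 δ)
  analytic_b : AnalyticOnNhd ℝ b (Metric.ball 0 δ)
  a_zero : a 0 = 0
  b_zero : b 0 = 0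
  /-- The tangent plane at the origin is the unstable eigenspace. -/
  tangent_a : ∀ u : E2, fderiv ℝ a 0 u =
    -(rho η ^ 2 + omega η ^ 2) * u 0 + 2 * rho η * u 1
  tangent_b : ∀ u : E2, fderiv ℝ b 0 u =
    -2 * rho η * (rho η ^ 2 + omega η ^ 2) * u 0 + (3 * rho η ^ 2 - omega η ^ 2) * u 1
  /-- Local invariance: the vector field is tangent to the graph (on the graph
  `x₁' = x₂` and `x₂' = a(x₁, x₂)`). -/
  invariant : ∀ u ∈ Metric.ball (0 : E2) δ,
    fderiv ℝ (graphMap a b) u !₂[u 1, a u] = X η (graphMap a b u)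
  subset_unstable : ∀ u ∈ Metric.ball (0 : E2) δ, graphMap a b u ∈ unstableManifold η

/-- The points `σ(θ)` of the curve `D^u`. -/
def sigma (a b : E2 → ℝ) (r θ : ℝ) : E4 :=
  graphMap a b !₂[r * Real.cos θ, r * Real.sin θ]

/-- `D^{u,+}`. -/
def DuPlus (a b : E2 → ℝ) (r : ℝ) : Set E4 := sigma a b r '' Ioc 0 Real.pi

/-- `D^{u,-}`. -/
def DuMinus (a b : E2 → ℝ) (r : ℝ) : Set E4 := sigma a b r '' Ioc Real.pi (2 * Real.pi)

/-- `D^u = D^{u,+} ∪ D^{u,-}`. -/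
def Du (a b : E2 → ℝ) (r : ℝ) : Set E4 := DuPlus a b r ∪ DuMinus a b r

/-- The tangent space `T_q W^u(O)` at a point `q = φ(t, p)`, `t > 0`, where `p ∈ D^u`: near `q`
the immersed surface `W^u(O)` is the image under `φ(t, ·)` of the local unstable manifold near `p`.
(If the orbit of `q` meets `D^u` only once, then the supremum is over exactly one pair.) -/
def unstableTangentSpace (η : ℝ) (a b : E2 → ℝ) (r : ℝ) (q : E4) : Submodule ℝ E4 :=
  ⨆ (u : E2) (t : ℝ) (_ : ‖u‖ = r ∧ 0 < t ∧ FlowsTo η t (graphMap a b u) q),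
    LinearMap.range (fderiv ℝ (fun w => flow η t (graphMap a b w)) u : E2 →ₗ[ℝ] E4)

/-! ### The cross section and the loop cylinder -/

/-- The cross section `S = {x₂ = 0}`. -/
def S : Set E4 := {x | x 1 = 0}

/-- The loop cylinder `C = S ∩ {H = 0}`. -/
def C (η : ℝ) : Set E4 := {x | x ∈ S ∧ H η x = 0}

/-- The line `v₁` in `S`. -/
def v₁ : Set E4 := {x | x ∈ S ∧ x 0 = 0 ∧ x 2 = 0}

/-- The line `v₂` in `S`. -/
def v₂ : Set E4 := {x | x ∈ S ∧ x 0 = 3 / 2 ∧ x 2 = 0}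

/-- The region `C₂` of the loop cylinder. -/
def C₂ (η : ℝ) : Set E4 := {x | x ∈ C η ∧ 0 < x 0 ∧ 0 < x 2}

/-- The region `C₃` of the loop cylinder. -/
def C₃ (η : ℝ) : Set E4 := {x | x ∈ C η ∧ 0 < x 0 ∧ x 2 < 0}

/-- The forward orbit of `x` hits `S`, and `y` is the first hit at a positive time. -/
def FirstHit (η : ℝ) (x y : E4) : Prop :=
  ∃ (T : ℝ) (γ : ℝ → E4), 0 < T ∧ IsIntegralCurveOn γ (fun _ => X η) (Icc 0 T) ∧
    γ 0 = x ∧ γ T = y ∧ y ∈ S ∧ ∀ t ∈ Ioo 0 T, γ t ∉ S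

/-- The `k`-th hits of `S` by forward orbits starting in `D` (`D` itself for `k = 0`). -/
def hits (η : ℝ) (D : Set E4) : ℕ → Set E4
  | 0 => D
  | k + 1 => {y | ∃ p ∈ hits η D k, FirstHit η p y}

/-- `Σ^u_k = Σ^{u,+}_k ∪ Σ^{u,-}_k`, for `k ≥ 1`. -/
def SigmaU (η : ℝ) (a b : E2 → ℝ) (r : ℝ) (k : ℕ) : Set E4 :=
  hits η (DuPlus a b r) k ∪ hits η (DuMinus a b r) k

/-- The domain of the Poincaré map of the loop cylinder. -/
def poincareDomain (η : ℝ) : Set E4 := {x | x ∈ C η ∧ ∃ y, FirstHit η x y}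

open Classical in
/-- The Poincaré map `Π`, with value `x` outside its domain. -/
def poincareMap (η : ℝ) (x : E4) : E4 :=
  if h : ∃ y, FirstHit η x y then h.choose else x

/-- `W^u(O)` and the line `v₂` intersect transversely at `q`, inside the level set of `H`
through `q`: the tangent space of the level set is `T_q W^u(O) + T_q v₂`. -/
def TransverseToV₂At (η : ℝ) (a b : E2 → ℝ) (r : ℝ) (q : E4) : Prop :=
  unstableTangentSpace η a b r q ⊔ Submodule.span ℝ {EuclideanSpace.single (3 : Fin 4) (1 : ℝ)} =
    LinearMap.ker (fderiv ℝ (H η) q : E4 →ₗ[ℝ] ℝ)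

/-- `A` is an open arc (an injective continuous image of `[0, 1]` without its two end points),
and `q` is one of its end points. -/
def IsOpenArcWithEndpoint (A : Set E4) (q : E4) : Prop :=
  ∃ c : ℝ → E4, ContinuousOn c (Icc 0 1) ∧ InjOn c (Icc 0 1) ∧ c 0 = q ∧ A = c '' Ioo 0 1

end LoopCylinder

end

open LoopCylinder

/-! Near `q` one has `x₄ > 0`. There `x₃' = x₄` makes `x₃` increase along every orbit, so `x₂`,
whose derivative is `x₃`, is strictly convex in time. The orbit of `q` touches `S` from the side `x₂
> 0`. A nearby orbit that meets `S` transversally close to `q` does so in a pair: first with `x₃ <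
0`, then with `x₃ > 0` (`exists_next_crossing`, `exists_previous_crossing`).

Transversality to `v₂` means that `(x₂, x₃)` are local coordinates on the unstable manifold at `q`,
so its intersection with `S` is there a curve `e σ` with `x₃ = σ` and `e 0 = q`
(`TurningOrbit.exists_curve`). For `σ < 0` the point is the first of a pair; it lies in `C₃`, and
the Poincaré map sends it to the second point of the pair, in `C₂`, which tends to `q` with `σ`. For
`σ > 0` the point is already the second of a pair and comes too late to be a `k`-th hit. Hence only
half of the curve belongs to `Σ^u_k`, and its image is the other arc ending at `q`.

Hits must also be counted. The crossings before `q` are transverse and finite in number, so their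
number is stable (`eventually_encard_crossings_eq`). Conversely, a `k`-th hit near `q` might come
from `D^u` after a quite different time. For bounded times compactness excludes this. For long times
the orbit would have crossed `S` too often, because the origin is a focus on the unstable manifold
and `x₂` changes sign again and again in the past (`exists_eq_zero_of_spiral`,
`eventually_many_crossings`). The point `p` itself is not in `S`, by a second derivative argument
(`not_mem_S_of_crossing`).

The link between the unstable manifold and its local graph is the linear equation for the deviation
from the graph: it gives local invariance (`onGraph_of_isSol`) and shows that orbits emanating from
the origin start on the graph (`eventually_onGraph`). The flow is only known to be Lipschitz in the
initial value. Its differentiability at `p` along the graph is contained in the transversality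
hypothesis, and `hasStrictFDerivAt_flow_comp` makes it strict, as the inverse function theorem
requires. -/

noncomputable section

namespace LoopCylinder

/-! ### Solutions of the system -/

/-- `γ` solves the system on `s`. -/
abbrev IsSol (η : ℝ) (γ : ℝ → E4) (s : Set ℝ) : Prop :=
  IsIntegralCurveOn γ (fun _ => X η) s

@[simp] theorem X_apply_zero (η : ℝ) (x : E4) : X η x 0 = x 1 := rfl
@[simp] theorem X_apply_one (η : ℝ) (x : E4) : X η x 1 = x 2 := rfl
@[simp] theorem X_apply_two (η : ℝ) (x : E4) : X η x 2 = x 3 := rfl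
@[simp] theorem X_apply_three (η : ℝ) (x : E4) :
    X η x 3 = -x 0 + η * x 2 + x 0 ^ 2 := rfl

theorem contDiff_X (η : ℝ) : ContDiff ℝ 1 (X η) := by
  refine contDiff_euclidean.2 fun i => ?_
  fin_cases i <;> simp <;> fun_prop

theorem IsSol.coord {η : ℝ} {γ : ℝ → E4} {s : Set ℝ} (h : IsSol η γ s) {t : ℝ} (ht : t ∈ s)
    (i : Fin 4) : HasDerivWithinAt (fun t => γ t i) (X η (γ t) i) s t := by
  exact ((EuclideanSpace.proj i : E4 →L[ℝ] ℝ).hasFDerivAt.comp_hasDerivWithinAt t (h t ht))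

theorem IsSol.mono {η : ℝ} {γ : ℝ → E4} {s s' : Set ℝ} (h : IsSol η γ s) (hs : s' ⊆ s) :
    IsSol η γ s' :=
  IsIntegralCurveOn.mono h hs

theorem IsSol.continuousOn_coord {η : ℝ} {γ : ℝ → E4} {s : Set ℝ} (h : IsSol η γ s) (i : Fin 4) :
    ContinuousOn (fun t => γ t i) s :=
  fun _ ht => (h.coord ht i).continuousWithinAt

/-- A globally Lipschitz bounded vector field that coincides with `X` on a ball. -/
theorem exists_cutoff (η R : ℝ) : ∃ Y : E4 → E4, (∃ K, LipschitzWith K Y) ∧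
    (∃ L : NNReal, ∀ x, ‖Y x‖ ≤ L) ∧ ∀ x ∈ Metric.closedBall (0 : E4) R, Y x = X η x := by
  -- Taking `max R 1` keeps the radii of the bump positive for every real `R`.
  let f : ContDiffBump (0 : E4) := ⟨max R 1, max R 1 + 1, by positivity, by linarith⟩
  have hc : HasCompactSupport fun x => f x • X η x := f.hasCompactSupport.smul_right
  have hd : ContDiff ℝ 1 fun x => f x • X η x := f.contDiff.smul (contDiff_X η)
  refine ⟨fun x => f x • X η x, hd.lipschitzWith_of_hasCompactSupport hc one_ne_zero, ?_, ?_⟩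
  · obtain ⟨L, hL⟩ := hd.continuous.bounded_above_of_compact_support hc
    exact ⟨L.toNNReal, fun x => (hL x).trans (Real.le_coe_toNNReal L)⟩
  · intro x hx
    have : f x = 1 := f.one_of_mem_closedBall (Metric.closedBall_subset_closedBall
      (le_max_left _ _) hx)
    simp [this]

theorem exists_bound_of_Icc {η : ℝ} {γ : ℝ → E4} {α β : ℝ} (h : IsSol η γ (Icc α β)) :
    ∃ R, ∀ t ∈ Icc α β, ‖γ t‖ ≤ R :=
  isCompact_Icc.exists_bound_of_continuousOn h.continuousOn

/-- Uniqueness for globally Lipschitz autonomous equations on a compact interval. -/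
theorem eqOn_Icc_of_lipschitz {Y : E4 → E4} {K : NNReal} (hY : LipschitzWith K Y)
    {γ₁ γ₂ : ℝ → E4} {α β t₀ : ℝ} (ht₀ : t₀ ∈ Icc α β)
    (h₁ : IsIntegralCurveOn γ₁ (fun _ => Y) (Icc α β))
    (h₂ : IsIntegralCurveOn γ₂ (fun _ => Y) (Icc α β))
    (h : γ₁ t₀ = γ₂ t₀) : EqOn γ₁ γ₂ (Icc α β) := by
  have hr : ∀ {γ : ℝ → E4}, IsIntegralCurveOn γ (fun _ => Y) (Icc α β) → ∀ t ∈ Ico t₀ β,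
      HasDerivWithinAt γ (Y (γ t)) (Ici t) t := fun hγ t ht =>
    ((hγ t ⟨ht₀.1.trans ht.1, ht.2.le⟩).mono
      (Icc_subset_Icc (ht₀.1.trans ht.1) le_rfl)).mono_of_mem_nhdsWithin (Icc_mem_nhdsGE ht.2)
  have hl : ∀ {γ : ℝ → E4}, IsIntegralCurveOn γ (fun _ => Y) (Icc α β) → ∀ t ∈ Ioc α t₀,
      HasDerivWithinAt γ (Y (γ t)) (Iic t) t := fun hγ t ht =>
    ((hγ t ⟨ht.1.le, ht.2.trans ht₀.2⟩).mono
      (Icc_subset_Icc le_rfl (ht.2.trans ht₀.2))).mono_of_mem_nhdsWithin (Icc_mem_nhdsLE ht.1)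
  intro t ht
  rcases le_total t₀ t with hle | hle
  · exact ODE_solution_unique (fun _ => hY)
      (h₁.continuousOn.mono (Icc_subset_Icc ht₀.1 le_rfl)) (hr h₁)
      (h₂.continuousOn.mono (Icc_subset_Icc ht₀.1 le_rfl)) (hr h₂) h ⟨hle, ht.2⟩
  · exact ODE_solution_unique_of_mem_Icc_left (s := fun _ => univ)
      (fun _ _ => hY.lipschitzOnWith)
      (h₁.continuousOn.mono (Icc_subset_Icc le_rfl ht₀.2)) (hl h₁) (fun _ _ => trivial)
      (h₂.continuousOn.mono (Icc_subset_Icc le_rfl ht₀.2)) (hl h₂) (fun _ _ => trivial)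
      h ⟨ht.1, hle⟩

theorem IsSol.cutoff {η R : ℝ} {Y : E4 → E4} {γ : ℝ → E4} {s : Set ℝ} (h : IsSol η γ s)
    (hY : ∀ x ∈ Metric.closedBall (0 : E4) R, Y x = X η x) (hR : ∀ t ∈ s, ‖γ t‖ ≤ R) :
    IsIntegralCurveOn γ (fun _ => Y) s := fun t ht =>
  (h t ht).congr_deriv (hY (γ t) (by simpa using hR t ht)).symm

/-- Local Lipschitz bounds suffice: two times span a compact interval, on which both curves stay in
one ball, and there the field may be replaced by a cut-off one. -/
theorem IsSol.eqOn {η : ℝ} {γ₁ γ₂ : ℝ → E4} {s : Set ℝ} (hs : s.OrdConnected) {t₀ : ℝ}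
    (ht₀ : t₀ ∈ s) (h₁ : IsSol η γ₁ s) (h₂ : IsSol η γ₂ s) (h : γ₁ t₀ = γ₂ t₀) :
    EqOn γ₁ γ₂ s := by
  intro t ht
  have hsub : Icc (min t₀ t) (max t₀ t) ⊆ s := hs.uIcc_subset ht₀ ht
  obtain ⟨R₁, hR₁⟩ := exists_bound_of_Icc (h₁.mono hsub)
  obtain ⟨R₂, hR₂⟩ := exists_bound_of_Icc (h₂.mono hsub)
  obtain ⟨Y, ⟨K, hK⟩, -, hY⟩ := exists_cutoff η (max R₁ R₂)
  exact eqOn_Icc_of_lipschitz hK (t₀ := t₀) ⟨min_le_left _ _, le_max_left _ _⟩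
    ((h₁.mono hsub).cutoff hY fun t ht => (hR₁ t ht).trans (le_max_left _ _))
    ((h₂.mono hsub).cutoff hY fun t ht => (hR₂ t ht).trans (le_max_right _ _)) h
    ⟨min_le_right _ _, le_max_right _ _⟩

/-- Translation in time. -/
theorem IsSol.shift {η : ℝ} {γ : ℝ → E4} {s s' : Set ℝ} (h : IsSol η γ s) (c : ℝ)
    (hs : ∀ t ∈ s', t + c ∈ s) : IsSol η (fun t => γ (t + c)) s' :=
  (IsIntegralCurveOn.comp_add h c).mono fun t ht => by
    refine ⟨t + c, hs t ht, ?_⟩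
    simp

/-- Concatenation of solutions. -/
theorem IsSol.glue {η : ℝ} {γ₁ γ₂ : ℝ → E4} {s₁ s₂ : Set ℝ} {b : ℝ} (h₁ : IsSol η γ₁ s₁)
    (h₂ : IsSol η γ₂ s₂) (hs₁ : s₁ ⊆ Iic b) (hs₂ : s₂ ⊆ Ici b) (hb₁ : b ∈ s₁) (hb₂ : b ∈ s₂)
    (hb : γ₁ b = γ₂ b) : IsSol η (fun t => if t ≤ b then γ₁ t else γ₂ t) (s₁ ∪ s₂) := by
  set γ : ℝ → E4 := fun t => if t ≤ b then γ₁ t else γ₂ t with hγ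
  have e₁ : EqOn γ γ₁ s₁ := fun t ht => if_pos (hs₁ ht)
  have e₂ : EqOn γ γ₂ s₂ := fun t ht => by
    rcases (show b ≤ t from hs₂ ht).eq_or_lt with rfl | hlt
    · simp [hγ, hb]
    · simp [hγ, not_le.2 hlt]
  have d₁ : ∀ t ∈ s₁, HasDerivWithinAt γ (X η (γ t)) s₁ t := fun t ht => by
    have := (h₁ t ht).congr e₁ (e₁ ht)
    rwa [← e₁ ht] at this
  have d₂ : ∀ t ∈ s₂, HasDerivWithinAt γ (X η (γ t)) s₂ t := fun t ht => by
    have := (h₂ t ht).congr e₂ (e₂ ht)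
    rwa [← e₂ ht] at this
  intro t ht
  rcases lt_trichotomy t b with hlt | rfl | hlt
  · have ht₁ : t ∈ s₁ := ht.resolve_right fun h => not_lt.2 (hs₂ h) hlt
    refine (d₁ t ht₁).mono_of_mem_nhdsWithin ?_
    filter_upwards [self_mem_nhdsWithin, mem_nhdsWithin_of_mem_nhds (Iio_mem_nhds hlt)] with u hu hub
    exact hu.resolve_right fun h => not_lt.2 (hs₂ h) (show u < b from hub)
  · exact (d₁ t hb₁).union (d₂ t hb₂)
  · have ht₂ : t ∈ s₂ := ht.resolve_left fun h => not_lt.2 (hs₁ h) hlt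
    refine (d₂ t ht₂).mono_of_mem_nhdsWithin ?_
    filter_upwards [self_mem_nhdsWithin, mem_nhdsWithin_of_mem_nhds (Ioi_mem_nhds hlt)] with u hu hub
    exact hu.resolve_left fun h => not_lt.2 (hs₁ h) (show b < u from hub)

/-- A curve of speed at most `L` that starts within distance `1` of `x₀` cannot leave a ball of this
radius in the available time. Hence the time interval need not be shortened. -/
theorem isPicardLindelof_of_bounded {Y : E4 → E4} {K L : NNReal} (hK : LipschitzWith K Y)
    (hL : ∀ x, ‖Y x‖ ≤ L) {α β : ℝ} (hα : α ≤ 0) (hβ : 0 ≤ β) (x₀ : E4) :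
    IsPicardLindelof (fun _ => Y) (⟨0, hα, hβ⟩ : Icc α β) x₀
      (1 + L * (max (β - 0) (0 - α)).toNNReal) 1 L K where
  lipschitzOnWith _ _ := hK.lipschitzOnWith
  continuousOn _ _ := continuousOn_const
  norm_le _ _ x _ := hL x
  mul_max_le := by
    push_cast
    rw [Real.coe_toNNReal _ (le_max_of_le_left (by simpa using hβ))]
    simp

/-- Serves to prolong the orbit beyond `q`, since the hypotheses only provide it up to `q`. -/
theorem exists_local_solution (η : ℝ) (x : E4) :
    ∃ ε > 0, ∃ γ : ℝ → E4, γ 0 = x ∧ IsSol η γ (Icc (-ε) ε) := by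
  obtain ⟨Y, ⟨K, hK⟩, ⟨L, hL⟩, hY⟩ := exists_cutoff η (‖x‖ + 1)
  obtain ⟨γ, h0, hγ⟩ := (isPicardLindelof_of_bounded hK hL (α := -1) (β := 1) (by norm_num)
    (by norm_num) x).exists_eq_forall_mem_Icc_hasDerivWithinAt (x := x) (by simp)
  have hc : ContinuousAt γ 0 := ((hγ 0 (by simp)).hasDerivAt
    (Icc_mem_nhds (by norm_num) (by norm_num))).continuousAt
  have h0' : γ 0 = x := h0
  have : ∀ᶠ t in 𝓝 (0 : ℝ), ‖γ t‖ < ‖x‖ + 1 :=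
    hc.norm.eventually_lt_const (by simp [h0'])
  obtain ⟨ε, hε, hb⟩ := Metric.eventually_nhds_iff.1 this
  refine ⟨min (ε / 2) 1, by positivity, γ, h0', fun t ht => ?_⟩
  have ht' : |t| ≤ min (ε / 2) 1 := abs_le.2 ht
  have hn : ‖γ t‖ < ‖x‖ + 1 := hb (by
    rw [Real.dist_eq, sub_zero]; linarith [min_le_left (ε / 2) 1])
  have hsub : Icc (-min (ε / 2) 1) (min (ε / 2) 1) ⊆ Icc (-1 : ℝ) 1 :=
    Icc_subset_Icc (neg_le_neg (min_le_right _ _)) (min_le_right _ _)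
  exact ((hγ t (hsub ht)).mono hsub).congr_deriv (hY _ (by simpa using hn.le))

/-- Solutions with initial values near that of a given solution on a compact interval exist on that
interval and depend on the initial value in a Lipschitz way. -/
theorem exists_flow_chart {η : ℝ} {γ : ℝ → E4} {α β : ℝ} (hα : α ≤ 0) (hβ : 0 ≤ β)
    (h : IsSol η γ (Icc α β)) :
    ∃ Ψ : E4 → ℝ → E4, ∃ ρ > 0, ∃ L : NNReal,
      (∀ y ∈ Metric.ball (γ 0) ρ, Ψ y 0 = y ∧ IsSol η (Ψ y) (Icc α β)) ∧
      (∀ t ∈ Icc α β, LipschitzOnWith L (Ψ · t) (Metric.ball (γ 0) ρ)) := by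
  obtain ⟨R, hR⟩ := exists_bound_of_Icc h
  obtain ⟨Y, ⟨K, hK⟩, ⟨L, hL⟩, hY⟩ := exists_cutoff η (R + 1)
  obtain ⟨Ψ, h1, L', h2⟩ := (isPicardLindelof_of_bounded hK hL hα hβ
    (γ 0)).exists_forall_mem_closedBall_eq_hasDerivWithinAt_lipschitzOnWith
  have hm : γ 0 ∈ Metric.closedBall (γ 0) ((1 : NNReal) : ℝ) := by simp
  have hE : EqOn (Ψ (γ 0)) γ (Icc α β) := eqOn_Icc_of_lipschitz hK (t₀ := 0) ⟨hα, hβ⟩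
    (h1 _ hm).2 (h.cutoff hY fun t ht => (hR t ht).trans (by linarith)) (h1 _ hm).1
  -- The radius `1 / (L' + 1)` keeps the cut-off solutions within distance `1` of `γ`, hence in the
  -- ball of radius `R + 1`, where the cut-off field is `X`.
  have hpos : (0 : ℝ) < L' + 1 := by positivity
  have hsub : Metric.ball (γ 0) (1 / (L' + 1)) ⊆ Metric.closedBall (γ 0) ((1 : NNReal) : ℝ) := by
    refine Metric.ball_subset_closedBall.trans (Metric.closedBall_subset_closedBall ?_)
    rw [div_le_iff₀ hpos]; simp
  refine ⟨Ψ, 1 / (L' + 1), by positivity, L', fun y hy => ⟨(h1 y (hsub hy)).1, fun t ht => ?_⟩,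
    fun t ht => (h2 t ht).mono hsub⟩
  have hd : dist (Ψ y t) (γ t) ≤ 1 := by
    rw [← hE ht]
    refine ((h2 t ht).dist_le_mul _ (hsub hy) _ hm).trans ?_
    have : dist y (γ 0) < 1 / (L' + 1) := hy
    rw [lt_div_iff₀ hpos] at this
    nlinarith [dist_nonneg (x := y) (y := γ 0)]
  refine ((h1 y (hsub hy)).2 t ht).congr_deriv (hY _ ?_)
  · rw [mem_closedBall_zero_iff]
    calc ‖Ψ y t‖ ≤ ‖γ t‖ + ‖Ψ y t - γ t‖ := norm_le_norm_add_norm_sub' _ _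
      _ ≤ R + 1 := add_le_add (hR t ht) (by rwa [← dist_eq_norm])

theorem continuousOn_flow_chart {η : ℝ} {Ψ : E4 → ℝ → E4} {x₀ : E4} {ρ α β : ℝ} {L : NNReal}
    (h1 : ∀ y ∈ Metric.ball x₀ ρ, Ψ y 0 = y ∧ IsSol η (Ψ y) (Icc α β))
    (h2 : ∀ t ∈ Icc α β, LipschitzOnWith L (Ψ · t) (Metric.ball x₀ ρ)) :
    ContinuousOn (Function.uncurry Ψ) (Metric.ball x₀ ρ ×ˢ Icc α β) :=
  continuousOn_prod_of_continuousOn_lipschitzOnWith _ L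
    (fun x hx => (h1 x hx).2.continuousOn) h2

/-! ### The relation `FlowsTo` -/

theorem IsSol.flowsTo {η : ℝ} {γ : ℝ → E4} {s : Set ℝ} (h : IsSol η γ s) {c t : ℝ}
    (hs : s.OrdConnected) (hc : c ∈ s) (ht : t ∈ s) : FlowsTo η (t - c) (γ c) (γ t) := by
  refine ⟨fun u => γ (u + c), h.shift c fun u hu => ?_, by simp, by simp⟩
  refine hs.uIcc_subset hc ht ?_
  rcases le_total 0 (t - c) with h0 | h0
  · rw [uIcc_of_le h0] at hu; rw [uIcc_of_le (by linarith)]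
    exact ⟨by linarith [hu.1], by linarith [hu.2]⟩
  · rw [uIcc_of_ge h0] at hu; rw [uIcc_of_ge (by linarith)]
    exact ⟨by linarith [hu.1], by linarith [hu.2]⟩

/-- Along a solution, `FlowsTo` determines the point that is reached. -/
theorem FlowsTo.eq_of_isSol {η t : ℝ} {x y : E4} (hxy : FlowsTo η t x y) {γ : ℝ → E4} {s : Set ℝ}
    (h : IsSol η γ s) (hs : s.OrdConnected) {c : ℝ} (hc : c ∈ s) (ht : c + t ∈ s)
    (hx : γ c = x) : γ (c + t) = y := by
  obtain ⟨δ, hδ, h0, rfl⟩ := hxy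
  have hsol : IsSol η (fun u => γ (u + c)) (uIcc 0 t) := h.shift c fun u hu => by
    refine hs.uIcc_subset hc ht ?_
    rcases le_total 0 t with h0 | h0
    · rw [uIcc_of_le h0] at hu; rw [uIcc_of_le (by linarith)]
      exact ⟨by linarith [hu.1], by linarith [hu.2]⟩
    · rw [uIcc_of_ge h0] at hu; rw [uIcc_of_ge (by linarith)]
      exact ⟨by linarith [hu.1], by linarith [hu.2]⟩
  have := hsol.eqOn ordConnected_uIcc (left_mem_uIcc) hδ (by simp [hx, h0]) right_mem_uIcc
  simpa [add_comm] using this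

theorem FlowsTo.unique {η t : ℝ} {x y z : E4} (hy : FlowsTo η t x y) (hz : FlowsTo η t x z) :
    y = z := by
  obtain ⟨γ, hγ, h0, rfl⟩ := hy
  simpa using hz.eq_of_isSol hγ ordConnected_uIcc (c := 0) left_mem_uIcc (by simp) h0

theorem FlowsTo.symm {η t : ℝ} {x y : E4} (h : FlowsTo η t x y) : FlowsTo η (-t) y x := by
  obtain ⟨γ, hγ, rfl, rfl⟩ := h
  replace hγ : IsSol η γ (uIcc 0 t) := hγ
  simpa using hγ.flowsTo ordConnected_uIcc right_mem_uIcc left_mem_uIcc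

theorem flow_eq {η t : ℝ} {x y : E4} (h : FlowsTo η t x y) : flow η t x = y := by
  have hex : ∃ y, FlowsTo η t x y := ⟨y, h⟩
  rw [flow, dif_pos hex]
  exact hex.choose_spec.unique h

/-! ### The first integral -/

theorem H_eq_of_isSol {η : ℝ} {γ : ℝ → E4} {s : Set ℝ} (h : IsSol η γ s) (hs : s.OrdConnected)
    {t u : ℝ} (ht : t ∈ s) (hu : u ∈ s) : H η (γ t) = H η (γ u) := by
  have hd : ∀ v ∈ s, HasDerivWithinAt (fun v => H η (γ v)) 0 s v := fun v hv => by
    have := (((((h.coord hv 0).pow 2).div_const 2).sub (((h.coord hv 0).pow 3).div_const 3)).sub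
      (((h.coord hv 1).pow 2).const_mul (η / 2))).add ((h.coord hv 1).mul (h.coord hv 3)) |>.sub
      (((h.coord hv 2).pow 2).div_const 2)
    refine (this.congr_deriv ?_).congr_of_mem (fun w _ => ?_) hv
    · simp only [X_apply_zero, X_apply_one, X_apply_two, X_apply_three]; push_cast; ring
    · simp [H]
  have := hs.convex.norm_image_sub_le_of_norm_hasDerivWithin_le (C := 0) hd (by simp) hu ht
  simpa [sub_eq_zero] using this

/-! ### Successive hits of the cross section -/

theorem FirstHit.unique {η : ℝ} {x y y' : E4} (h : FirstHit η x y) (h' : FirstHit η x y') :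
    y = y' := by
  obtain ⟨T, γ, hT, hγ, h0, rfl, hS, hn⟩ := h
  obtain ⟨T', γ', hT', hγ', h0', rfl, hS', hn'⟩ := h'
  have key : ∀ {T T' : ℝ} {γ γ' : ℝ → E4}, 0 < T → IsSol η γ (Icc 0 T) → γ 0 = x →
      IsSol η γ' (Icc 0 T') → γ' 0 = x → γ T ∈ S → (∀ t ∈ Ioo 0 T', γ' t ∉ S) → T ≤ T' →
      γ T = γ' T ∧ T = T' := by
    intro T T' γ γ' hT hγ h0 hγ' h0' hS hn hle
    have e := hγ.eqOn ordConnected_Icc (left_mem_Icc.2 hT.le)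
      (hγ'.mono (Icc_subset_Icc le_rfl hle)) (h0.trans h0'.symm) (right_mem_Icc.2 hT.le)
    refine ⟨e, hle.eq_of_not_lt fun hlt => hn T ⟨hT, hlt⟩ (e ▸ hS)⟩
  rcases le_total T T' with hle | hle
  · obtain ⟨e, rfl⟩ := key hT hγ h0 hγ' h0' hS hn' hle
    exact e
  · obtain ⟨e, rfl⟩ := key hT' hγ' h0' hγ h0 hS' hn hle
    exact e.symm

theorem poincareMap_eq {η : ℝ} {x y : E4} (h : FirstHit η x y) : poincareMap η x = y := by
  have hex : ∃ y, FirstHit η x y := ⟨y, h⟩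
  rw [poincareMap, dif_pos hex]
  exact hex.choose_spec.unique h

/-- Both orbits are run back from `y`. If the hitting times differed, the start of the shorter orbit
would be a point of `S` on the longer one strictly before its first hit. -/
theorem FirstHit.injective {η : ℝ} {x x' y : E4} (hx : x ∈ S) (hx' : x' ∈ S)
    (h : FirstHit η x y) (h' : FirstHit η x' y) : x = x' := by
  have key : ∀ {x x' : E4} {T T' : ℝ} {γ γ' : ℝ → E4}, 0 < T → IsSol η γ (Icc 0 T) → γ 0 = x →
      IsSol η γ' (Icc 0 T') → γ' 0 = x' → γ T = γ' T' → x ∈ S →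
      (∀ t ∈ Ioo 0 T', γ' t ∉ S) → T ≤ T' → x = x' := by
    intro x x' T T' γ γ' hT hγ h0 hγ' h0' hy hS hn hle
    have e := (hγ.shift (s' := Icc (-T) 0) T fun t ht => ⟨by linarith [ht.1], by linarith [ht.2]⟩).eqOn
      ordConnected_Icc (right_mem_Icc.2 (by linarith))
      (hγ'.shift (s' := Icc (-T) 0) T' fun t ht => ⟨by linarith [ht.1], by linarith [ht.2]⟩)
      (by simpa using hy) (left_mem_Icc.2 (by linarith))
    simp only [neg_add_cancel, h0] at e
    rcases hle.eq_or_lt with rfl | hlt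
    · simpa [h0'] using e
    · exact absurd (e ▸ hS) (hn _ ⟨by linarith, by linarith⟩)
  obtain ⟨T, γ, hT, hγ, h0, hy, hS, hn⟩ := h
  obtain ⟨T', γ', hT', hγ', h0', hy', hS', hn'⟩ := h'
  rcases le_total T T' with hle | hle
  · exact key hT hγ h0 hγ' h0' (hy.trans hy'.symm) hx hn' hle
  · exact (key hT' hγ' h0' hγ h0 (hy'.trans hy.symm) hx' hn hle).symm

/-- The points of `hits` are characterized by the number of crossings of `S`. -/
theorem mem_hits_iff {η : ℝ} {D : Set E4} {k : ℕ} {y : E4} :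
    y ∈ hits η D (k + 1) ↔ ∃ p ∈ D, ∃ T > 0, ∃ γ : ℝ → E4, IsSol η γ (Icc 0 T) ∧ γ 0 = p ∧
      γ T = y ∧ y ∈ S ∧ {t | t ∈ Ioc 0 T ∧ γ t ∈ S}.encard = k + 1 := by
  induction k generalizing y with
  | zero =>
    constructor
    · rintro ⟨p, hp, T, γ, hT, hγ, h0, hy, hS, hn⟩
      refine ⟨p, hp, T, hT, γ, hγ, h0, hy, hS, ?_⟩
      have : {t | t ∈ Ioc 0 T ∧ γ t ∈ S} = {T} := by
        ext t
        simp only [mem_ofPred_eq, mem_singleton_iff]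
        refine ⟨fun ht => ht.1.2.eq_of_not_lt fun hlt => hn t ⟨ht.1.1, hlt⟩ ht.2, ?_⟩
        rintro rfl
        exact ⟨⟨hT, le_rfl⟩, hy ▸ hS⟩
      rw [this, encard_singleton]; rfl
    · rintro ⟨p, hp, T, hT, γ, hγ, h0, hy, hS, hc⟩
      refine ⟨p, hp, T, γ, hT, hγ, h0, hy, hS, fun t ht hS' => ?_⟩
      obtain ⟨u, hu⟩ := encard_eq_one.1 (by simpa using hc)
      have h1 : t ∈ ({u} : Set ℝ) := hu ▸ ⟨⟨ht.1, ht.2.le⟩, hS'⟩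
      have h2 : T ∈ ({u} : Set ℝ) := hu ▸ ⟨⟨hT, le_rfl⟩, hy ▸ hS⟩
      exact ht.2.ne (h1.trans h2.symm)
  | succ k ih =>
    constructor
    · rintro ⟨x, hx, T₂, γ₂, hT₂, hγ₂, h0₂, hy, hS, hn⟩
      obtain ⟨p, hp, T, hT, γ, hγ, h0, hx', hxS, hc⟩ := ih.1 hx
      have hsh : IsSol η (fun t => γ₂ (t + -T)) (Icc T (T + T₂)) :=
        IsSol.shift hγ₂ (-T) fun t ht => ⟨by linarith [ht.1], by linarith [ht.2]⟩
      have hg := hγ.glue hsh (b := T) (fun t ht => ht.2) (fun t ht => ht.1) ⟨hT.le, le_rfl⟩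
        ⟨le_rfl, by linarith⟩ (by simp [hx', h0₂])
      rw [Icc_union_Icc_eq_Icc hT.le (by linarith)] at hg
      refine ⟨p, hp, T + T₂, by positivity, _, hg, by simp [hT.le, h0], by simp [hT₂.not_ge, hy], hS, ?_⟩
      have : {t | t ∈ Ioc 0 (T + T₂) ∧ (if t ≤ T then γ t else γ₂ (t + -T)) ∈ S} =
          insert (T + T₂) {t | t ∈ Ioc 0 T ∧ γ t ∈ S} := by
        ext t
        simp only [mem_ofPred_eq, mem_insert_iff]
        constructor
        · rintro ⟨ht, htS⟩
          by_cases htT : t ≤ T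
          · exact Or.inr ⟨⟨ht.1, htT⟩, by simpa [htT] using htS⟩
          · refine Or.inl (ht.2.eq_of_not_lt fun hlt => hn (t + -T) ⟨?_, ?_⟩ (by simpa [htT] using htS))
            · linarith
            · linarith
        · rintro (rfl | ⟨ht, htS⟩)
          · exact ⟨⟨by linarith, le_rfl⟩, by simpa [hT₂.not_ge, hy] using hS⟩
          · exact ⟨⟨ht.1, by linarith [ht.2]⟩, by simpa [ht.2] using htS⟩
      rw [this, encard_insert_of_notMem fun h => by linarith [h.1.2], hc]
      push_cast; rfl
    · rintro ⟨p, hp, T, hT, γ, hγ, h0, hy, hS, hc⟩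
      set Z := {t | t ∈ Ioc 0 T ∧ γ t ∈ S} with hZ
      have hTZ : T ∈ Z := ⟨⟨hT, le_rfl⟩, hy ▸ hS⟩
      have hfin : Z.Finite := finite_of_encard_eq_coe (k := k + 1 + 1) (by rw [hc]; push_cast; rfl)
      have hc' : (Z \ {T}).encard = k + 1 := by
        have := encard_sdiff_singleton_add_one hTZ
        rw [hc] at this
        push_cast at this
        exact WithTop.add_right_cancel ENat.one_ne_top this
      have hne : (Z \ {T}).Nonempty := by
        rw [← encard_pos, hc']; positivity
      -- The last crossing before `T` is the hit with the preceding index.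
      obtain ⟨T₁, ⟨⟨hT₁, hT₁S⟩, hT₁ne⟩, hmax⟩ :=
        (hfin.subset sdiff_subset).exists_maximal hne
      have hlt : T₁ < T := lt_of_le_of_ne hT₁.2 hT₁ne
      have hmax' : ∀ t ∈ Z \ {T}, t ≤ T₁ := fun t ht => (le_total t T₁).elim id (hmax ht)
      refine ⟨γ T₁, ih.2 ⟨p, hp, T₁, hT₁.1, γ, hγ.mono (Icc_subset_Icc le_rfl hlt.le), h0, rfl,
        hT₁S, ?_⟩, T - T₁, fun t => γ (t + T₁), by linarith, hγ.shift T₁ fun t ht =>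
          ⟨by linarith [ht.1, hT₁.1], by linarith [ht.2]⟩, by simp, by simp [hy], hS, fun t ht h => ?_⟩
      · rw [← hc']
        congr 1
        ext t
        simp only [mem_ofPred_eq, Set.mem_sdiff, mem_singleton_iff]
        refine ⟨fun ht => ⟨⟨⟨ht.1.1, ht.1.2.trans hlt.le⟩, ht.2⟩, (ht.1.2.trans_lt hlt).ne⟩,
          fun ht => ⟨⟨ht.1.1.1, hmax' t ht⟩, ht.1.2⟩⟩
      · have := hmax' (t + T₁) ⟨⟨⟨by linarith [ht.1, hT₁.1], by linarith [ht.2]⟩, h⟩,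
          fun h => by rw [mem_singleton_iff] at h; linarith [ht.2]⟩
        linarith [ht.1]

theorem hits_union {η : ℝ} {D D' : Set E4} {k : ℕ} :
    hits η D k ∪ hits η D' k = hits η (D ∪ D') k := by
  induction k with
  | zero => rfl
  | succ k ih =>
    ext y
    simp only [hits, ← ih, mem_union, mem_ofPred_eq]
    constructor
    · rintro (⟨p, hp, h⟩ | ⟨p, hp, h⟩)
      exacts [⟨p, Or.inl hp, h⟩, ⟨p, Or.inr hp, h⟩]
    · rintro ⟨p, hp | hp, h⟩
      exacts [Or.inl ⟨p, hp, h⟩, Or.inr ⟨p, hp, h⟩]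

theorem sigmaU_eq {η : ℝ} {a b : E2 → ℝ} {r : ℝ} {k : ℕ} :
    SigmaU η a b r k = hits η (Du a b r) k := hits_union

/-! ### Monotonicity from the sign of the derivative within an interval -/

theorem monotoneOn_of_hasDerivWithinAt {f f' : ℝ → ℝ} {s : Set ℝ} (hs : s.OrdConnected)
    (h : ∀ t ∈ s, HasDerivWithinAt f (f' t) s t) (h0 : ∀ t ∈ s, 0 ≤ f' t) : MonotoneOn f s :=
  monotoneOn_of_hasDerivWithinAt_nonneg hs.convex (fun t ht => (h t ht).continuousWithinAt)
    (fun t ht => (h t (interior_subset ht)).mono interior_subset)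
    fun t ht => h0 t (interior_subset ht)

theorem antitoneOn_of_hasDerivWithinAt {f f' : ℝ → ℝ} {s : Set ℝ} (hs : s.OrdConnected)
    (h : ∀ t ∈ s, HasDerivWithinAt f (f' t) s t) (h0 : ∀ t ∈ s, f' t ≤ 0) : AntitoneOn f s :=
  antitoneOn_of_hasDerivWithinAt_nonpos hs.convex (fun t ht => (h t ht).continuousWithinAt)
    (fun t ht => (h t (interior_subset ht)).mono interior_subset)
    fun t ht => h0 t (interior_subset ht)

/-! ### The local unstable manifold -/

theorem rho_pos {η : ℝ} (hη : η ∈ Ioo (-2 : ℝ) 2) : 0 < rho η :=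
  div_pos (Real.sqrt_pos.2 (by linarith [hη.1])) two_pos

theorem rho_sq {η : ℝ} (hη : η ∈ Ioo (-2 : ℝ) 2) : rho η ^ 2 = (η + 2) / 4 := by
  rw [rho, div_pow, Real.sq_sqrt (by linarith [hη.1])]; norm_num

theorem omega_sq {η : ℝ} (hη : η ∈ Ioo (-2 : ℝ) 2) : omega η ^ 2 = (-η + 2) / 4 := by
  rw [omega, div_pow, Real.sq_sqrt (by linarith [hη.2])]; norm_num

theorem rho_lt_one {η : ℝ} (hη : η ∈ Ioo (-2 : ℝ) 2) : rho η < 1 := by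
  have := rho_sq hη
  nlinarith [hη.2, rho_pos hη]

/-- The projection to the plane of the coordinates `(x₁, x₂)`. -/
def base : E4 →L[ℝ] E2 :=
  (EuclideanSpace.equiv (Fin 2) ℝ).symm.toContinuousLinearMap.comp
    (ContinuousLinearMap.pi ![EuclideanSpace.proj 0, EuclideanSpace.proj 1])

@[simp] theorem base_zero (x : E4) : base x 0 = x 0 := rfl
@[simp] theorem base_one (x : E4) : base x 1 = x 1 := rfl

theorem norm_sq_E2 (u : E2) : ‖u‖ ^ 2 = u 0 ^ 2 + u 1 ^ 2 := by
  simp [EuclideanSpace.norm_sq_eq, Fin.sum_univ_two]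

theorem norm_base_sq (x : E4) : ‖base x‖ ^ 2 = x 0 ^ 2 + x 1 ^ 2 := norm_sq_E2 _

/-- The point `x` lies on the graph of `(a, b)`. -/
def OnGraph (a b : E2 → ℝ) (x : E4) : Prop := x 2 = a (base x) ∧ x 3 = b (base x)

@[simp] theorem base_graphMap (a b : E2 → ℝ) (u : E2) : base (graphMap a b u) = u := by
  ext i; fin_cases i <;> rfl

theorem onGraph_graphMap (a b : E2 → ℝ) (u : E2) : OnGraph a b (graphMap a b u) := by
  rw [OnGraph, base_graphMap]; exact ⟨rfl, rfl⟩

theorem OnGraph.graphMap_base {a b : E2 → ℝ} {x : E4} (h : OnGraph a b x) :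
    graphMap a b (base x) = x := by
  ext i; fin_cases i
  exacts [rfl, rfl, h.1.symm, h.2.symm]

/-- The two half-open ranges of angles together run once through the circle. -/
theorem du_eq {a b : E2 → ℝ} {r : ℝ} (hr : 0 < r) :
    Du a b r = graphMap a b '' Metric.sphere 0 r := by
  have hs : Metric.sphere (0 : E2) r =
      (fun θ : ℝ => (!₂[r * Real.cos θ, r * Real.sin θ] : E2)) '' Ioc 0 (2 * Real.pi) := by
    ext u
    simp only [mem_sphere_zero_iff_norm, mem_image]
    constructor
    · intro hu
      have h2 : u 0 ^ 2 + u 1 ^ 2 = r ^ 2 := by rw [← norm_sq_E2, hu]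
      let z : ℂ := ⟨u 0, u 1⟩
      have hz : ‖z‖ = r := by
        rw [Complex.norm_def, Complex.normSq_mk, ← sq, ← sq, h2, Real.sqrt_sq hr.le]
      have hc : r * Real.cos z.arg = u 0 := by rw [← hz]; exact Complex.norm_mul_cos_arg z
      have hs : r * Real.sin z.arg = u 1 := by rw [← hz]; exact Complex.norm_mul_sin_arg z
      -- The argument lies in `(-π, π]` and is moved into `(0, 2π]`.
      rcases le_or_gt z.arg 0 with h0 | h0
      · refine ⟨z.arg + 2 * Real.pi, ⟨by linarith [Complex.neg_pi_lt_arg z, Real.pi_pos],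
          by linarith⟩, ?_⟩
        ext i; fin_cases i
        · simpa using hc
        · simpa using hs
      · refine ⟨z.arg, ⟨h0, by linarith [Complex.arg_le_pi z, Real.pi_pos]⟩, ?_⟩
        ext i; fin_cases i
        · simpa using hc
        · simpa using hs
    · rintro ⟨θ, -, rfl⟩
      refine (sq_eq_sq₀ (norm_nonneg _) hr.le).1 ?_
      rw [norm_sq_E2]
      simp only [Matrix.cons_val_zero, Matrix.cons_val_one]
      linear_combination r ^ 2 * Real.cos_sq_add_sin_sq θ
  rw [hs, image_image, Du, DuPlus, DuMinus, ← image_union,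
    Ioc_union_Ioc_eq_Ioc Real.pi_pos.le (by linarith [Real.pi_pos])]
  rfl

/-! ### Solutions near the local graph: invariance, behaviour in the past, size of the disc -/

section

variable {η δ : ℝ} {a b : E2 → ℝ} (hab : IsLocalUnstableGraph η δ a b)
include hab

theorem differentiableAt_a {u : E2} (hu : u ∈ Metric.ball (0 : E2) δ) : DifferentiableAt ℝ a u :=
  (hab.analytic_a u hu).differentiableAt

theorem differentiableAt_b {u : E2} (hu : u ∈ Metric.ball (0 : E2) δ) : DifferentiableAt ℝ b u :=
  (hab.analytic_b u hu).differentiableAt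

theorem contDiffAt_graphMap {u : E2} (hu : u ∈ Metric.ball (0 : E2) δ) :
    ContDiffAt ℝ 1 (graphMap a b) u := by
  have ha := (hab.analytic_a u hu).contDiffAt (n := 1)
  have hb := (hab.analytic_b u hu).contDiffAt (n := 1)
  refine contDiffAt_euclidean.2 fun i => ?_
  fin_cases i
  · exact (EuclideanSpace.proj 0 : E2 →L[ℝ] ℝ).contDiff.contDiffAt
  · exact (EuclideanSpace.proj 1 : E2 →L[ℝ] ℝ).contDiff.contDiffAt
  · exact ha
  · exact hb

theorem continuousOn_graphMap : ContinuousOn (graphMap a b) (Metric.ball 0 δ) :=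
  fun _ hu => (contDiffAt_graphMap hab hu).continuousAt.continuousWithinAt

/-- The third component of the invariance equation. -/
theorem fderiv_a_field {u : E2} (hu : u ∈ Metric.ball (0 : E2) δ) :
    fderiv ℝ a u !₂[u 1, a u] = b u := by
  have hd := (contDiffAt_graphMap hab hu).differentiableAt one_ne_zero
  have h1 := ((EuclideanSpace.proj 2 : E4 →L[ℝ] ℝ).hasFDerivAt.comp u hd.hasFDerivAt).fderiv
  have h2 : (EuclideanSpace.proj 2 : E4 →L[ℝ] ℝ) ∘ graphMap a b = a := rfl
  rw [h2] at h1
  rw [h1, ContinuousLinearMap.comp_apply, hab.invariant u hu]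
  rfl

theorem fderiv_b_field {u : E2} (hu : u ∈ Metric.ball (0 : E2) δ) :
    fderiv ℝ b u !₂[u 1, a u] = -u 0 + η * a u + u 0 ^ 2 := by
  have hd := (contDiffAt_graphMap hab hu).differentiableAt one_ne_zero
  have h1 := ((EuclideanSpace.proj 3 : E4 →L[ℝ] ℝ).hasFDerivAt.comp u hd.hasFDerivAt).fderiv
  have h2 : (EuclideanSpace.proj 3 : E4 →L[ℝ] ℝ) ∘ graphMap a b = b := rfl
  rw [h2] at h1
  rw [h1, ContinuousLinearMap.comp_apply, hab.invariant u hu]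
  rfl

omit hab in
-- With `c` the value of `a`, the planar velocity splits into the reduced field on the graph and a
-- multiple of the deviation `x₃ - a`. This makes the equation for the deviation linear.
theorem base_X (η : ℝ) (x : E4) (c : ℝ) :
    base (X η x) = !₂[base x 1, c] + (x 2 - c) • EuclideanSpace.single (1 : Fin 2) (1 : ℝ) := by
  ext i; fin_cases i <;> simp

/-- The deviation from the graph satisfies a linear equation. -/
theorem hasDerivWithinAt_deviation {γ : ℝ → E4} {s : Set ℝ} (h : IsSol η γ s) {t : ℝ} (ht : t ∈ s)
    (hu : base (γ t) ∈ Metric.ball (0 : E2) δ) :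
    HasDerivWithinAt (fun t => γ t 2 - a (base (γ t)))
      ((γ t 3 - b (base (γ t))) - fderiv ℝ a (base (γ t)) (EuclideanSpace.single 1 1) *
        (γ t 2 - a (base (γ t)))) s t ∧
    HasDerivWithinAt (fun t => γ t 3 - b (base (γ t)))
      ((η - fderiv ℝ b (base (γ t)) (EuclideanSpace.single 1 1)) *
        (γ t 2 - a (base (γ t)))) s t := by
  have hbase := base.hasFDerivAt.comp_hasDerivWithinAt t (h t ht)
  have hA := (differentiableAt_a hab hu).hasFDerivAt.comp_hasDerivWithinAt t hbase
  have hB := (differentiableAt_b hab hu).hasFDerivAt.comp_hasDerivWithinAt t hbase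
  refine ⟨((h.coord ht 2).sub hA).congr_deriv ?_, ((h.coord ht 3).sub hB).congr_deriv ?_⟩
  · rw [base_X η (γ t) (a (base (γ t))), map_add, map_smul, fderiv_a_field hab hu]
    simp only [X_apply_two, smul_eq_mul]; ring
  · rw [base_X η (γ t) (a (base (γ t))), map_add, map_smul, fderiv_b_field hab hu]
    simp only [X_apply_three, smul_eq_mul, base_zero]; ring

/-- The graph is locally invariant. -/
theorem onGraph_of_isSol {γ : ℝ → E4} {s : Set ℝ} (hs : s.OrdConnected) (h : IsSol η γ s)
    (hu : ∀ t ∈ s, base (γ t) ∈ Metric.ball (0 : E2) δ) {t₀ t : ℝ} (ht₀ : t₀ ∈ s)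
    (h0 : OnGraph a b (γ t₀)) (ht : t ∈ s) : OnGraph a b (γ t) := by
  have hsub : uIcc t₀ t ⊆ s := hs.uIcc_subset ht₀ ht
  replace h := h.mono hsub
  replace hu : ∀ v ∈ uIcc t₀ t, base (γ v) ∈ Metric.ball (0 : E2) δ := fun v hv => hu v (hsub hv)
  have hbc : ContinuousOn (fun t => base (γ t)) (uIcc t₀ t) :=
    base.continuous.comp_continuousOn h.continuousOn
  have hca : ContinuousOn (fun t => fderiv ℝ a (base (γ t)) (EuclideanSpace.single 1 1))
      (uIcc t₀ t) :=
    (hab.analytic_a.fderiv.continuousOn.comp hbc hu).clm_apply continuousOn_const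
  have hcb : ContinuousOn (fun t => fderiv ℝ b (base (γ t)) (EuclideanSpace.single 1 1))
      (uIcc t₀ t) :=
    (hab.analytic_b.fderiv.continuousOn.comp hbc hu).clm_apply continuousOn_const
  obtain ⟨A, hA⟩ := isCompact_uIcc.exists_bound_of_continuousOn hca
  obtain ⟨B, hB⟩ := isCompact_uIcc.exists_bound_of_continuousOn hcb
  set z₁ := fun t => γ t 2 - a (base (γ t)) with hz₁
  set z₂ := fun t => γ t 3 - b (base (γ t)) with hz₂
  have hN : ∀ v ∈ uIcc t₀ t, HasDerivWithinAt (fun v => z₁ v ^ 2 + z₂ v ^ 2)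
      (2 * z₁ v * (z₂ v - fderiv ℝ a (base (γ v)) (EuclideanSpace.single 1 1) * z₁ v) +
       2 * z₂ v * ((η - fderiv ℝ b (base (γ v)) (EuclideanSpace.single 1 1)) * z₁ v))
      (uIcc t₀ t) v := fun v hv => by
    obtain ⟨d₁, d₂⟩ := hasDerivWithinAt_deviation hab h hv (hu v hv)
    refine ((d₁.pow 2).add (d₂.pow 2)).congr_deriv ?_
    push_cast; ring
  -- A bound for the exponential rate at which the squared deviation can change, using `2|z₁z₂| ≤
  -- z₁² + z₂²`.
  set c := 1 + |η| + 2 * |A| + 2 * |B| with hc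
  have hbd : ∀ v ∈ uIcc t₀ t,
      |2 * z₁ v * (z₂ v - fderiv ℝ a (base (γ v)) (EuclideanSpace.single 1 1) * z₁ v) +
       2 * z₂ v * ((η - fderiv ℝ b (base (γ v)) (EuclideanSpace.single 1 1)) * z₁ v)| ≤
      c * (z₁ v ^ 2 + z₂ v ^ 2) := fun v hv => by
    have hA' := (hA v hv).trans (le_abs_self A)
    have hB' := (hB v hv).trans (le_abs_self B)
    rw [Real.norm_eq_abs] at hA' hB'
    generalize fderiv ℝ a (base (γ v)) (EuclideanSpace.single 1 1) = α at *
    generalize fderiv ℝ b (base (γ v)) (EuclideanSpace.single 1 1) = β at *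
    have e : 2 * z₁ v * (z₂ v - α * z₁ v) + 2 * z₂ v * ((η - β) * z₁ v) =
      (1 + η - β) * (2 * (z₁ v * z₂ v)) + (- (2 * α)) * z₁ v ^ 2 := by ring
    have h1 : |2 * (z₁ v * z₂ v)| ≤ z₁ v ^ 2 + z₂ v ^ 2 := by
      rw [abs_le]; constructor <;> nlinarith [sq_nonneg (z₁ v + z₂ v), sq_nonneg (z₁ v - z₂ v)]
    have h2 : |1 + η - β| ≤ 1 + |η| + |B| := by
      calc |1 + η - β| ≤ |1 + η| + |β| := abs_sub _ _
        _ ≤ |1| + |η| + |β| := by gcongr; exact abs_add_le _ _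
        _ ≤ _ := by rw [abs_one]; gcongr
    have h3 : |-(2 * α)| ≤ 2 * |A| := by rw [abs_neg, abs_mul, abs_two]; gcongr
    rw [e]
    calc _ ≤ |1 + η - β| * |2 * (z₁ v * z₂ v)| + |-(2 * α)| * |z₁ v ^ 2| := by
          rw [← abs_mul, ← abs_mul]; exact abs_add_le _ _
      _ ≤ (1 + |η| + |B|) * (z₁ v ^ 2 + z₂ v ^ 2) + 2 * |A| * (z₁ v ^ 2 + z₂ v ^ 2) := by
          gcongr
          rw [abs_of_nonneg (sq_nonneg _)]; linarith [sq_nonneg (z₂ v)]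
      _ ≤ _ := by
          rw [hc]; nlinarith [abs_nonneg B, sq_nonneg (z₁ v), sq_nonneg (z₂ v),
            mul_nonneg (abs_nonneg B) (sq_nonneg (z₁ v)), mul_nonneg (abs_nonneg B) (sq_nonneg (z₂ v))]
  have hexp : ∀ (k v : ℝ), HasDerivWithinAt (fun v => Real.exp (k * v)) (k * Real.exp (k * v))
      (uIcc t₀ t) v := fun k v => by
    have := ((hasDerivAt_id v).const_mul k).exp.hasDerivWithinAt (s := uIcc t₀ t)
    simpa [mul_comm] using this
  have hz0 : z₁ t₀ ^ 2 + z₂ t₀ ^ 2 = 0 := by simp [hz₁, hz₂, h0.1, h0.2]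
  -- The weight `exp (-c v)` makes the squared deviation nonincreasing, and `exp (c v)` makes it
  -- nondecreasing. So its zero at `t₀` spreads forwards and backwards.
  have hfin : z₁ t ^ 2 + z₂ t ^ 2 ≤ 0 := by
    rcases le_total t₀ t with hle | hle
    · have hanti := antitoneOn_of_hasDerivWithinAt ordConnected_uIcc
        (fun v hv => (hN v hv).mul (hexp (-c) v)) (fun v hv => by
          have := (abs_le.1 (hbd v hv)).2
          have he := Real.exp_pos (-c * v)
          nlinarith)
      have := hanti left_mem_uIcc right_mem_uIcc hle
      simp only [Pi.mul_apply, hz0, zero_mul] at this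
      exact nonpos_of_mul_nonpos_left this (Real.exp_pos _)
    · have hmono := monotoneOn_of_hasDerivWithinAt ordConnected_uIcc
        (fun v hv => (hN v hv).mul (hexp c v)) (fun v hv => by
          have := (abs_le.1 (hbd v hv)).1
          have he := Real.exp_pos (c * v)
          nlinarith)
      have := hmono right_mem_uIcc left_mem_uIcc hle
      simp only [Pi.mul_apply, hz0, zero_mul] at this
      exact nonpos_of_mul_nonpos_left this (Real.exp_pos _)
  have q1 : z₁ t = 0 := by nlinarith [sq_nonneg (z₁ t), sq_nonneg (z₂ t)]
  have q2 : z₂ t = 0 := by nlinarith [sq_nonneg (z₁ t), sq_nonneg (z₂ t)]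
  exact ⟨sub_eq_zero.1 q1, sub_eq_zero.1 q2⟩

/-- In the far past, a solution that tends to the origin backwards in time is on the graph. -/
theorem eventually_onGraph (hη : η ∈ Ioo (-2 : ℝ) 2) (hδ : 0 < δ) {γ : ℝ → E4} {c : ℝ}
    (h : IsSol η γ (Iic c)) (h0 : Tendsto γ atBot (𝓝 0)) :
    ∀ᶠ t in atBot, OnGraph a b (γ t) := by
  have hball : Metric.ball (0 : E2) δ ∈ 𝓝 (0 : E2) := Metric.ball_mem_nhds _ hδ
  have hb0 : Tendsto (fun t => base (γ t)) atBot (𝓝 0) := by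
    simpa [Function.comp_def] using (base.continuous.tendsto 0).comp h0
  have hρ := rho_pos hη
  have hρ1 := rho_lt_one hη
  have hfa : Tendsto (fun t => fderiv ℝ a (base (γ t)) (EuclideanSpace.single 1 1)) atBot
      (𝓝 (2 * rho η)) := by
    have hc : ContinuousAt (fun u => fderiv ℝ a u (EuclideanSpace.single 1 1)) 0 :=
      (hab.analytic_a.fderiv.continuousOn.continuousAt hball).clm_apply continuousAt_const
    have := hc.tendsto.comp hb0
    rw [hab.tangent_a] at this
    simpa [Function.comp_def] using this
  have hfb : Tendsto (fun t => fderiv ℝ b (base (γ t)) (EuclideanSpace.single 1 1)) atBot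
      (𝓝 (η + 1)) := by
    have hc : ContinuousAt (fun u => fderiv ℝ b u (EuclideanSpace.single 1 1)) 0 :=
      (hab.analytic_b.fderiv.continuousOn.continuousAt hball).clm_apply continuousAt_const
    have := hc.tendsto.comp hb0
    rw [hab.tangent_b, rho_sq hη, omega_sq hη] at this
    have e : -2 * rho η * ((η + 2) / 4 + (-η + 2) / 4) * (EuclideanSpace.single (1 : Fin 2) (1 : ℝ)) 0 +
        (3 * ((η + 2) / 4) - (-η + 2) / 4) * (EuclideanSpace.single (1 : Fin 2) (1 : ℝ)) 1 = η + 1 := by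
      simp; ring
    rwa [e] at this
  obtain ⟨t₀, ht₀⟩ := eventually_atBot.1 ((hb0.eventually hball).and
    ((Metric.tendsto_nhds.1 hfa (rho η / 10) (by positivity)).and
      ((Metric.tendsto_nhds.1 hfb (rho η / 10) (by positivity)).and (eventually_le_atBot c))))
  set z₁ := fun t => γ t 2 - a (base (γ t)) with hz₁
  set z₂ := fun t => γ t 3 - b (base (γ t)) with hz₂
  have hs : Iic t₀ ⊆ Iic c := fun t ht => (ht₀ t ht).2.2.2
  -- To first order `z₁' = z₂ - 2ρ z₁` and `z₂' = -z₁`, a stable focus. The form `z₁² + z₂²` has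
  -- derivative `-4ρ z₁²`, which does not see `z₂`; the cross term turns it into `-ρ(3z₁² - 2ρ z₁z₂
  -- + z₂²)`. Errors of size `ρ/10` in the two coefficients contribute at most `ρ/2 · (z₁² + z₂²)`,
  -- which this absorbs.
  have hanti : AntitoneOn (fun t => z₁ t ^ 2 - rho η * (z₁ t * z₂ t) + z₂ t ^ 2) (Iic t₀) := by
    refine antitoneOn_of_hasDerivWithinAt (f' := fun t => 2 * z₁ t * (z₂ t - fderiv ℝ a (base (γ t)) (EuclideanSpace.single 1 1) * z₁ t) -
        rho η * ((z₂ t - fderiv ℝ a (base (γ t)) (EuclideanSpace.single 1 1) * z₁ t) * z₂ t +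
        z₁ t * ((η - fderiv ℝ b (base (γ t)) (EuclideanSpace.single 1 1)) * z₁ t)) +
        2 * z₂ t * ((η - fderiv ℝ b (base (γ t)) (EuclideanSpace.single 1 1)) * z₁ t))
        ordConnected_Iic (fun t ht => ?_) ?_
    · obtain ⟨d₁, d₂⟩ := hasDerivWithinAt_deviation hab (h.mono hs) ht (ht₀ t ht).1
      refine (((d₁.pow 2).sub ((d₁.mul d₂).const_mul (rho η))).add (d₂.pow 2)).congr_deriv ?_
      push_cast; ring
    · intro t ht
      obtain ⟨-, h1, h2, -⟩ := ht₀ t ht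
      rw [Real.dist_eq] at h1 h2
      dsimp only
      obtain ⟨α, hα⟩ : ∃ α, fderiv ℝ a (base (γ t)) (EuclideanSpace.single 1 1) = 2 * rho η + α :=
        ⟨_, (add_sub_cancel _ _).symm⟩
      obtain ⟨β, hβ⟩ : ∃ β, fderiv ℝ b (base (γ t)) (EuclideanSpace.single 1 1) = η + 1 + β :=
        ⟨_, (add_sub_cancel _ _).symm⟩
      rw [hα] at h1 ⊢
      rw [hβ] at h2 ⊢
      rw [add_sub_cancel_left] at h1 h2
      generalize z₁ t = x
      generalize z₂ t = y
      generalize rho η = ρ at *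
      have e : 2 * x * (y - (2 * ρ + α) * x) - ρ * ((y - (2 * ρ + α) * x) * y +
          x * ((η - (η + 1 + β)) * x)) + 2 * y * ((η - (η + 1 + β)) * x) =
          -ρ * (3 * x ^ 2 - ρ * (2 * (x * y)) + y ^ 2) + (α * (-2 * x ^ 2 + ρ * (x * y)) +
            β * (ρ * x ^ 2 - 2 * (x * y))) := by ring
      rw [e]
      have hxy : |x * y| ≤ (x ^ 2 + y ^ 2) / 2 := by
        rw [abs_le]; constructor <;> nlinarith [sq_nonneg (x + y), sq_nonneg (x - y)]
      have hxy2 : |x * y| ≤ x ^ 2 + y ^ 2 / 4 := by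
        rw [abs_le]; constructor <;> nlinarith [sq_nonneg (x + y / 2), sq_nonneg (x - y / 2)]
      have hρxy : ρ * (2 * (x * y)) ≤ 2 * x ^ 2 + y ^ 2 / 2 := by
        have : ρ * (x * y) ≤ 1 * |x * y| := by
          calc ρ * (x * y) ≤ ρ * |x * y| := by gcongr; exact le_abs_self _
            _ ≤ _ := by gcongr
        linarith
      have k1 : |-2 * x ^ 2 + ρ * (x * y)| ≤ 5 / 2 * (x ^ 2 + y ^ 2) := by
        calc _ ≤ |-2 * x ^ 2| + |ρ * (x * y)| := abs_add_le _ _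
          _ = 2 * x ^ 2 + ρ * |x * y| := by
            rw [abs_mul, abs_mul, abs_of_pos hρ, abs_of_nonneg (sq_nonneg x)]; norm_num
          _ ≤ 2 * x ^ 2 + 1 * ((x ^ 2 + y ^ 2) / 2) := by gcongr
          _ ≤ _ := by nlinarith [sq_nonneg y]
      have k2 : |ρ * x ^ 2 - 2 * (x * y)| ≤ 5 / 2 * (x ^ 2 + y ^ 2) := by
        calc _ ≤ |ρ * x ^ 2| + |2 * (x * y)| := abs_sub _ _
          _ = ρ * x ^ 2 + 2 * |x * y| := by
            rw [abs_mul, abs_mul, abs_of_pos hρ, abs_of_nonneg (sq_nonneg x)]; norm_num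
          _ ≤ 1 * x ^ 2 + 2 * ((x ^ 2 + y ^ 2) / 2) := by gcongr
          _ ≤ _ := by nlinarith [sq_nonneg y, sq_nonneg x]
      have m1 : α * (-2 * x ^ 2 + ρ * (x * y)) ≤ ρ / 10 * (5 / 2 * (x ^ 2 + y ^ 2)) := by
        refine (le_abs_self _).trans ?_
        rw [abs_mul]; gcongr
      have m2 : β * (ρ * x ^ 2 - 2 * (x * y)) ≤ ρ / 10 * (5 / 2 * (x ^ 2 + y ^ 2)) := by
        refine (le_abs_self _).trans ?_
        rw [abs_mul]; gcongr
      have m3 : ρ * ((x ^ 2 + y ^ 2) / 2) ≤ ρ * (3 * x ^ 2 - ρ * (2 * (x * y)) + y ^ 2) := by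
        gcongr; linarith [sq_nonneg x]
      linarith
  have hlim : Tendsto (fun t => z₁ t ^ 2 - rho η * (z₁ t * z₂ t) + z₂ t ^ 2) atBot (𝓝 0) := by
    have hca : Tendsto (fun t => a (base (γ t))) atBot (𝓝 0) := by
      have := ((differentiableAt_a hab (Metric.mem_ball_self hδ)).continuousAt.tendsto).comp hb0
      rwa [hab.a_zero] at this
    have hcb : Tendsto (fun t => b (base (γ t))) atBot (𝓝 0) := by
      have := ((differentiableAt_b hab (Metric.mem_ball_self hδ)).continuousAt.tendsto).comp hb0
      rwa [hab.b_zero] at this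
    have hi : ∀ i : Fin 4, Tendsto (fun t => γ t i) atBot (𝓝 0) := fun i =>
      ((EuclideanSpace.proj i : E4 →L[ℝ] ℝ).continuous.tendsto 0).comp h0
    have l1 : Tendsto z₁ atBot (𝓝 0) := by simpa using (hi 2).sub hca
    have l2 : Tendsto z₂ atBot (𝓝 0) := by simpa using (hi 3).sub hcb
    simpa using ((l1.pow 2).sub ((l1.mul l2).const_mul (rho η))).add (l2.pow 2)
  -- The form is nonincreasing in time with limit `0` at `-∞`, so it is at most `0`. It is positive
  -- definite, so the deviation vanishes.
  refine eventually_atBot.2 ⟨t₀, fun t ht => ?_⟩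
  have hle : z₁ t ^ 2 - rho η * (z₁ t * z₂ t) + z₂ t ^ 2 ≤ 0 :=
    ge_of_tendsto hlim (eventually_atBot.2 ⟨t, fun u hu => hanti (le_trans hu ht) ht hu⟩)
  have hpos : (z₁ t ^ 2 + z₂ t ^ 2) / 2 ≤ z₁ t ^ 2 - rho η * (z₁ t * z₂ t) + z₂ t ^ 2 := by
    have hxy : |z₁ t * z₂ t| ≤ (z₁ t ^ 2 + z₂ t ^ 2) / 2 := by
      rw [abs_le]; constructor <;> nlinarith [sq_nonneg (z₁ t + z₂ t), sq_nonneg (z₁ t - z₂ t)]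
    have : rho η * (z₁ t * z₂ t) ≤ 1 * |z₁ t * z₂ t| := by
      calc rho η * (z₁ t * z₂ t) ≤ rho η * |z₁ t * z₂ t| := by gcongr; exact le_abs_self _
        _ ≤ _ := by gcongr
    linarith
  have q1 : z₁ t = 0 := by nlinarith [sq_nonneg (z₁ t), sq_nonneg (z₂ t)]
  have q2 : z₂ t = 0 := by nlinarith [sq_nonneg (z₁ t), sq_nonneg (z₂ t)]
  exact ⟨sub_eq_zero.1 q1, sub_eq_zero.1 q2⟩

omit hab in
theorem continuous_H (η : ℝ) : Continuous (H η) := by unfold H; fun_prop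

omit hab in
theorem H_eq_zero_of_tendsto {γ : ℝ → E4} {c : ℝ} (h : IsSol η γ (Iic c))
    (h0 : Tendsto γ atBot (𝓝 0)) {t : ℝ} (ht : t ≤ c) : H η (γ t) = 0 := by
  have h1 : Tendsto (fun t => H η (γ t)) atBot (𝓝 (H η 0)) :=
    ((continuous_H η).tendsto 0).comp h0
  have h2 : Tendsto (fun u => H η (γ u)) atBot (𝓝 (H η (γ t))) :=
    tendsto_const_nhds.congr' ((eventually_le_atBot c).mono fun u hu =>
      H_eq_of_isSol h ordConnected_Iic ht hu)
  rw [tendsto_nhds_unique h2 h1]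
  simp [H]

omit hab in
theorem H_eq_zero_of_mem_unstableManifold {x : E4} (h : x ∈ unstableManifold η) : H η x = 0 := by
  obtain ⟨γ, hγ, rfl, h0⟩ := h
  exact H_eq_zero_of_tendsto hγ h0 le_rfl

/-- The local graph does not reach the second equilibrium of the reduced planar field. -/
theorem radius_le : δ ≤ 3 / 2 := by
  by_contra! hlt
  set u : E2 := !₂[3 / 2, 0] with hu
  have hub : u ∈ Metric.ball (0 : E2) δ := by
    rw [mem_ball_zero_iff]
    have h1 : ‖u‖ ^ 2 = (3 / 2) ^ 2 := by rw [norm_sq_E2]; simp [hu]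
    have : ‖u‖ = 3 / 2 := by nlinarith [norm_nonneg u]
    linarith
  have hH := H_eq_zero_of_mem_unstableManifold (hab.subset_unstable u hub)
  -- Over `(3/2, 0)` the equation `H = 0` reduces to `a² = 0`. The reduced field then vanishes
  -- there, so invariance would force an equilibrium, whereas `x₄' = 3/4`.
  have ha : a u = 0 := by
    simp only [H, graphMap, hu, PiLp.toLp_apply, Matrix.cons_val_zero, Matrix.cons_val_one,
      Matrix.cons_val] at hH
    have : a u ^ 2 = 0 := by linarith
    simpa using this
  have hv : (!₂[u 1, a u] : E2) = 0 := by
    ext i; fin_cases i <;> simp [ha]; try simp [hu]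
  have hinv := congrArg (fun x : E4 => x 3) (hab.invariant u hub)
  rw [hv, map_zero] at hinv
  simp only [X_apply_three, graphMap, ha, Matrix.cons_val, mul_zero] at hinv
  simp [hu] at hinv
  norm_num at hinv

end

/-! ### Continuous dependence on the initial value -/

theorem eventually_mem_of_isCompact {η : ℝ} {γ : ℝ → E4} {α β : ℝ} (hα : α ≤ 0) (hβ : 0 ≤ β)
    (h : IsSol η γ (Icc α β)) {K : Set ℝ} (hK : IsCompact K) (hKs : K ⊆ Icc α β) {U : Set E4}
    (hU : IsOpen U) (hKU : ∀ s ∈ K, γ s ∈ U) :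
    ∀ᶠ y in 𝓝 (γ 0), ∀ γ' : ℝ → E4, IsSol η γ' (Icc α β) → γ' 0 = y → ∀ s ∈ K, γ' s ∈ U := by
  obtain ⟨Ψ, ρ, hρ, L, h1, h2⟩ := exists_flow_chart hα hβ h
  obtain ⟨ε, hε, hth⟩ := (hK.image_of_continuousOn
    (h.continuousOn.mono hKs)).exists_thickening_subset_open hU (image_subset_iff.2 hKU)
  have hm : γ 0 ∈ Metric.ball (γ 0) ρ := Metric.mem_ball_self hρ
  have h0 : (0 : ℝ) ∈ Icc α β := ⟨hα, hβ⟩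
  have hpos : (0 : ℝ) < L + 1 := by positivity
  filter_upwards [Metric.ball_mem_nhds (γ 0) hρ,
    Metric.ball_mem_nhds (γ 0) (div_pos hε hpos)] with y hy hyε γ' hγ' hy0 s hs
  refine hth (Metric.mem_thickening_iff.2 ⟨γ s, mem_image_of_mem _ hs, ?_⟩)
  rw [hγ'.eqOn ordConnected_Icc h0 (h1 y hy).2 (hy0.trans (h1 y hy).1.symm) (hKs hs),
    h.eqOn ordConnected_Icc h0 (h1 _ hm).2 (h1 _ hm).1.symm (hKs hs)]
  refine ((h2 s (hKs hs)).dist_le_mul y hy _ hm).trans_lt ?_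
  have : dist y (γ 0) < ε / (L + 1) := hyε
  rw [lt_div_iff₀ hpos] at this
  nlinarith [dist_nonneg (x := y) (y := γ 0)]

/-! ### Rotation around the origin in the past -/

/-- A planar solution near a repelling focus cannot stay in a half plane in the past. -/
theorem exists_eq_zero_of_spiral {x y A : ℝ → ℝ} {ρ t₀ : ℝ} (hρ : 0 < ρ) (hρ1 : ρ < 1)
    (hx : ∀ t ∈ Iic t₀, HasDerivWithinAt x (y t) (Iic t₀) t)
    (hy : ∀ t ∈ Iic t₀, HasDerivWithinAt y (A t) (Iic t₀) t)
    (hA : ∀ t ∈ Iic t₀, |A t - (-x t + 2 * ρ * y t)| ≤ (1 - ρ) / 4 * (|x t| + |y t|))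
    (hx0 : Tendsto x atBot (𝓝 0)) (hy0 : Tendsto y atBot (𝓝 0)) (hpos : ∀ t ∈ Iic t₀, 0 ≤ y t) :
    ∃ t ∈ Iic t₀, x t = 0 ∧ y t = 0 := by
  -- While `y ≥ 0`, `x` increases from its limit `0`, so the solution stays in the quadrant `x, y ≥
  -- 0`. The monotone quantity `y - 3x` then confines it to the sector `0 ≤ y ≤ 3x`.
  have hmono : MonotoneOn x (Iic t₀) := monotoneOn_of_hasDerivWithinAt ordConnected_Iic hx hpos
  have hxpos : ∀ t ∈ Iic t₀, 0 ≤ x t := fun t ht =>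
    le_of_tendsto hx0 (eventually_atBot.2 ⟨t, fun u hu => hmono (le_trans hu ht) ht hu⟩)
  have hA' : ∀ t ∈ Iic t₀, A t ≤ -x t + 2 * ρ * y t + (1 - ρ) / 4 * (x t + y t) := fun t ht => by
    have := (abs_le.1 (hA t ht)).2
    rw [abs_of_nonneg (hxpos t ht), abs_of_nonneg (hpos t ht)] at this
    linarith
  have hanti : AntitoneOn (fun t => y t - 3 * x t) (Iic t₀) :=
    antitoneOn_of_hasDerivWithinAt ordConnected_Iic
      (fun t ht => (hy t ht).sub ((hx t ht).const_mul 3)) fun t ht => by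
        have := hA' t ht
        nlinarith [mul_nonneg (sub_nonneg.2 hρ1.le) (hpos t ht), hxpos t ht, hpos t ht,
          mul_nonneg hρ.le (hxpos t ht)]
  have hle : ∀ t ∈ Iic t₀, y t ≤ 3 * x t := fun t ht => by
    have hl : Tendsto (fun t => y t - 3 * x t) atBot (𝓝 0) := by
      simpa using hy0.sub (hx0.const_mul 3)
    have := ge_of_tendsto hl (eventually_atBot.2 ⟨t, fun u hu => hanti (le_trans hu ht) ht hu⟩)
    linarith
  by_contra! hne
  have hxp : ∀ t ∈ Iic t₀, 0 < x t := fun t ht => by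
    refine lt_of_le_of_ne (hxpos t ht) fun h => ?_
    exact hne t ht h.symm (le_antisymm (by have := hle t ht; rw [← h] at this; linarith) (hpos t ht))
  -- The slope `s = y/x` satisfies `s' = A/x - s²`, and completing the square at `s = ρ + (1 - ρ)/8`
  -- gives `s' ≤ -(1 - ρ)/2`.
  have hs : AntitoneOn (fun t => y t / x t + (1 - ρ) / 2 * t) (Iic t₀) :=
    antitoneOn_of_hasDerivWithinAt ordConnected_Iic
      (fun t ht => ((hy t ht).div (hx t ht) (hxp t ht).ne').add
        ((hasDerivAt_id t).hasDerivWithinAt.const_mul _)) fun t ht => by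
        have hX := hxp t ht
        have h1 := mul_le_mul_of_nonneg_right (hA' t ht) hX.le
        rw [mul_one, div_add' _ _ _ (by positivity)]
        refine div_nonpos_of_nonpos_of_nonneg ?_ (by positivity)
        have h2 : 0 ≤ (1 - (1 - ρ) / 4 - (1 - ρ) / 2 - (ρ + (1 - ρ) / 8) ^ 2) * x t ^ 2 :=
          mul_nonneg (by nlinarith) (sq_nonneg _)
        nlinarith [sq_nonneg (y t - (ρ + (1 - ρ) / 8) * x t)]
  have hd : 0 < 1 - ρ := by linarith
  -- In a time `8/(1 - ρ)` the slope falls by at least `4`, which is impossible between `3` and `0`.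
  have hmem : t₀ - 8 / (1 - ρ) ∈ Iic t₀ := by
    have : 0 < 8 / (1 - ρ) := by positivity
    simp only [mem_Iic]; linarith
  have h1 := hs hmem self_mem_Iic hmem
  simp only at h1
  have h2 : y (t₀ - 8 / (1 - ρ)) / x (t₀ - 8 / (1 - ρ)) ≤ 3 := by
    rw [div_le_iff₀ (hxp _ hmem)]; exact hle _ hmem
  have h3 : 0 ≤ y t₀ / x t₀ := div_nonneg (hpos _ self_mem_Iic) (hxpos _ self_mem_Iic)
  have h4 : (1 - ρ) / 2 * (8 / (1 - ρ)) = 4 := by field_simp; norm_num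
  nlinarith

section

variable {η δ : ℝ} {a b : E2 → ℝ} (hab : IsLocalUnstableGraph η δ a b)
include hab

/-- In the far past the solution is on the graph, where `(x₁, x₂)` follows a perturbed repelling
focus (with `ρ² + ω² = 1`) and cannot stay in a half plane. A common zero of `x₁` and `x₂` would put
the solution at the origin. The factor `σ` treats both signs of `x₂` at once. -/
theorem exists_sign_of_past (hη : η ∈ Ioo (-2 : ℝ) 2) (hδ : 0 < δ) {γ : ℝ → E4} {c : ℝ}
    (h : IsSol η γ (Iic c)) (h0 : Tendsto γ atBot (𝓝 0)) (hne : ∀ t ≤ c, γ t ≠ 0) {σ : ℝ}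
    (hσ : σ = 1 ∨ σ = -1) (t₁ : ℝ) : ∃ t < t₁, σ * γ t 1 < 0 := by
  by_contra! hcon
  have hb0 : Tendsto (fun t => base (γ t)) atBot (𝓝 0) := by
    simpa [Function.comp_def] using (base.continuous.tendsto 0).comp h0
  have hi : ∀ i : Fin 4, Tendsto (fun t => γ t i) atBot (𝓝 0) := fun i =>
    ((EuclideanSpace.proj i : E4 →L[ℝ] ℝ).continuous.tendsto 0).comp h0
  have hρ1 := rho_lt_one hη
  have hlin : ∀ᶠ u in 𝓝 (0 : E2), |a u - (-u 0 + 2 * rho η * u 1)| ≤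
      (1 - rho η) / 4 * (|u 0| + |u 1|) := by
    have := ((differentiableAt_a hab (Metric.mem_ball_self hδ)).hasFDerivAt.isLittleO).bound
      (show 0 < (1 - rho η) / 4 by linarith)
    filter_upwards [this] with u hu
    rw [hab.a_zero, sub_zero, sub_zero, hab.tangent_a, rho_sq hη, omega_sq hη, Real.norm_eq_abs] at hu
    have hn : ‖u‖ ≤ |u 0| + |u 1| := by
      refine abs_le_of_sq_le_sq' ?_ (by positivity) |>.2
      rw [norm_sq_E2, ← sq_abs (u 0), ← sq_abs (u 1)]
      nlinarith [mul_nonneg (abs_nonneg (u 0)) (abs_nonneg (u 1))]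
    have e : a u - (-u 0 + 2 * rho η * u 1) =
        a u - (-((η + 2) / 4 + (-η + 2) / 4) * u 0 + 2 * rho η * u 1) := by ring
    rw [e]
    exact hu.trans (by gcongr)
  obtain ⟨t₀, ht₀⟩ := eventually_atBot.1 ((eventually_onGraph hab hη hδ h h0).and
    ((hb0.eventually hlin).and ((eventually_le_atBot c).and (eventually_lt_atBot t₁))))
  have hs : Iic t₀ ⊆ Iic c := fun t ht => (ht₀ t ht).2.2.1
  have hσ2 : σ * σ = 1 := by rcases hσ with rfl | rfl <;> norm_num
  have hσa : |σ| = 1 := by rcases hσ with rfl | rfl <;> norm_num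
  obtain ⟨t, ht, hx, hy⟩ := exists_eq_zero_of_spiral (x := fun t => σ * γ t 0)
    (y := fun t => σ * γ t 1) (A := fun t => σ * γ t 2) (rho_pos hη) hρ1
    (fun t ht => ((h.mono hs).coord ht 0).const_mul σ)
    (fun t ht => ((h.mono hs).coord ht 1).const_mul σ)
    (fun t ht => by
      have := (ht₀ t ht).2.1
      rw [← (ht₀ t ht).1.1] at this
      have e : σ * γ t 2 - (-(σ * γ t 0) + 2 * rho η * (σ * γ t 1)) =
        σ * (γ t 2 - (-γ t 0 + 2 * rho η * γ t 1)) := by ring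
      rw [e, abs_mul, abs_mul, abs_mul, hσa, one_mul, one_mul, one_mul]
      exact this)
    (by simpa using (hi 0).const_mul σ) (by simpa using (hi 1).const_mul σ)
    (fun t ht => hcon t (ht₀ t ht).2.2.2)
  have hσ0 : σ ≠ 0 := by rintro rfl; simp at hσ2
  have hx' : γ t 0 = 0 := (mul_eq_zero.1 hx).resolve_left hσ0
  have hy' : γ t 1 = 0 := (mul_eq_zero.1 hy).resolve_left hσ0
  refine hne t (hs ht) ?_
  have hb : base (γ t) = 0 := by ext i; fin_cases i <;> simp [hx', hy']
  obtain ⟨g1, g2⟩ := (ht₀ t ht).1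
  rw [hb, hab.a_zero] at g1
  rw [hb, hab.b_zero] at g2
  ext i; fin_cases i <;> simp [*]

/-- Backward orbits of the points near a point of the unstable manifold cross the section many
times. -/
theorem eventually_many_crossings (hη : η ∈ Ioo (-2 : ℝ) 2) (hδ : 0 < δ) {γ : ℝ → E4}
    (h : IsSol η γ (Iic 0)) (h0 : Tendsto γ atBot (𝓝 0)) (hne : ∀ t ≤ 0, γ t ≠ 0) (n : ℕ) :
    ∃ M > 0, ∀ᶠ y in 𝓝 (γ 0), ∀ γ' : ℝ → E4, IsSol η γ' (Icc (-M) 0) → γ' 0 = y →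
      ∃ Z : Finset ℝ, Z.card = n ∧ ∀ t ∈ Z, t ∈ Ioo (-M) 0 ∧ γ' t ∈ S := by
  induction n with
  | zero => exact ⟨1, one_pos, Eventually.of_forall fun y γ' _ _ => ⟨∅, by simp⟩⟩
  | succ n ih =>
    obtain ⟨M, hM, hev⟩ := ih
    -- Before `-M` the coordinate `x₂` takes both signs. These signs persist for nearby orbits,
    -- which gives one more zero, distinct from those already found after `-M`.
    obtain ⟨s₁, hs₁, hn₁⟩ := exists_sign_of_past hab hη hδ h h0 hne (Or.inl rfl) (-M)
    obtain ⟨s₂, hs₂, hn₂⟩ := exists_sign_of_past hab hη hδ h h0 hne (Or.inr rfl) (-M)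
    set M' := 1 - min s₁ s₂ with hM'
    have hm₁ : -M' < s₁ := by linarith [min_le_left s₁ s₂]
    have hm₂ : -M' < s₂ := by linarith [min_le_right s₁ s₂]
    have hsol : IsSol η γ (Icc (-M') 0) := h.mono fun t ht => ht.2
    have hM'0 : 0 < M' := by linarith
    have hc1 : Continuous fun x : E4 => x 1 := (EuclideanSpace.proj 1 : E4 →L[ℝ] ℝ).continuous
    have e₁ := eventually_mem_of_isCompact (K := {s₁}) (U := {x | x 1 < 0}) (by linarith) le_rfl hsol
      isCompact_singleton (by simpa using ⟨hm₁.le, by linarith⟩)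
      (isOpen_lt hc1 continuous_const) (by simpa using hn₁)
    have e₂ := eventually_mem_of_isCompact (K := {s₂}) (U := {x | 0 < x 1}) (by linarith) le_rfl hsol
      isCompact_singleton (by simpa using ⟨hm₂.le, by linarith⟩)
      (isOpen_lt continuous_const hc1) (by simpa using hn₂)
    refine ⟨M', hM'0, ?_⟩
    filter_upwards [hev, e₁, e₂] with y hy hy₁ hy₂ γ' hγ' hγ0
    obtain ⟨Z, hZ, hZ'⟩ := hy γ' (hγ'.mono (Icc_subset_Icc (by linarith) le_rfl)) hγ0
    have hsub : uIcc s₁ s₂ ⊆ Ioo (-M') (-M) := ordConnected_Ioo.uIcc_subset ⟨hm₁, hs₁⟩ ⟨hm₂, hs₂⟩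
    have hI : uIcc s₁ s₂ ⊆ Icc (-M') 0 := fun t ht => ⟨(hsub ht).1.le, by linarith [(hsub ht).2]⟩
    obtain ⟨t, ht, ht0⟩ := intermediate_value_uIcc
      ((hγ'.continuousOn_coord 1).mono hI) (show (0 : ℝ) ∈ uIcc (γ' s₁ 1) (γ' s₂ 1) from
        Icc_subset_uIcc ⟨(hy₁ γ' hγ' hγ0 s₁ rfl).le, (hy₂ γ' hγ' hγ0 s₂ rfl).le⟩)
    have htZ : t ∉ Z := fun hz => by linarith [(hZ' t hz).1.1, (hsub ht).2]
    refine ⟨insert t Z, by rw [Finset.card_insert_of_notMem htZ, hZ], fun u hu => ?_⟩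
    rcases Finset.mem_insert.1 hu with rfl | hu
    · exact ⟨⟨(hsub ht).1, by linarith [(hsub ht).2]⟩, ht0⟩
    · obtain ⟨h1, h2⟩ := hZ' u hu
      exact ⟨⟨by linarith [h1.1], h1.2⟩, h2⟩

end

/-! ### The orbit of a point of the unstable manifold -/

/-- A solution that tends to the origin in the past is injective, unless it is at the origin. -/
theorem injOn_of_tendsto {η : ℝ} {γ : ℝ → E4} {c : ℝ} (h : IsSol η γ (Iic c))
    (h0 : Tendsto γ atBot (𝓝 0)) (hne : ∀ t ≤ c, γ t ≠ 0) : InjOn γ (Iic c) := by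
  have key : ∀ s t, s < t → t ≤ c → γ s ≠ γ t := by
    intro s t hst htc heq
    have hP : 0 < t - s := by linarith
    -- A repeated value makes the whole past periodic with period `t - s`, and the limit at `-∞`
    -- then forces `γ s = 0`.
    have hper : EqOn γ (fun u => γ (u + (t - s))) (Iic s) :=
      (h.mono (Iic_subset_Iic.2 (by linarith))).eqOn ordConnected_Iic self_mem_Iic
        (h.shift (t - s) fun u hu => by
          simp only [mem_Iic] at hu ⊢; linarith) (by simpa using heq)
    have hn : ∀ n : ℕ, γ (s - n * (t - s)) = γ s := by
      intro n
      induction n with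
      | zero => simp
      | succ n ih =>
        rw [hper (show s - ((n + 1 : ℕ) : ℝ) * (t - s) ∈ Iic s by
          simp only [mem_Iic]; nlinarith [(Nat.cast_nonneg (n + 1) : (0 : ℝ) ≤ ((n + 1 : ℕ) : ℝ))]),
          ← ih]
        push_cast
        ring_nf
    have hlim : Tendsto (fun n : ℕ => s - n * (t - s)) atTop atBot := by
      simpa [sub_eq_add_neg] using tendsto_atBot_add_const_left atTop s
        (tendsto_neg_atTop_atBot.comp (tendsto_natCast_atTop_atTop.atTop_mul_const hP))
    have := h0.comp hlim
    simp only [Function.comp_def, hn] at this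
    exact hne s (by linarith) (tendsto_nhds_unique tendsto_const_nhds this)
  intro s hs t ht heq
  rcases lt_trichotomy s t with hlt | rfl | hlt
  · exact absurd heq (key s t hlt ht)
  · rfl
  · exact absurd heq.symm (key t s hlt hs)

theorem isSol_zero (η : ℝ) (s : Set ℝ) : IsSol η (fun _ => 0) s := fun t _ => by
  have : X η 0 = 0 := by ext i; fin_cases i <;> simp
  simpa [this] using hasDerivWithinAt_const t s (0 : E4)

theorem ne_zero_of_isSol {η : ℝ} {γ : ℝ → E4} {s : Set ℝ} (hs : s.OrdConnected) (h : IsSol η γ s)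
    {t u : ℝ} (ht : t ∈ s) (hne : γ t ≠ 0) (hu : u ∈ s) : γ u ≠ 0 := fun h0 =>
  hne (h.eqOn hs hu (isSol_zero η s) h0 ht)

/-- On the level set `H = 0`, a point of `S` that is not on the lines `v₁`, `v₂` is a point of
transversality. -/
theorem mem_v_of_H_eq_zero {η : ℝ} {x : E4} (hH : H η x = 0) (h1 : x 1 = 0) (h2 : x 2 = 0) :
    x 0 = 0 ∨ x 0 = 3 / 2 := by
  rw [H, h1, h2] at hH
  have : x 0 ^ 2 * (3 / 2 - x 0) = 0 := by linear_combination 3 * hH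
  rcases mul_eq_zero.1 this with h | h
  · exact Or.inl (by simpa using h)
  · exact Or.inr (by linarith)

/-! ### Leaving the disc of radius `r` -/

section

variable {η δ r : ℝ} {a b : E2 → ℝ} (hab : IsLocalUnstableGraph η δ a b)
include hab

/-- A solution on the graph that starts in the disc of radius `r` leaves it through the graph. -/
theorem exists_exit (hrδ : r < δ) {γ : ℝ → E4} {s e : ℝ} (hse : s ≤ e) (h : IsSol η γ (Icc s e))
    (hs : ‖base (γ s)‖ < r) (he : r < ‖base (γ e)‖) (hg : OnGraph a b (γ s)) :
    ∃ t ∈ Ioo s e, ‖base (γ t)‖ = r ∧ (∀ u ∈ Ico s t, ‖base (γ u)‖ < r) ∧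
      ∀ u ∈ Icc s t, OnGraph a b (γ u) := by
  have hc : ContinuousOn (fun t => ‖base (γ t)‖) (Icc s e) :=
    (base.continuous.comp_continuousOn h.continuousOn).norm
  have hcomp : IsCompact (Icc s e ∩ (fun t => ‖base (γ t)‖) ⁻¹' Ici r) :=
    isCompact_Icc.of_isClosed_subset (hc.preimage_isClosed_of_isClosed isClosed_Icc isClosed_Ici)
      inter_subset_left
  obtain ⟨t, ⟨ht, htr⟩, hmin⟩ := hcomp.exists_isLeast ⟨e, right_mem_Icc.2 hse, he.le⟩
  have hlt : ∀ u ∈ Ico s t, ‖base (γ u)‖ < r := fun u hu => by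
    by_contra! hcon
    exact absurd (hmin ⟨⟨hu.1, hu.2.le.trans ht.2⟩, hcon⟩) (not_le.2 hu.2)
  have heq : ‖base (γ t)‖ = r := by
    obtain ⟨u, hu, hur⟩ := intermediate_value_Icc ht.1 (hc.mono (Icc_subset_Icc le_rfl ht.2))
      (show r ∈ Icc _ _ from ⟨hs.le, htr⟩)
    have : t ≤ u := hmin ⟨⟨hu.1, hu.2.trans ht.2⟩, hur.ge⟩
    rwa [le_antisymm this hu.2]
  have hst : s < t := lt_of_le_of_ne ht.1 fun h => by rw [← h] at heq; linarith
  have hte : t < e := lt_of_le_of_ne ht.2 fun h => by rw [h] at heq; linarith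
  refine ⟨t, ⟨hst, hte⟩, heq, hlt, fun u hu => ?_⟩
  refine onGraph_of_isSol hab ordConnected_Icc (h.mono (Icc_subset_Icc le_rfl ht.2)) (fun v hv => ?_)
    (left_mem_Icc.2 ht.1) hg hu
  rw [mem_ball_zero_iff]
  rcases hv.2.eq_or_lt with rfl | hvt
  · linarith
  · linarith [hlt v ⟨hv.1, hvt⟩]

end

/-- At a point of `S ∩ {H = 0}` over the disc of radius less than `3/2`, a solution is tangent from one
side to the cylinder through the point. -/
theorem not_mem_S_of_crossing {η r : ℝ} {γ : ℝ → E4} {t₀ ε : ℝ} (hε : 0 < ε) (hr : 0 < r)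
    (hr2 : r < 3 / 2) (h : IsSol η γ (Ioo (t₀ - ε) (t₀ + ε))) (hH : H η (γ t₀) = 0)
    (heq : ‖base (γ t₀)‖ = r) (hlt : ∀ t ∈ Ioo (t₀ - ε) t₀, ‖base (γ t)‖ < r)
    (hgt : ∀ t ∈ Ioo t₀ (t₀ + ε), r < ‖base (γ t)‖) : γ t₀ ∉ S := by
  intro hS
  have h1 : γ t₀ 1 = 0 := hS
  set f : ℝ → ℝ := fun t => γ t 0 ^ 2 + γ t 1 ^ 2 with hf
  have hfn : ∀ t, f t = ‖base (γ t)‖ ^ 2 := fun t => (norm_base_sq _).symm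
  have hmem : Ioo (t₀ - ε) (t₀ + ε) ∈ 𝓝 t₀ := Ioo_mem_nhds (by linarith) (by linarith)
  have hc : ∀ t ∈ Ioo (t₀ - ε) (t₀ + ε), ∀ i, HasDerivAt (fun t => γ t i) (X η (γ t) i) t :=
    fun t ht i => (h.coord ht i).hasDerivAt (isOpen_Ioo.mem_nhds ht)
  have ht₀ := mem_of_mem_nhds hmem
  have hd1 : deriv f =ᶠ[𝓝 t₀] fun t => 2 * (γ t 1 * (γ t 0 + γ t 2)) := by
    filter_upwards [hmem] with t ht
    refine (HasDerivAt.congr_deriv (((hc t ht 0).pow 2).add ((hc t ht 1).pow 2)) ?_).deriv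
    simp only [X_apply_zero, X_apply_one]; push_cast; ring
  have hd2 : deriv (deriv f) t₀ = 2 * (γ t₀ 2 * (γ t₀ 0 + γ t₀ 2)) := by
    rw [hd1.deriv_eq]
    refine (HasDerivAt.congr_deriv (((hc _ ht₀ 1).mul
      ((hc _ ht₀ 0).add (hc _ ht₀ 2))).const_mul 2) ?_).deriv
    simp only [X_apply_zero, X_apply_one, X_apply_two, h1, Pi.add_apply]; ring
  have hd0 : deriv f t₀ = 0 := by rw [hd1.self_of_nhds]; simp [h1]
  have hcont : ContinuousAt f t₀ :=
    (((hc _ ht₀ 0).pow 2).add ((hc _ ht₀ 1).pow 2)).continuousAt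
  have hx0 : γ t₀ 0 ^ 2 = r ^ 2 := by
    have := norm_base_sq (γ t₀)
    rw [heq, h1] at this; linarith
  have hle : γ t₀ 0 ≤ r := by nlinarith
  have hne0 : γ t₀ 0 ≠ 0 := fun h => by rw [h] at hx0; nlinarith
  have hne : γ t₀ 2 * (γ t₀ 0 + γ t₀ 2) ≠ 0 := by
    refine mul_ne_zero (fun h2 => ?_) fun h2 => ?_
    · rcases mem_v_of_H_eq_zero hH h1 h2 with h | h
      · exact hne0 h
      · linarith
    · have h3 : γ t₀ 2 = -γ t₀ 0 := by linarith
      rw [H, h1, h3] at hH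
      have : γ t₀ 0 ^ 3 = 0 := by linear_combination -3 * hH
      exact hne0 (by simpa using this)
  rcases hne.lt_or_gt with hn | hn
  · have hmax := isLocalMax_of_deriv_deriv_neg (f := f) (by rw [hd2]; linarith) hd0 hcont
    obtain ⟨t, ht, ht'⟩ := (((show ∀ᶠ t in 𝓝 t₀, f t ≤ f t₀ from hmax).filter_mono
      (nhdsWithin_le_nhds (s := Ioi t₀))).and
      (Ioo_mem_nhdsGT (show t₀ < t₀ + ε by linarith))).exists
    have := hgt t ht'
    rw [hfn, hfn, heq] at ht
    nlinarith
  · have hmin := isLocalMin_of_deriv_deriv_pos (f := f) (by rw [hd2]; linarith) hd0 hcont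
    obtain ⟨t, ht, ht'⟩ := (((show ∀ᶠ t in 𝓝 t₀, f t₀ ≤ f t from hmin).filter_mono
      (nhdsWithin_le_nhds (s := Iio t₀))).and
      (Ioo_mem_nhdsLT (show t₀ - ε < t₀ by linarith))).exists
    have := hlt t ht'
    rw [hfn, hfn, heq] at ht
    nlinarith [norm_nonneg (base (γ t))]

/-- The orbit of a point `q` of `v₂` that leaves the graph at the time `-T` through the curve `D^u`
and reaches `q` at the time `0` as its `k`-th crossing of the section. -/
structure TurningOrbit (η δ r : ℝ) (a b : E2 → ℝ) (k : ℕ) (q : E4) (γ : ℝ → E4) (T τ : ℝ)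
    (u₀ : E2) : Prop where
  T_pos : 0 < T
  τ_pos : 0 < τ
  isSol : IsSol η γ (Iic τ)
  at_zero : γ 0 = q
  tendsto : Tendsto γ atBot (𝓝 0)
  ne_zero : ∀ t ≤ 0, γ t ≠ 0
  norm_u₀ : ‖u₀‖ = r
  at_neg_T : γ (-T) = graphMap a b u₀
  eq_neg_T : ∀ t ≤ 0, γ t ∈ Du a b r → t = -T
  before : ∀ t < -T, ‖base (γ t)‖ < r
  after : ∃ ε > 0, ∀ t ∈ Ioo (-T) (-T + ε), r < ‖base (γ t)‖
  not_mem_S : γ (-T) ∉ S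
  encard_crossings : {t | t ∈ Ioc (-T) 0 ∧ γ t ∈ S}.encard = k
  transverse : ∀ t ∈ Ioo (-T) 0, γ t ∈ S → γ t 2 ≠ 0

/-- Three pieces are glued: the past of `p` on the unstable manifold, the arc from `p` to `q`, and a
short continuation. Every exit from the disc along the graph is a point of `D^u`, so the single
meeting with `D^u` makes `-T` the only exit time. -/
theorem exists_turningOrbit {η : ℝ} (hη : η ∈ Ioo (-2 : ℝ) 2) {a b : E2 → ℝ} {δ r : ℝ}
    (hab : IsLocalUnstableGraph η δ a b) (hr : 0 < r) (hrδ : r < δ) {k : ℕ} (hk : 1 ≤ k) {q : E4}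
    (hq0 : q 0 = 3 / 2) (hq : q ∈ SigmaU η a b r k)
    (hfund : ∃! p, p ∈ Du a b r ∧ p ∈ orbit η q)
    (hreg : ∀ p ∈ Du a b r, Disjoint (orbitArc η p q) (v₁ ∪ v₂)) :
    ∃ γ T τ u₀, TurningOrbit η δ r a b k q γ T τ u₀ := by
  have hδ : 0 < δ := hr.trans hrδ
  have hr2 : r < 3 / 2 := hrδ.trans_le (radius_le hab)
  obtain ⟨k, rfl⟩ : ∃ n, k = n + 1 := ⟨k - 1, by omega⟩
  rw [sigmaU_eq, mem_hits_iff] at hq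
  obtain ⟨p, hp, T, hT, γ₁, hγ₁, h0₁, hT₁, -, hcard⟩ := hq
  obtain ⟨u₀, hu₀, hpu⟩ : p ∈ graphMap a b '' Metric.sphere 0 r := du_eq hr ▸ hp
  rw [mem_sphere_zero_iff_norm] at hu₀
  obtain ⟨γ₂, hγ₂, h0₂, hlim₂⟩ := hab.subset_unstable u₀ (by
    rw [mem_ball_zero_iff]; linarith)
  obtain ⟨τ, hτ, γ₃, h0₃, hγ₃⟩ := exists_local_solution η q
  have hA := IsSol.glue (b := 0) hγ₂ hγ₁ Subset.rfl (fun t ht => ht.1) self_mem_Iic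
    (left_mem_Icc.2 hT.le) (by rw [h0₂, h0₁, hpu])
  rw [Iic_union_Icc_eq_Iic hT.le] at hA
  set γ₄ : ℝ → E4 := fun t => if t ≤ 0 then γ₂ t else γ₁ t with hγ₄
  have hA' := hA.shift (s' := Iic 0) T fun t ht => by simpa using ht
  have hB := IsSol.glue (b := 0) hA' (hγ₃.mono (Icc_subset_Icc (neg_nonpos.2 hτ.le) le_rfl))
    Subset.rfl (fun t ht => ht.1) self_mem_Iic (left_mem_Icc.2 hτ.le)
    (by simp [hγ₄, not_le.2 hT, hT₁, h0₃])
  rw [Iic_union_Icc_eq_Iic hτ.le] at hB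
  set γ : ℝ → E4 := fun t => if t ≤ 0 then γ₄ (t + T) else γ₃ t with hγ
  have hγpast : ∀ t ≤ -T, γ t = γ₂ (t + T) := fun t ht => by
    simp only [hγ, hγ₄]
    rw [if_pos (by linarith), if_pos (by linarith)]
  have hγmid : ∀ t ∈ Icc (-T) 0, γ t = γ₁ (t + T) := fun t ht => by
    simp only [hγ, hγ₄]
    rw [if_pos ht.2]
    split_ifs with h
    · have : t + T = 0 := le_antisymm h (by linarith [ht.1])
      rw [this, h0₂, h0₁, hpu]
    · rfl
  have hγ0 : γ 0 = q := by rw [hγmid 0 ⟨by linarith, le_rfl⟩, zero_add, hT₁]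
  have hγT : γ (-T) = p := by rw [hγpast _ le_rfl, neg_add_cancel, h0₂, hpu]
  have hlim : Tendsto γ atBot (𝓝 0) :=
    (hlim₂.comp (tendsto_atBot_add_const_right _ T tendsto_id)).congr'
      ((eventually_le_atBot (-T)).mono fun t ht => (hγpast t ht).symm)
  have hq_ne : q ≠ 0 := fun h => by rw [h] at hq0; norm_num at hq0
  have hne : ∀ t ≤ τ, γ t ≠ 0 := fun t ht => ne_zero_of_isSol ordConnected_Iic hB (t := 0) hτ.le
    (by rwa [hγ0]) ht
  have hinj := injOn_of_tendsto hB hlim hne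
  have horb : ∀ t ≤ 0, γ t ∈ orbit η q := fun t ht => ⟨t, by
    have := hB.flowsTo ordConnected_Iic (c := 0) (t := t) hτ.le (ht.trans hτ.le)
    rwa [sub_zero, hγ0] at this⟩
  have heqT : ∀ t ≤ 0, γ t ∈ Du a b r → t = -T := fun t ht hD =>
    hinj (ht.trans hτ.le) (show -T ≤ τ by linarith) (hfund.unique ⟨hD, horb t ht⟩
      ⟨hγT ▸ hp, horb (-T) (by linarith)⟩)
  have hDu : ∀ t, OnGraph a b (γ t) → ‖base (γ t)‖ = r → γ t ∈ Du a b r := fun t hg hn => by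
    rw [du_eq hr]
    exact ⟨base (γ t), by simpa using hn, hg.graphMap_base⟩
  have hbq : r < ‖base (γ 0)‖ := by
    have : (3 / 2) ^ 2 ≤ ‖base (γ 0)‖ ^ 2 := by
      rw [norm_base_sq, hγ0, hq0]; linarith [sq_nonneg (q 1)]
    nlinarith [norm_nonneg (base (γ 0))]
  have hb0 : Tendsto (fun t => ‖base (γ t)‖) atBot (𝓝 0) := by
    simpa [Function.comp_def] using ((base.continuous.tendsto 0).comp hlim).norm
  obtain ⟨s, hs⟩ := eventually_atBot.1 ((eventually_onGraph hab hη hδ hB hlim).and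
    ((hb0.eventually_lt_const hr).and (eventually_le_atBot 0)))
  have hsub : ∀ s, Icc s 0 ⊆ Iic τ := fun s t ht => ht.2.trans hτ.le
  obtain ⟨t, ht, htr, htlt, htg⟩ := exists_exit hab hrδ (hs s le_rfl).2.2 (hB.mono (hsub s))
    (hs s le_rfl).2.1 hbq (hs s le_rfl).1
  obtain rfl : t = -T := heqT t ht.2.le (hDu t (htg t ⟨ht.1.le, le_rfl⟩) htr)
  have hbefore : ∀ t < -T, ‖base (γ t)‖ < r := fun t htT => by
    rcases le_or_gt t s with h | h
    · exact (hs t h).2.1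
    · exact htlt t ⟨h.le, htT⟩
  have hcb : ContinuousAt (fun t => ‖base (γ t)‖) (-T) :=
    (base.continuous.continuousAt.comp
      (hB.continuousOn.continuousAt (Iic_mem_nhds (by linarith)))).norm
  obtain ⟨ε, hε, hεδ⟩ := Metric.eventually_nhds_iff.1
    (hcb.eventually_lt_const (show ‖base (γ (-T))‖ < δ by rw [htr]; exact hrδ))
  -- Just after `-T` the orbit is still on the graph. If it were then on the circle, or inside it
  -- and thus bound to exit again before reaching `x₁ = 3/2 > r`, it would meet `D^u` a second time.
  have hafter : ∀ t ∈ Ioo (-T) (-T + min ε T), r < ‖base (γ t)‖ := fun t ht' => by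
    have htT : t < 0 := by linarith [ht'.2, min_le_right ε T]
    have hg : OnGraph a b (γ t) := by
      refine onGraph_of_isSol hab ordConnected_Icc (s := Icc (-T) t)
        (hB.mono fun v hv => by simp only [mem_Iic]; linarith [hv.2]) (fun v hv => ?_)
        (left_mem_Icc.2 ht'.1.le) (htg _ ⟨ht.1.le, le_rfl⟩) (right_mem_Icc.2 ht'.1.le)
      rw [mem_ball_zero_iff]
      refine hεδ ?_
      rw [Real.dist_eq, abs_of_nonneg (by linarith [hv.1])]
      linarith [hv.2, ht'.2, min_le_left ε T]
    by_contra! hle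
    rcases hle.eq_or_lt with heq | hlt
    · exact ht'.1.ne' (heqT t htT.le (hDu t hg heq))
    · obtain ⟨v, hv, hvr, -, hvg⟩ := exists_exit hab hrδ htT.le (hB.mono (hsub t)) hlt hbq hg
      have := heqT v hv.2.le (hDu v (hvg v ⟨hv.1.le, le_rfl⟩) hvr)
      linarith [hv.1, ht'.1]
  have hHz : ∀ t ≤ 0, H η (γ t) = 0 := fun t ht =>
    H_eq_zero_of_tendsto hB hlim (ht.trans hτ.le)
  have hm : 0 < min ε T := lt_min hε hT
  refine ⟨γ, T, τ, u₀, hT, hτ, hB, hγ0, hlim, fun t ht => hne t (ht.trans hτ.le), hu₀,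
    hγT.trans hpu.symm, heqT, hbefore, ⟨min ε T, hm, hafter⟩, ?_, ?_, ?_⟩
  · refine not_mem_S_of_crossing hm hr hr2 (hB.mono fun t ht => ?_) (hHz _ (by linarith)) htr
      (fun t ht => hbefore t ht.2) hafter
    simp only [mem_Iic]; linarith [ht.2, min_le_right ε T]
  · have : {t | t ∈ Ioc (-T) 0 ∧ γ t ∈ S} = (fun t => t - T) '' {t | t ∈ Ioc 0 T ∧ γ₁ t ∈ S} := by
      ext t
      simp only [mem_ofPred_eq, mem_image]
      constructor
      · rintro ⟨h1, h2⟩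
        refine ⟨t + T, ⟨⟨by linarith [h1.1], by linarith [h1.2]⟩, ?_⟩, by ring⟩
        rwa [← hγmid t ⟨h1.1.le, h1.2⟩]
      · rintro ⟨v, ⟨h1, h2⟩, rfl⟩
        refine ⟨⟨by linarith [h1.1], by linarith [h1.2]⟩, ?_⟩
        rwa [hγmid (v - T) ⟨by linarith [h1.1], by linarith [h1.2]⟩, sub_add_cancel]
    rw [this, (sub_left_injective (b := T)).encard_image, hcard]
    push_cast; rfl
  · intro t ht' hS h2
    have hv := mem_v_of_H_eq_zero (hHz t ht'.2.le) hS h2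
    refine Set.disjoint_left.1 (hreg p hp) (show γ t ∈ orbitArc η p q from
      ⟨t + T, by linarith [ht'.1], -t, by linarith [ht'.2], ?_, ?_⟩) ?_
    · have := hB.flowsTo ordConnected_Iic (c := -T) (t := t) (show -T ≤ τ by linarith)
        (ht'.2.le.trans hτ.le)
      rwa [hγT, sub_neg_eq_add] at this
    · have := hB.flowsTo ordConnected_Iic (c := t) (t := 0) (ht'.2.le.trans hτ.le) hτ.le
      rwa [hγ0, zero_sub] at this
    · rcases hv with h | h
      exacts [Or.inl ⟨hS, h, h2⟩, Or.inr ⟨hS, h, h2⟩]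

theorem TurningOrbit.unstableTangentSpace_eq {η δ r : ℝ} {a b : E2 → ℝ} {k : ℕ} {q : E4}
    {γ : ℝ → E4} {T τ : ℝ} {u₀ : E2} (h : TurningOrbit η δ r a b k q γ T τ u₀) (hr : 0 < r) :
    unstableTangentSpace η a b r q =
      LinearMap.range (fderiv ℝ (fun w => flow η T (graphMap a b w)) u₀ : E2 →ₗ[ℝ] E4) := by
  have hτ := h.τ_pos
  have hT := h.T_pos
  refine le_antisymm (iSup_le fun u => iSup_le fun t => iSup_le fun ⟨hu, ht, hf⟩ => ?_) ?_
  · have hγt : γ (0 + -t) = graphMap a b u := hf.symm.eq_of_isSol h.isSol ordConnected_Iic hτ.le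
      (show 0 + -t ≤ τ by linarith) h.at_zero
    rw [zero_add] at hγt
    have htT := h.eq_neg_T (-t) (by linarith) (by
      rw [du_eq hr, hγt]; exact mem_image_of_mem _ (by simpa using hu))
    obtain rfl : t = T := by linarith
    have : u = u₀ := by
      rw [← base_graphMap a b u, ← hγt, h.at_neg_T, base_graphMap]
    rw [this]
  · refine le_iSup_of_le u₀ (le_iSup_of_le T (le_iSup_of_le ⟨h.norm_u₀, hT, ?_⟩ le_rfl))
    have := h.isSol.flowsTo ordConnected_Iic (c := -T) (t := 0) (show -T ≤ τ by linarith) hτ.le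
    rwa [h.at_neg_T, h.at_zero, zero_sub, neg_neg] at this

/-! ### Strict differentiability of the flow along a surface -/

theorem norm_le_sum_abs (v : E4) : ‖v‖ ≤ |v 0| + |v 1| + |v 2| + |v 3| := by
  refine abs_le_of_sq_le_sq' ?_ (by positivity) |>.2
  rw [EuclideanSpace.norm_sq_eq, Fin.sum_univ_four]
  simp only [Real.norm_eq_abs]
  nlinarith [abs_nonneg (v 0), abs_nonneg (v 1), abs_nonneg (v 2), abs_nonneg (v 3),
    mul_nonneg (abs_nonneg (v 0)) (abs_nonneg (v 1)), mul_nonneg (abs_nonneg (v 0)) (abs_nonneg (v 2)),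
    mul_nonneg (abs_nonneg (v 0)) (abs_nonneg (v 3)), mul_nonneg (abs_nonneg (v 1)) (abs_nonneg (v 2)),
    mul_nonneg (abs_nonneg (v 1)) (abs_nonneg (v 3)), mul_nonneg (abs_nonneg (v 2)) (abs_nonneg (v 3))]

theorem abs_coord_le (v : E4) (i : Fin 4) : |v i| ≤ ‖v‖ := PiLp.norm_apply_le v i

/-- The second difference of the vector field. -/
theorem norm_second_difference_le (η : ℝ) (x y x' y' : E4) :
    ‖X η x - X η y - (X η x' - X η y')‖ ≤
      (4 + |η| + |x' 0 + y' 0|) * ‖x - y - (x' - y')‖ +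
        |x 0 + y 0 - x' 0 - y' 0| * ‖x - y‖ := by
  set D := x - y - (x' - y') with hD
  refine (norm_le_sum_abs _).trans ?_
  have c0 : (X η x - X η y - (X η x' - X η y')) 0 = D 1 := rfl
  have c1 : (X η x - X η y - (X η x' - X η y')) 1 = D 2 := rfl
  have c2 : (X η x - X η y - (X η x' - X η y')) 2 = D 3 := rfl
  -- Only this component is nonlinear; for the squares, `x² - y² - x'² + y'² = (x' + y')((x - y) -
  -- (x' - y')) + (x + y - x' - y')(x - y)`.
  have c3 : (X η x - X η y - (X η x' - X η y')) 3 = -D 0 + η * D 2 + (x' 0 + y' 0) * D 0 +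
      (x 0 + y 0 - x' 0 - y' 0) * (x - y) 0 := by
    simp only [hD, PiLp.sub_apply, X_apply_three]; ring
  rw [c0, c1, c2, c3]
  have k : ∀ i, |D i| ≤ ‖D‖ := abs_coord_le D
  have k' : |(x - y) 0| ≤ ‖x - y‖ := abs_coord_le _ 0
  have t : |-D 0 + η * D 2 + (x' 0 + y' 0) * D 0 + (x 0 + y 0 - x' 0 - y' 0) * (x - y) 0| ≤
      |D 0| + |η| * |D 2| + |x' 0 + y' 0| * |D 0| + |x 0 + y 0 - x' 0 - y' 0| * |(x - y) 0| := by
    refine (abs_add_le _ _).trans (add_le_add ((abs_add_le _ _).trans (add_le_add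
      ((abs_add_le _ _).trans (add_le_add ?_ ?_)) ?_)) ?_)
    · rw [abs_neg]
    all_goals rw [abs_mul]
  have m1 : |η| * |D 2| ≤ |η| * ‖D‖ := by gcongr; exact k 2
  have m2 : |x' 0 + y' 0| * |D 0| ≤ |x' 0 + y' 0| * ‖D‖ := by gcongr; exact k 0
  have m3 : |x 0 + y 0 - x' 0 - y' 0| * |(x - y) 0| ≤ |x 0 + y 0 - x' 0 - y' 0| * ‖x - y‖ := by
    gcongr
  linarith [k 0, k 1, k 2, k 3]

/-- The increment between `w` and `w'` is compared with the increment between `u₀ + (w - w')` and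
`u₀`, to which differentiability at `u₀` applies. The second difference of the flow is initially
`o(‖w - w'‖)` by strict differentiability of `G`. It remains so by Grönwall, since the second
difference of `X` is bounded by it and a small multiple of the first difference. No variational
equation is needed. -/
theorem hasStrictFDerivAt_flow_comp {η : ℝ} {Ψ : E4 → ℝ → E4} {ρ T : ℝ} {L : NNReal}
    {G : E2 → E4} {u₀ : E2} (hρ : 0 < ρ) (hT : 0 ≤ T)
    (h1 : ∀ y ∈ Metric.ball (G u₀) ρ, Ψ y 0 = y ∧ IsSol η (Ψ y) (Icc 0 T))
    (h2 : ∀ t ∈ Icc 0 T, LipschitzOnWith L (Ψ · t) (Metric.ball (G u₀) ρ))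
    {G' : E2 →L[ℝ] E4} (hG : HasStrictFDerivAt G G' u₀) {Φ' : E2 →L[ℝ] E4}
    (hΦ : HasFDerivAt (fun w => Ψ (G w) T) Φ' u₀) :
    HasStrictFDerivAt (fun w => Ψ (G w) T) Φ' u₀ := by
  have hm : G u₀ ∈ Metric.ball (G u₀) ρ := Metric.mem_ball_self hρ
  obtain ⟨R, hR⟩ := exists_bound_of_Icc (h1 _ hm).2
  have hR0 : 0 ≤ R := (norm_nonneg _).trans (hR 0 ⟨le_rfl, hT⟩)
  obtain ⟨LG, hLG⟩ := hG.exists_lipschitzOnWith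
  obtain ⟨sG, hsG, hLG⟩ := hLG
  set K : ℝ := 4 + |η| + 2 * (R + 1) with hK
  have hKpos : 0 < K := by positivity
  refine .of_isLittleO (Asymptotics.isLittleO_iff.2 fun c hc => ?_)
  -- With initial error `2εN` and forcing `4ε·L·LG·N`, Grönwall gives at most `exp(KT)(2 + 4·L·LG)εN
  -- ≤ (c/2)N`. The other half of `c` is spent on differentiability at `u₀`.
  set ε : ℝ := c / (4 * (Real.exp (K * T) * (1 + 4 * (L * LG)))) with hε
  have hεpos : 0 < ε := by positivity
  set ν : ℝ := min 1 ε / (L + 1) with hν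
  have hνpos : 0 < ν := by positivity
  have hnear : ∀ᶠ w in 𝓝 u₀, w ∈ sG ∧ G w ∈ Metric.ball (G u₀) ρ ∧ dist (G w) (G u₀) < ν :=
    (Filter.eventually_mem_set.2 hsG).and
      ((hG.continuousAt.eventually (Metric.ball_mem_nhds _ hρ)).and
        (hG.continuousAt.eventually (Metric.ball_mem_nhds _ hνpos)))
  have htend : Tendsto (fun p : E2 × E2 => u₀ + (p.1 - p.2)) (𝓝 (u₀, u₀)) (𝓝 u₀) := by
    have : Continuous fun p : E2 × E2 => u₀ + (p.1 - p.2) := by fun_prop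
    simpa using this.tendsto (u₀, u₀)
  have hstr : ∀ᶠ p in 𝓝 (u₀, u₀), ‖G p.1 - G p.2 - G' (p.1 - p.2)‖ ≤ ε * ‖p.1 - p.2‖ :=
    hG.isLittleO.bound hεpos
  have hstr0 : ∀ᶠ w in 𝓝 u₀, ‖G w - G u₀ - G' (w - u₀)‖ ≤ ε * ‖w - u₀‖ :=
    hG.hasFDerivAt.isLittleO.bound hεpos
  have hΦ0 : ∀ᶠ w in 𝓝 u₀, ‖Ψ (G w) T - Ψ (G u₀) T - Φ' (w - u₀)‖ ≤ c / 2 * ‖w - u₀‖ :=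
    hΦ.isLittleO.bound (by positivity)
  filter_upwards [(continuous_fst.tendsto (u₀, u₀)).eventually hnear,
    (continuous_snd.tendsto (u₀, u₀)).eventually hnear, htend.eventually hnear, hstr,
    htend.eventually hstr0, htend.eventually hΦ0] with p ⟨hs1, hb1, hd1⟩ ⟨hs2, hb2, hd2⟩
    ⟨hs3, hb3, hd3⟩ hp hp0 hpΦ
  obtain ⟨w, w'⟩ := p
  dsimp only at *
  rw [add_sub_cancel_left] at hp0 hpΦ
  set w'' := u₀ + (w - w') with hw''
  set N := ‖w - w'‖ with hN
  have hN0 : 0 ≤ N := norm_nonneg _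
  have hclose : ∀ v, G v ∈ Metric.ball (G u₀) ρ → dist (G v) (G u₀) < ν → ∀ t ∈ Icc 0 T,
      |Ψ (G v) t 0 - Ψ (G u₀) t 0| ≤ min 1 ε := fun v hv hd t ht => by
    refine (abs_coord_le (Ψ (G v) t - Ψ (G u₀) t) 0).trans ?_
    rw [← dist_eq_norm]
    refine ((h2 t ht).dist_le_mul _ hv _ hm).trans ?_
    have : (L + 1 : ℝ) * dist (G v) (G u₀) ≤ min 1 ε := by
      rw [hν, lt_div_iff₀ (by positivity)] at hd; linarith
    nlinarith [dist_nonneg (x := G v) (y := G u₀)]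
  have hdiff : ∀ t ∈ Icc 0 T, ‖Ψ (G w) t - Ψ (G w') t‖ ≤ L * LG * N := fun t ht => by
    rw [← dist_eq_norm]
    refine ((h2 t ht).dist_le_mul _ hb1 _ hb2).trans ?_
    rw [mul_assoc, hN, ← dist_eq_norm]
    gcongr
    exact hLG.dist_le_mul _ hs1 _ hs2
  have hDcont : ContinuousOn (fun t => Ψ (G w) t - Ψ (G w') t - (Ψ (G w'') t - Ψ (G u₀) t))
      (Icc 0 T) :=
    (((h1 _ hb1).2.continuousOn.sub (h1 _ hb2).2.continuousOn)).sub
      ((h1 _ hb3).2.continuousOn.sub (h1 _ hm).2.continuousOn)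
  have hDd : ∀ t ∈ Ico 0 T, HasDerivWithinAt
      (fun t => Ψ (G w) t - Ψ (G w') t - (Ψ (G w'') t - Ψ (G u₀) t))
      (X η (Ψ (G w) t) - X η (Ψ (G w') t) - (X η (Ψ (G w'') t) - X η (Ψ (G u₀) t))) (Ici t) t :=
    fun t ht => by
      have hI : Icc 0 T ∈ 𝓝[≥] t := mem_of_superset (Icc_mem_nhdsGE ht.2)
        (Icc_subset_Icc ht.1 le_rfl)
      have ht' : t ∈ Icc 0 T := ⟨ht.1, ht.2.le⟩
      have hd : ∀ y ∈ Metric.ball (G u₀) ρ, HasDerivWithinAt (Ψ y) (X η (Ψ y t)) (Ici t) t :=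
        fun y hy => ((h1 y hy).2 t ht').mono_of_mem_nhdsWithin hI
      exact ((hd _ hb1).sub (hd _ hb2)).sub ((hd _ hb3).sub (hd _ hm))
  have hgr := norm_le_gronwallBound_of_norm_deriv_right_le hDcont hDd
    (δ := 2 * ε * N) (K := K) (ε := 4 * ε * (L * LG * N)) ?_ ?_ T ⟨hT, le_rfl⟩
  · rw [gronwallBound_of_K_ne_0 hKpos.ne', sub_zero] at hgr
    have hE : 1 ≤ Real.exp (K * T) := Real.one_le_exp (by positivity)
    have hK1 : 1 ≤ K := by rw [hK]; linarith [abs_nonneg η]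
    have hb : 4 * ε * (L * LG * N) / K * (Real.exp (K * T) - 1) ≤
        4 * ε * (L * LG * N) * Real.exp (K * T) := by
      gcongr
      · exact div_le_self (by positivity) hK1
      · linarith
    have hfin : 2 * ε * N * Real.exp (K * T) + 4 * ε * (L * LG * N) * Real.exp (K * T) ≤
        c / 2 * N := by
      have e : c / 2 * N = 2 * (ε * (Real.exp (K * T) * (1 + 4 * (L * LG)))) * N := by
        rw [hε]; field_simp; ring
      rw [e]
      have : 0 ≤ ε * (L * LG * N) * Real.exp (K * T) := by positivity
      nlinarith
    calc ‖Ψ (G w) T - Ψ (G w') T - Φ' (w - w')‖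
        = ‖(Ψ (G w) T - Ψ (G w') T - (Ψ (G w'') T - Ψ (G u₀) T)) +
          (Ψ (G w'') T - Ψ (G u₀) T - Φ' (w - w'))‖ := by congr 1; abel
      _ ≤ c / 2 * N + c / 2 * N := (norm_add_le _ _).trans (add_le_add (by linarith) hpΦ)
      _ = c * N := by ring
  · rw [(h1 _ hb1).1, (h1 _ hb2).1, (h1 _ hb3).1, (h1 _ hm).1]
    calc ‖G w - G w' - (G w'' - G u₀)‖
        = ‖(G w - G w' - G' (w - w')) - (G w'' - G u₀ - G' (w - w'))‖ := by congr 1; abel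
      _ ≤ ε * N + ε * N := (norm_sub_le _ _).trans (add_le_add hp hp0)
      _ = 2 * ε * N := by ring
  · intro t ht
    have ht' : t ∈ Icc 0 T := ⟨ht.1, ht.2.le⟩
    refine (norm_second_difference_le η _ _ _ _).trans (add_le_add ?_ ?_)
    · gcongr
      rw [hK]
      gcongr
      have e3 := hclose w'' hb3 hd3 t ht'
      have hu := (abs_coord_le _ 0).trans (hR t ht')
      have e : Ψ (G w'') t 0 + Ψ (G u₀) t 0 =
        (Ψ (G w'') t 0 - Ψ (G u₀) t 0) + 2 * Ψ (G u₀) t 0 := by ring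
      rw [e]
      calc _ ≤ |Ψ (G w'') t 0 - Ψ (G u₀) t 0| + |2 * Ψ (G u₀) t 0| := abs_add_le _ _
        _ ≤ 1 + 2 * R := by
          rw [abs_mul, abs_two]; gcongr; exact e3.trans (min_le_left _ _)
        _ ≤ _ := by linarith
    · have e1 := (hclose w hb1 hd1 t ht').trans (min_le_right _ _)
      have e2 := (hclose w' hb2 hd2 t ht').trans (min_le_right _ _)
      have e3 := (hclose w'' hb3 hd3 t ht').trans (min_le_right _ _)
      have hq : |Ψ (G w) t 0 + Ψ (G w') t 0 - Ψ (G w'') t 0 - Ψ (G u₀) t 0| ≤ 4 * ε := by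
        rw [abs_le] at *
        constructor <;> linarith [e1.1, e1.2, e2.1, e2.2, e3.1, e3.2]
      gcongr
      exact hdiff t ht'

/-! ### The curve of crossings through `q` -/

theorem fderiv_H (η : ℝ) (x v : E4) : fderiv ℝ (H η) x v =
    (x 0 - x 0 ^ 2) * v 0 - η * x 1 * v 1 + v 1 * x 3 + x 1 * v 3 - x 2 * v 2 := by
  have hp : ∀ i : Fin 4, HasFDerivAt (fun x : E4 => x i) (EuclideanSpace.proj i : E4 →L[ℝ] ℝ) x :=
    fun i => (EuclideanSpace.proj i : E4 →L[ℝ] ℝ).hasFDerivAt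
  have h := (((((hp 0).pow 2).mul_const (1 / 2)).sub (((hp 0).pow 3).mul_const (1 / 3))).sub
      (((hp 1).pow 2).const_mul (η / 2))).add ((hp 1).mul (hp 3)) |>.sub
      (((hp 2).pow 2).mul_const (1 / 2))
  have h' : HasFDerivAt (H η) _ x := h.congr_of_eventuallyEq (Eventually.of_forall fun y => by
    simp [H]; ring)
  rw [h'.fderiv]
  simp
  ring

/-- Near a transverse point of `v₂`, the crossings of the section by the unstable manifold form a
curve that is parametrized by the coordinate `x₃`. -/
theorem TurningOrbit.exists_curve {η δ r : ℝ} {a b : E2 → ℝ} {k : ℕ} {q : E4}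
    {γ : ℝ → E4} {T τ : ℝ} {u₀ : E2} (h : TurningOrbit η δ r a b k q γ T τ u₀)
    (hab : IsLocalUnstableGraph η δ a b) (hr : 0 < r) (hrδ : r < δ)
    {q₄ : ℝ} (hq : q = !₂[3 / 2, 0, 0, q₄])
    (htrans : TransverseToV₂At η a b r q) :
    ∃ ε > 0, ∃ (e : ℝ → E4) (w : ℝ → E2), ContinuousOn e (Icc (-ε) ε) ∧
      ContinuousOn w (Icc (-ε) ε) ∧ e 0 = q ∧ w 0 = u₀ ∧
      (∀ σ ∈ Icc (-ε) ε, e σ 1 = 0 ∧ e σ 2 = σ ∧ FlowsTo η T (graphMap a b (w σ)) (e σ)) ∧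
      ∀ᶠ u in 𝓝 u₀, ∀ y, FlowsTo η T (graphMap a b u) y → y 1 = 0 → y 2 ∈ Icc (-ε) ε →
        y = e (y 2) := by
  have hT := h.T_pos
  have hτ := h.τ_pos
  rw [TransverseToV₂At, h.unstableTangentSpace_eq hr] at htrans
  have hu₀ : u₀ ∈ Metric.ball (0 : E2) δ := by rw [mem_ball_zero_iff, h.norm_u₀]; exact hrδ
  have hshift : IsSol η (fun t => γ (t + -T)) (Icc 0 T) := h.isSol.shift (-T) fun t ht => by
    simp only [mem_Iic]; linarith [ht.2]
  have hs0 : γ (0 + -T) = graphMap a b u₀ := by rw [zero_add, h.at_neg_T]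
  obtain ⟨Ψ, ρ, hρ, L, h1, h2⟩ := exists_flow_chart le_rfl hT.le hshift
  rw [hs0] at h1 h2
  have hcd := contDiffAt_graphMap hab hu₀
  have hnear : ∀ᶠ u in 𝓝 u₀, graphMap a b u ∈ Metric.ball (graphMap a b u₀) ρ :=
    hcd.continuousAt.eventually (Metric.ball_mem_nhds _ hρ)
  have hflows : ∀ u, graphMap a b u ∈ Metric.ball (graphMap a b u₀) ρ →
      FlowsTo η T (graphMap a b u) (Ψ (graphMap a b u) T) := fun u hu => by
    have := (h1 _ hu).2.flowsTo ordConnected_Icc (left_mem_Icc.2 hT.le) (right_mem_Icc.2 hT.le)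
    rwa [sub_zero, (h1 _ hu).1] at this
  set Φ : E2 → E4 := fun u => Ψ (graphMap a b u) T with hΦ
  have heq : (fun w => flow η T (graphMap a b w)) =ᶠ[𝓝 u₀] Φ :=
    hnear.mono fun u hu => flow_eq (hflows u hu)
  have hΦ0 : Φ u₀ = q := by
    have hfl := h.isSol.flowsTo ordConnected_Iic (c := -T) (t := 0) (show -T ≤ τ by linarith) hτ.le
    rw [h.at_neg_T, h.at_zero, zero_sub, neg_neg] at hfl
    exact (hflows u₀ (Metric.mem_ball_self hρ)).unique hfl
  rw [heq.fderiv_eq] at htrans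
  have hker : ∀ v : E4, v ∈ LinearMap.ker (fderiv ℝ (H η) q : E4 →ₗ[ℝ] ℝ) ↔
      -(3 / 4) * v 0 + v 1 * q₄ = 0 := fun v => by
    rw [LinearMap.mem_ker, ContinuousLinearMap.coe_coe, fderiv_H, hq]
    simp only [Matrix.cons_val_zero, Matrix.cons_val_one, Matrix.cons_val]
    constructor <;> intro h <;> linarith
  -- Any prescribed `(α, β)` extends to a vector of the kernel of `dH(q)`, and the direction of `v₂`
  -- only affects the fourth coordinate. So the tangent plane of the unstable manifold already
  -- projects onto the `(x₂, x₃)` plane.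
  have hsurj : ∀ α β : ℝ, ∃ w : E2, fderiv ℝ Φ u₀ w 1 = α ∧ fderiv ℝ Φ u₀ w 2 = β := fun α β => by
    have hv : (!₂[4 / 3 * q₄ * α, α, β, 0] : E4) ∈
        LinearMap.ker (fderiv ℝ (H η) q : E4 →ₗ[ℝ] ℝ) := by
      rw [hker]; simp; ring
    rw [← htrans, Submodule.mem_sup] at hv
    obtain ⟨_, ⟨w, rfl⟩, z, hz, hwz⟩ := hv
    obtain ⟨c, rfl⟩ := Submodule.mem_span_singleton.1 hz
    refine ⟨w, ?_, ?_⟩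
    · simpa using congrArg (fun x : E4 => x 1) hwz
    · simpa using congrArg (fun x : E4 => x 2) hwz
  -- Without differentiability `fderiv` takes the value `0`, which contradicts the surjectivity just
  -- obtained.
  have hdiff : DifferentiableAt ℝ Φ u₀ := by
    by_contra hnd
    obtain ⟨w, hw, -⟩ := hsurj 1 0
    rw [fderiv_zero_of_not_differentiableAt hnd] at hw
    simp at hw
  have hstrict := hasStrictFDerivAt_flow_comp hρ hT.le h1 h2 (hcd.hasStrictFDerivAt one_ne_zero)
    hdiff.hasFDerivAt
  set P : E4 →L[ℝ] ℝ × ℝ := (EuclideanSpace.proj 1).prod (EuclideanSpace.proj 2) with hP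
  have hPapp : ∀ x, P x = (x 1, x 2) := fun x => rfl
  set A : E2 →L[ℝ] ℝ × ℝ := P.comp (fderiv ℝ Φ u₀) with hA
  have hAsurj : Function.Surjective (A : E2 →ₗ[ℝ] ℝ × ℝ) := fun ⟨α, β⟩ => by
    obtain ⟨w, h1, h2⟩ := hsurj α β
    exact ⟨w, Prod.ext h1 h2⟩
  have hAinj : Function.Injective (A : E2 →ₗ[ℝ] ℝ × ℝ) :=
    (LinearMap.injective_iff_surjective_of_finrank_eq_finrank (by simp)).2 hAsurj
  let A' : E2 ≃L[ℝ] ℝ × ℝ := (LinearEquiv.ofBijective _ ⟨hAinj, hAsurj⟩).toContinuousLinearEquiv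
  have hF : HasStrictFDerivAt (fun u => P (Φ u)) (A' : E2 →L[ℝ] ℝ × ℝ) u₀ := by
    have : (A' : E2 →L[ℝ] ℝ × ℝ) = A := by ext1 x; rfl
    rw [this]
    exact P.hasStrictFDerivAt.comp u₀ hstrict
  -- The inverse function theorem in `(x₂, x₃)`; the curve is the image of `σ ↦ (0, σ)` under the
  -- local inverse, followed by the flow.
  set f := hF.toOpenPartialHomeomorph _ with hf
  have hfc : ∀ u, f u = P (Φ u) := fun u => rfl
  have hsrc : u₀ ∈ f.source := hF.mem_toOpenPartialHomeomorph_source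
  have hfu : f u₀ = (0, 0) := by rw [hfc, hΦ0, hPapp, hq]; simp
  have htgt : ((0 : ℝ), (0 : ℝ)) ∈ f.target := hfu ▸ f.map_source hsrc
  have hsym0 : f.symm (0, 0) = u₀ := by rw [← hfu, f.left_inv hsrc]
  have hΦc : ∀ᶠ u in 𝓝 u₀, ContinuousAt Φ u := by
    have hop : ∀ᶠ u in 𝓝 u₀, u ∈ Metric.ball (0 : E2) δ := Metric.isOpen_ball.mem_nhds hu₀
    filter_upwards [hnear, hop] with u hu hub
    have c1 : ContinuousAt (fun y => Ψ y T) (graphMap a b u) :=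
      (h2 T ⟨hT.le, le_rfl⟩).continuousOn.continuousAt (Metric.isOpen_ball.mem_nhds hu)
    exact c1.comp (contDiffAt_graphMap hab hub).continuousAt
  have hev : ∀ᶠ p in 𝓝 ((0 : ℝ), (0 : ℝ)), p ∈ f.target ∧
      (graphMap a b (f.symm p) ∈ Metric.ball (graphMap a b u₀) ρ ∧ ContinuousAt Φ (f.symm p)) := by
    refine (Filter.eventually_mem_set.2 (f.open_target.mem_nhds htgt)).and ?_
    have := (f.continuousAt_symm htgt).tendsto
    rw [hsym0] at this
    exact this.eventually (hnear.and hΦc)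
  have hline : Continuous fun σ : ℝ => ((0 : ℝ), σ) := by fun_prop
  obtain ⟨ε, hε, hev'⟩ := Metric.eventually_nhds_iff.1 ((hline.tendsto 0).eventually hev)
  have hmem : ∀ σ ∈ Icc (-(ε / 2)) (ε / 2), dist σ 0 < ε := fun σ hσ => by
    rw [Real.dist_eq, sub_zero]
    exact (abs_le.2 hσ).trans_lt (by linarith)
  have hwc : ContinuousOn (fun σ : ℝ => f.symm (0, σ)) (Icc (-(ε / 2)) (ε / 2)) := fun σ hσ =>
    ((f.continuousAt_symm (hev' (hmem σ hσ)).1).comp (f := fun σ : ℝ => ((0 : ℝ), σ))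
      hline.continuousAt).continuousWithinAt
  refine ⟨ε / 2, by positivity, fun σ => Φ (f.symm (0, σ)), fun σ => f.symm (0, σ), fun σ hσ => ?_,
    hwc, by simp only [hsym0, hΦ0], hsym0, fun σ hσ => ?_, ?_⟩
  · exact ContinuousAt.comp_continuousWithinAt (f := fun σ : ℝ => f.symm (0, σ))
      (hev' (hmem σ hσ)).2.2 (hwc σ hσ)
  · obtain ⟨hσt, hσb, -⟩ := hev' (hmem σ hσ)
    have := f.right_inv hσt
    rw [hfc, hPapp] at this
    exact ⟨congrArg Prod.fst this, congrArg Prod.snd this, hflows _ hσb⟩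
  · filter_upwards [hnear, f.open_source.mem_nhds hsrc] with u hu hus y hy hy1 hy2
    obtain rfl : y = Φ u := hy.unique (hflows u hu)
    have : f u = (0, Φ u 2) := by rw [hfc, hPapp, hy1]
    rw [← this, f.left_inv hus]

/-! ### Crossings of the section near a fold -/

theorem strictMonoOn_coord {η : ℝ} {γ : ℝ → E4} {c d : ℝ} (h : IsSol η γ (Icc c d)) (i : Fin 4)
    (σ : ℝ) (hpos : ∀ t ∈ Ioo c d, 0 < σ * X η (γ t) i) :
    StrictMonoOn (fun t => σ * γ t i) (Icc c d) := by
  refine strictMonoOn_of_hasDerivWithinAt_pos (f' := fun t => σ * X η (γ t) i) (convex_Icc c d)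
    (continuousOn_const.mul (h.continuousOn_coord i)) (fun t ht => ?_) fun t ht => ?_
  · exact ((h.coord (interior_subset ht) i).mono interior_subset).const_mul σ
  · rw [interior_Icc] at ht; exact hpos t ht

/-! ### Orbits with `x₄ > 0`, where `x₂` is strictly convex in time -/

section

variable {η : ℝ} {γ : ℝ → E4} {c d : ℝ} (h : IsSol η γ (Icc c d)) (h4 : ∀ t ∈ Icc c d, 0 < γ t 3)
include h h4

theorem strictMonoOn_x3 : StrictMonoOn (fun t => γ t 2) (Icc c d) := by
  simpa using strictMonoOn_coord h 2 1 fun t ht => by simpa using h4 t (Ioo_subset_Icc_self ht)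

theorem x2_lt_of_x3_nonpos {s t : ℝ} (hs : c ≤ s) (hst : s < t) (ht : t ≤ d) (h3 : γ t 2 ≤ 0) :
    γ t 1 < γ s 1 := by
  have hm := strictMonoOn_coord (h.mono (Icc_subset_Icc hs ht)) 1 (-1) fun v hv => by
    have := strictMonoOn_x3 h h4 ⟨hs.trans hv.1.le, hv.2.le.trans ht⟩ ⟨hs.trans hst.le, ht⟩ hv.2
    simp only [X_apply_one] at this ⊢
    linarith
  have := hm (left_mem_Icc.2 hst.le) (right_mem_Icc.2 hst.le) hst
  simp only at this
  linarith

theorem x2_lt_of_x3_nonneg {s t : ℝ} (hs : c ≤ s) (hst : s < t) (ht : t ≤ d) (h3 : 0 ≤ γ s 2) :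
    γ s 1 < γ t 1 := by
  have hm := strictMonoOn_coord (h.mono (Icc_subset_Icc hs ht)) 1 1 fun v hv => by
    have := strictMonoOn_x3 h h4 ⟨hs, hst.le.trans ht⟩ ⟨hs.trans hv.1.le, hv.2.le.trans ht⟩ hv.1
    simp only [X_apply_one] at this ⊢
    linarith
  have := hm (left_mem_Icc.2 hst.le) (right_mem_Icc.2 hst.le) hst
  simp only at this
  linarith

/-- The convex function `x₂` starts at `0` with negative slope and ends positive, so it returns to
`0` exactly once, with positive slope. -/
theorem exists_next_crossing (hc : c ≤ 0) (hd : 0 < d) (h1 : γ 0 1 = 0) (h3 : γ 0 2 < 0)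
    (hend : 0 < γ d 1) : ∃ θ ∈ Ioo 0 d, γ θ 1 = 0 ∧ 0 < γ θ 2 ∧ (∀ t ∈ Ioo 0 θ, γ t 1 < 0) ∧
      ∀ t ∈ Ioc θ d, 0 < γ t 1 := by
  have hcont : ContinuousWithinAt (fun t => γ t 2) (Icc 0 d) 0 :=
    (h.continuousOn_coord 2 0 ⟨hc, hd.le⟩).mono (Icc_subset_Icc hc le_rfl)
  obtain ⟨t₁, ht₁, ht₁d⟩ : ∃ t, γ t 2 < 0 ∧ t ∈ Ioo 0 d := by
    have h1 : ∀ᶠ t in 𝓝[Icc 0 d] (0 : ℝ), γ t 2 < 0 := hcont.eventually_lt_const h3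
    have h2 : 𝓝[>] (0 : ℝ) ≤ 𝓝[Icc 0 d] 0 := by
      rw [nhdsWithin_Icc_eq_nhdsGE hd]; exact nhdsWithin_mono _ Ioi_subset_Ici_self
    exact ((h1.filter_mono h2).and (Ioo_mem_nhdsGT hd)).exists
  have hneg : γ t₁ 1 < 0 := h1 ▸ x2_lt_of_x3_nonpos h h4 hc ht₁d.1 ht₁d.2.le ht₁.le
  obtain ⟨θ, hθ, hθ0⟩ := intermediate_value_Icc ht₁d.2.le ((h.continuousOn_coord 1).mono
    (Icc_subset_Icc (hc.trans ht₁d.1.le) le_rfl)) (show (0 : ℝ) ∈ Icc (γ t₁ 1) (γ d 1) from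
      ⟨hneg.le, hend.le⟩)
  simp only at hθ0
  have hθ1 : 0 < θ := ht₁d.1.trans_le hθ.1
  have hθd : θ < d := lt_of_le_of_ne hθ.2 fun e => by rw [e] at hθ0; linarith
  have hθ3 : 0 < γ θ 2 := by
    by_contra! hle
    have := x2_lt_of_x3_nonpos h h4 hc hθ1 hθd.le hle
    linarith
  refine ⟨θ, ⟨hθ1, hθd⟩, hθ0, hθ3, fun t ht => ?_, fun t ht => ?_⟩
  · rcases le_total (γ t 2) 0 with hle | hle
    · exact h1 ▸ x2_lt_of_x3_nonpos h h4 hc ht.1 (ht.2.le.trans hθd.le) hle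
    · exact hθ0 ▸ x2_lt_of_x3_nonneg h h4 (hc.trans ht.1.le) ht.2 hθd.le hle
  · exact hθ0 ▸ x2_lt_of_x3_nonneg h h4 (hc.trans hθ1.le) ht.1 ht.2 hθ3.le

/-- The time-reversed companion of `exists_next_crossing`; it identifies a crossing with `x₃ > 0` as
the second of a pair. -/
theorem exists_previous_crossing (hc : c < 0) (hd : 0 ≤ d) (h1 : γ 0 1 = 0) (h3 : 0 < γ 0 2)
    (hend : 0 < γ c 1) : ∃ t ∈ Ioo c 0, γ t 1 = 0 := by
  have hcont : ContinuousWithinAt (fun t => γ t 2) (Icc c 0) 0 :=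
    (h.continuousOn_coord 2 0 ⟨hc.le, hd⟩).mono (Icc_subset_Icc le_rfl hd)
  obtain ⟨t₁, ht₁, ht₁d⟩ : ∃ t, 0 < γ t 2 ∧ t ∈ Ioo c 0 := by
    have h1 : ∀ᶠ t in 𝓝[Icc c 0] (0 : ℝ), 0 < γ t 2 := hcont.eventually_const_lt h3
    have h2 : 𝓝[<] (0 : ℝ) ≤ 𝓝[Icc c 0] 0 := by
      rw [nhdsWithin_Icc_eq_nhdsLE hc]; exact nhdsWithin_mono _ Iio_subset_Iic_self
    exact ((h1.filter_mono h2).and (Ioo_mem_nhdsLT hc)).exists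
  have hneg : γ t₁ 1 < 0 := h1 ▸ x2_lt_of_x3_nonneg h h4 ht₁d.1.le ht₁d.2 hd ht₁.le
  obtain ⟨θ, hθ, hθ0⟩ := intermediate_value_Icc' ht₁d.1.le ((h.continuousOn_coord 1).mono
    (Icc_subset_Icc le_rfl (ht₁d.2.le.trans hd))) (show (0 : ℝ) ∈ Icc (γ t₁ 1) (γ c 1) from
      ⟨hneg.le, hend.le⟩)
  simp only at hθ0
  exact ⟨θ, ⟨lt_of_le_of_ne hθ.1 fun e => by rw [← e] at hθ0; linarith, hθ.2.trans_lt ht₁d.2⟩, hθ0⟩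

end

/-! ### Stability of the number of transverse crossings -/

theorem isOpen_coord_lt (σ : ℝ) (i : Fin 4) : IsOpen {x : E4 | 0 < σ * x i} :=
  isOpen_lt continuous_const
    (continuous_const.mul (EuclideanSpace.proj i : E4 →L[ℝ] ℝ).continuous)

theorem isClosed_S : IsClosed S :=
  isClosed_eq (EuclideanSpace.proj 1 : E4 →L[ℝ] ℝ).continuous continuous_const

/-- In a small window around each transverse zero, `x₂` remains strictly monotone along nearby
orbits and changes sign, so it has exactly one zero there. On the compact set of remaining times,
avoiding `S` is an open condition. -/
theorem eventually_encard_crossings_eq {η : ℝ} {γ : ℝ → E4} {α β c d : ℝ} (hα : α ≤ 0)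
    (hβ : 0 ≤ β) (h : IsSol η γ (Icc α β)) (hc : α ≤ c) (hd : d ≤ β) (hcS : γ c ∉ S)
    (hdS : γ d ∉ S) (hfin : {t | t ∈ Icc c d ∧ γ t ∈ S}.Finite)
    (htr : ∀ t ∈ Icc c d, γ t ∈ S → γ t 2 ≠ 0) :
    ∀ᶠ y in 𝓝 (γ 0), ∀ γ' : ℝ → E4, IsSol η γ' (Icc α β) → γ' 0 = y →
      {t | t ∈ Icc c d ∧ γ' t ∈ S}.encard = {t | t ∈ Icc c d ∧ γ t ∈ S}.encard := by
  set Z := {t | t ∈ Icc c d ∧ γ t ∈ S} with hZ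
  have hsub : Icc c d ⊆ Icc α β := Icc_subset_Icc hc hd
  have hin : ∀ z ∈ Z, z ∈ Ioo c d := fun z hz =>
    ⟨lt_of_le_of_ne hz.1.1 fun e => hcS (e ▸ hz.2), lt_of_le_of_ne hz.1.2 fun e => hdS (e ▸ hz.2)⟩
  set σ : ℝ → ℝ := fun z => SignType.sign (γ z 2) with hσ
  have hσpos : ∀ z ∈ Z, 0 < σ z * γ z 2 := fun z hz => by
    simp only [hσ, sign_mul_self, abs_pos]
    exact htr z hz.1 hz.2
  -- The windows must lie in `(c, d)`, keep the direction of crossing, and be disjoint, so that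
  -- different windows give different zeros.
  have hε : ∀ᶠ ε in 𝓝[>] (0 : ℝ), ∀ z ∈ Z, (∀ t ∈ Icc (z - ε) (z + ε), t ∈ Ioo c d ∧
      0 < σ z * γ t 2) ∧ ∀ z' ∈ Z, z ≠ z' → 2 * ε < |z - z'| := by
    refine (eventually_all_finite hfin).2 fun z hz => Filter.Eventually.and ?_ ?_
    · have hn : ∀ᶠ t in 𝓝 z, t ∈ Ioo c d ∧ 0 < σ z * γ t 2 := by
        have hcd : Ioo c d ∈ 𝓝 z := Ioo_mem_nhds (hin z hz).1 (hin z hz).2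
        refine Filter.Eventually.and hcd ?_
        have hcont : ContinuousAt (fun t => σ z * γ t 2) z :=
          continuousAt_const.mul ((h.continuousOn_coord 2).continuousAt
            (mem_of_superset hcd (Ioo_subset_Icc_self.trans hsub)))
        exact hcont.eventually_const_lt (hσpos z hz)
      obtain ⟨ε₀, hε₀, hb⟩ := Metric.eventually_nhds_iff.1 hn
      filter_upwards [Ioo_mem_nhdsGT hε₀] with ε hε t ht
      refine hb ?_
      rw [Real.dist_eq, abs_lt]
      constructor <;> linarith [ht.1, ht.2, hε.2]
    · refine (eventually_all_finite hfin).2 fun z' hz' => ?_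
      by_cases hne : z = z'
      · simp [hne]
      · have : 0 < |z - z'| / 2 := by
          have := abs_pos.2 (sub_ne_zero.2 hne); positivity
        filter_upwards [Ioo_mem_nhdsGT this] with ε hε _
        linarith [hε.2]
  obtain ⟨ε, hεZ, hε0⟩ := (hε.and self_mem_nhdsWithin).exists
  have hε0 : 0 < ε := hε0
  have hIsub : ∀ z ∈ Z, Icc (z - ε) (z + ε) ⊆ Icc α β := fun z hz t ht =>
    hsub (Ioo_subset_Icc_self ((hεZ z hz).1 t ht).1)
  have hmono : ∀ z ∈ Z, ∀ γ' : ℝ → E4, IsSol η γ' (Icc α β) →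
      (∀ t ∈ Icc (z - ε) (z + ε), 0 < σ z * γ' t 2) →
      StrictMonoOn (fun t => σ z * γ' t 1) (Icc (z - ε) (z + ε)) := fun z hz γ' hγ' hp =>
    strictMonoOn_coord (hγ'.mono (hIsub z hz)) 1 (σ z) fun t ht => hp t (Ioo_subset_Icc_self ht)
  have hK : IsCompact (Icc c d \ ⋃ z ∈ Z, Ioo (z - ε) (z + ε)) :=
    isCompact_Icc.diff (isOpen_biUnion fun _ _ => isOpen_Ioo)
  have ev1 := eventually_mem_of_isCompact hα hβ h hK (sdiff_subset.trans hsub)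
    isClosed_S.isOpen_compl fun t ht hS => ht.2 (mem_iUnion₂.2 ⟨t, ⟨ht.1, hS⟩,
      ⟨by linarith, by linarith⟩⟩)
  have ev2 : ∀ᶠ y in 𝓝 (γ 0), ∀ z ∈ Z, ∀ γ' : ℝ → E4, IsSol η γ' (Icc α β) → γ' 0 = y →
      (∀ t ∈ Icc (z - ε) (z + ε), 0 < σ z * γ' t 2) ∧ 0 < -σ z * γ' (z - ε) 1 ∧
      0 < σ z * γ' (z + ε) 1 := by
    refine (eventually_all_finite hfin).2 fun z hz => ?_
    have hm := hmono z hz γ h fun t ht => ((hεZ z hz).1 t ht).2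
    have hz0 : γ z 1 = 0 := hz.2
    have m1 : z - ε ∈ Icc (z - ε) (z + ε) := ⟨le_rfl, by linarith⟩
    have m2 : z + ε ∈ Icc (z - ε) (z + ε) := ⟨by linarith, le_rfl⟩
    have m3 : z ∈ Icc (z - ε) (z + ε) := ⟨by linarith, by linarith⟩
    have s1 := hm m1 m3 (by linarith)
    have s2 := hm m3 m2 (by linarith)
    simp only [hz0, mul_zero] at s1 s2
    filter_upwards [eventually_mem_of_isCompact hα hβ h isCompact_Icc (hIsub z hz)
        (isOpen_coord_lt (σ z) 2) fun t ht => ((hεZ z hz).1 t ht).2,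
      eventually_mem_of_isCompact hα hβ h isCompact_singleton
        (singleton_subset_iff.2 (hIsub z hz m1)) (isOpen_coord_lt (-σ z) 1) (by
          rintro t rfl; simp only [mem_ofPred_eq]; linarith),
      eventually_mem_of_isCompact hα hβ h isCompact_singleton
        (singleton_subset_iff.2 (hIsub z hz m2)) (isOpen_coord_lt (σ z) 1) (by
          rintro t rfl; exact s2)] with y e1 e2 e3 γ' hγ' h0
    exact ⟨e1 γ' hγ' h0, e2 γ' hγ' h0 _ rfl, e3 γ' hγ' h0 _ rfl⟩
  filter_upwards [ev1, ev2] with y hy1 hy2 γ' hγ' h0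
  have hex : ∀ z ∈ Z, ∃ t ∈ Ioo (z - ε) (z + ε), γ' t 1 = 0 := fun z hz => by
    obtain ⟨e1, e2, e3⟩ := hy2 z hz γ' hγ' h0
    have hcz : ContinuousOn (fun t => σ z * γ' t 1) (Icc (z - ε) (z + ε)) :=
      continuousOn_const.mul ((hγ'.mono (hIsub z hz)).continuousOn_coord 1)
    obtain ⟨t, ht, ht0⟩ := intermediate_value_Icc (show z - ε ≤ z + ε by linarith) hcz
      (show (0 : ℝ) ∈ Icc (σ z * γ' (z - ε) 1) (σ z * γ' (z + ε) 1) from ⟨by linarith, e3.le⟩)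
    simp only at ht0
    refine ⟨t, ⟨lt_of_le_of_ne ht.1 fun e => ?_, lt_of_le_of_ne ht.2 fun e => ?_⟩,
      (mul_eq_zero.1 ht0).resolve_left fun e => ?_⟩
    · rw [← e] at ht0; linarith
    · rw [e] at ht0; linarith
    · rw [e, zero_mul] at e3; exact lt_irrefl _ e3
  choose! ζ hζ hζ0 using hex
  have himg : {t | t ∈ Icc c d ∧ γ' t ∈ S} = ζ '' Z := by
    ext t
    constructor
    · rintro ⟨ht, htS⟩
      by_cases hU : t ∈ ⋃ z ∈ Z, Ioo (z - ε) (z + ε)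
      · obtain ⟨z, hz, htz⟩ := mem_iUnion₂.1 hU
        refine ⟨z, hz, ?_⟩
        refine (hmono z hz γ' hγ' (hy2 z hz γ' hγ' h0).1).injOn (Ioo_subset_Icc_self (hζ z hz))
          (Ioo_subset_Icc_self htz) ?_
        have : γ' t 1 = 0 := htS
        simp only [hζ0 z hz, this]
      · exact absurd htS (hy1 γ' hγ' h0 t ⟨ht, hU⟩)
    · rintro ⟨z, hz, rfl⟩
      exact ⟨Ioo_subset_Icc_self ((hεZ z hz).1 _ (Ioo_subset_Icc_self (hζ z hz))).1, hζ0 z hz⟩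
  rw [himg]
  refine InjOn.encard_image fun z hz z' hz' e => ?_
  by_contra hne
  have h2 := (hεZ z hz).2 z' hz' hne
  have a1 := hζ z hz
  have a2 := hζ z' hz'
  rw [← e] at a2
  have : |z - z'| < 2 * ε := by
    rw [abs_lt]; constructor <;> linarith [a1.1, a1.2, a2.1, a2.2]
  linarith

/-! ### The orbits near a turning point -/

/-- A solution that passes at the time `0` near the turning point, followed backwards up to the time
`-M`: it stays in `W` for `|t| ≤ τ`, and it can be on `D^u` only at times close to `-T`. -/
structure NearTurning (η δ r : ℝ) (a b : E2 → ℝ) (k : ℕ) (W : Set E4) (N : Set E2) (T τ M : ℝ)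
    (γ : ℝ → E4) : Prop where
  isSol : IsSol η γ (Icc (-M) τ)
  mem_W : ∀ t ∈ Icc (-τ) τ, γ t ∈ W
  left_pos : 0 < γ (-τ) 1
  right_pos : 0 < γ τ 1
  not_mem_S : ∀ t ∈ Icc (-T - τ) (-T + τ), γ t ∉ S
  norm_lt : ∀ t ∈ Icc (-T - τ) (-T + τ), ‖base (γ t)‖ < δ
  inside : ‖base (γ (-T - τ))‖ < r
  outside : r < ‖base (γ (-T + τ))‖
  encard_add_one : {t | t ∈ Icc (-T + τ) (-τ) ∧ γ t ∈ S}.encard + 1 = k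
  of_mem_Du : ∀ t ∈ Icc (-M) 0, γ t ∈ Du a b r → t ∈ Ioo (-T - τ) (-T + τ)
  base_mem : base (γ (-T)) ∈ N
  many : ∃ Z : Finset ℝ, Z.card = k + 1 ∧ ∀ t ∈ Z, t ∈ Ioo (-M) 0 ∧ γ t ∈ S

/-- Besides the stable crossing count, all requirements are open conditions over compact sets of
times, so they pass from the orbit of `q` to nearby orbits. The count on `[-T + τ₁, -τ₁]` is `k -
1`, since the tangency at time `0` is left out. `M` is so large that `k + 1` crossings occur in
`(-M, 0)`, which bounds the time a `k`-th hit may have taken. -/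
theorem TurningOrbit.eventually_nearTurning {η δ r : ℝ} {a b : E2 → ℝ} {k : ℕ} {q : E4}
    {γ : ℝ → E4} {T τ : ℝ} {u₀ : E2} (h : TurningOrbit η δ r a b k q γ T τ u₀)
    (hη : η ∈ Ioo (-2 : ℝ) 2) (hab : IsLocalUnstableGraph η δ a b) (hr : 0 < r) (hrδ : r < δ)
    {q₄ : ℝ} (hq : q = !₂[3 / 2, 0, 0, q₄]) {W : Set E4} (hW : IsOpen W) (hqW : q ∈ W)
    (hW4 : ∀ x ∈ W, 0 < x 3) {N : Set E2} (hN : N ∈ 𝓝 u₀) :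
    ∃ τ₁ > 0, ∃ M, 2 * τ₁ < T ∧ T + τ₁ ≤ M ∧ IsSol η γ (Icc (-M) τ₁) ∧
      ∀ᶠ y in 𝓝 q, ∀ γ' : ℝ → E4, IsSol η γ' (Icc (-M) τ₁) → γ' 0 = y →
        NearTurning η δ r a b k W N T τ₁ M γ' := by
  have hT := h.T_pos
  have hτ := h.τ_pos
  obtain ⟨εa, hεa, hafter⟩ := h.after
  have hnorm0 : ‖base (γ (-T))‖ = r := by rw [h.at_neg_T, base_graphMap, h.norm_u₀]
  have hca : ∀ t < τ, ContinuousAt γ t := fun t ht =>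
    h.isSol.continuousOn.continuousAt (Iic_mem_nhds ht)
  have e0 : ∀ᶠ t in 𝓝 (0 : ℝ), γ t ∈ W :=
    (hca 0 hτ).eventually (hW.mem_nhds (by rwa [h.at_zero]))
  have e1 : ∀ᶠ t in 𝓝 (-T), γ t ∉ S ∧ ‖base (γ t)‖ < δ :=
    ((hca (-T) (by linarith)).eventually (isClosed_S.isOpen_compl.mem_nhds h.not_mem_S)).and
      ((base.continuous.continuousAt.comp (hca (-T) (by linarith))).norm.eventually_lt_const (by
        simp only [Function.comp_apply, hnorm0]; exact hrδ))
  obtain ⟨ε₀, hε₀, hb0⟩ := Metric.eventually_nhds_iff.1 e0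
  obtain ⟨ε₁, hε₁, hb1⟩ := Metric.eventually_nhds_iff.1 e1
  obtain ⟨τ₁, hτ₁, hlt⟩ := exists_between (show 0 < min (min ε₀ ε₁) (min (min τ εa) (T / 2)) by
    positivity)
  simp only [lt_min_iff] at hlt
  obtain ⟨⟨l0, l1⟩, ⟨l2, l3⟩, l4⟩ := hlt
  have hW' : ∀ t ∈ Icc (-τ₁) τ₁, γ t ∈ W := fun t ht => hb0 (by
    rw [Real.dist_eq, sub_zero]; exact (abs_le.2 ht).trans_lt l0)
  have hT' : ∀ t ∈ Icc (-T - τ₁) (-T + τ₁), γ t ∉ S ∧ ‖base (γ t)‖ < δ := fun t ht => hb1 (by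
    rw [Real.dist_eq, abs_lt]; constructor <;> linarith [ht.1, ht.2])
  have hsol0 : IsSol η γ (Icc (-τ₁) τ₁) := h.isSol.mono fun t ht => ht.2.trans l2.le
  have hx4 : ∀ t ∈ Icc (-τ₁) τ₁, 0 < γ t 3 := fun t ht => hW4 _ (hW' t ht)
  have hx2 : γ 0 1 = 0 := by rw [h.at_zero, hq]; simp
  have hx3 : γ 0 2 = 0 := by rw [h.at_zero, hq]; simp
  have hneg : ∀ t ∈ Ico (-τ₁) 0, 0 < γ t 1 := fun t ht =>
    hx2 ▸ x2_lt_of_x3_nonpos hsol0 hx4 ht.1 ht.2 hτ₁.le hx3.le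
  have hpos : 0 < γ τ₁ 1 :=
    hx2 ▸ x2_lt_of_x3_nonneg hsol0 hx4 (neg_nonpos.2 hτ₁.le) hτ₁ le_rfl hx3.ge
  obtain ⟨M₀, hM₀, hmany⟩ := eventually_many_crossings hab hη (hr.trans hrδ)
    (h.isSol.mono (Iic_subset_Iic.2 hτ.le)) h.tendsto h.ne_zero (k + 1)
  set M := max M₀ (T + τ₁) with hM
  have hMT : T + τ₁ ≤ M := le_max_right _ _
  have hM0 : M₀ ≤ M := le_max_left _ _
  have hsol : IsSol η γ (Icc (-M) τ₁) := h.isSol.mono fun t ht => ht.2.trans l2.le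
  have hα : -M ≤ 0 := by linarith
  have hI : ∀ {c d}, -M ≤ c → d ≤ τ₁ → Icc c d ⊆ Icc (-M) τ₁ := fun hc hd => Icc_subset_Icc hc hd
  have key : ∀ {K : Set ℝ} (_ : IsCompact K) (_ : K ⊆ Icc (-M) τ₁) {U : Set E4} (_ : IsOpen U)
      (_ : ∀ s ∈ K, γ s ∈ U), ∀ᶠ y in 𝓝 q, ∀ γ' : ℝ → E4, IsSol η γ' (Icc (-M) τ₁) → γ' 0 = y →
      ∀ s ∈ K, γ' s ∈ U := fun hK hKs U hU hKU => by
    rw [← h.at_zero]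
    exact eventually_mem_of_isCompact hα hτ₁.le hsol hK hKs hU hKU
  have hcb : Continuous fun x : E4 => ‖base x‖ := base.continuous.norm
  have hDu : IsClosed (Du a b r) := by
    rw [du_eq hr]
    refine ((isCompact_sphere (0 : E2) r).image_of_continuousOn
      ((continuousOn_graphMap hab).mono fun u hu => ?_)).isClosed
    rw [mem_ball_zero_iff, mem_sphere_zero_iff_norm.1 hu]; exact hrδ
  have hset : {t | t ∈ Ioc (-T) 0 ∧ γ t ∈ S} =
      insert 0 {t | t ∈ Icc (-T + τ₁) (-τ₁) ∧ γ t ∈ S} := by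
    ext t
    simp only [mem_ofPred_eq, mem_insert_iff]
    constructor
    · rintro ⟨ht, htS⟩
      rcases ht.2.eq_or_lt with h0 | h0
      · exact Or.inl h0
      · refine Or.inr ⟨⟨?_, ?_⟩, htS⟩
        · by_contra! hcon
          exact (hT' t ⟨by linarith [ht.1], hcon.le⟩).1 htS
        · by_contra! hcon
          exact (hneg t ⟨hcon.le, h0⟩).ne' htS
    · rintro (rfl | ⟨ht, htS⟩)
      · exact ⟨⟨by linarith, le_rfl⟩, hx2⟩
      · exact ⟨⟨by linarith [ht.1], by linarith [ht.2]⟩, htS⟩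
  have hcard : {t | t ∈ Icc (-T + τ₁) (-τ₁) ∧ γ t ∈ S}.encard + 1 = k := by
    rw [← h.encard_crossings, hset, encard_insert_of_notMem fun h0 => by linarith [h0.1.2]]
  have hfin : {t | t ∈ Icc (-T + τ₁) (-τ₁) ∧ γ t ∈ S}.Finite := by
    refine (finite_of_encard_eq_coe h.encard_crossings).subset ?_
    rw [hset]; exact subset_insert _ _
  have ev_card := eventually_encard_crossings_eq (c := -T + τ₁) (d := -τ₁) hα hτ₁.le hsol
    (by linarith) (by linarith) (hT' _ ⟨by linarith, le_rfl⟩).1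
    (fun hS => (hneg (-τ₁) ⟨le_rfl, by linarith⟩).ne' hS) hfin
    fun t ht hS => h.transverse t ⟨by linarith [ht.1], by linarith [ht.2]⟩ hS
  rw [h.at_zero] at hmany ev_card
  have m1 : -τ₁ ∈ Icc (-M) τ₁ := ⟨by linarith, by linarith⟩
  have m2 : τ₁ ∈ Icc (-M) τ₁ := ⟨by linarith, le_rfl⟩
  have m3 : -T - τ₁ ∈ Icc (-M) τ₁ := ⟨by linarith, by linarith⟩
  have m4 : -T + τ₁ ∈ Icc (-M) τ₁ := ⟨by linarith, by linarith⟩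
  have m5 : -T ∈ Icc (-M) τ₁ := ⟨by linarith, by linarith⟩
  have hpt : ∀ {t : ℝ}, t ∈ Icc (-M) τ₁ → {t} ⊆ Icc (-M) τ₁ := fun ht => singleton_subset_iff.2 ht
  have f1 := key isCompact_Icc (hI (c := -τ₁) (d := τ₁) (by linarith) le_rfl) hW hW'
  have f2 := key isCompact_singleton (hpt m1) (isOpen_coord_lt 1 1) (by
    rintro t rfl; simpa using hneg (-τ₁) ⟨le_rfl, by linarith⟩)
  have f3 := key isCompact_singleton (hpt m2) (isOpen_coord_lt 1 1) (by
    rintro t rfl; simpa using hpos)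
  have f4 := key isCompact_Icc (hI (c := -T - τ₁) (d := -T + τ₁) (by linarith) (by linarith))
    isClosed_S.isOpen_compl fun t ht => (hT' t ht).1
  have f5 := key isCompact_Icc (hI (c := -T - τ₁) (d := -T + τ₁) (by linarith) (by linarith))
    (isOpen_lt hcb continuous_const) fun t ht => (hT' t ht).2
  have f6 := key isCompact_singleton (hpt m3) (isOpen_lt hcb (continuous_const (y := r))) (by
    rintro t rfl; exact h.before _ (by linarith))
  have f7 := key isCompact_singleton (hpt m4) (isOpen_lt (continuous_const (y := r)) hcb) (by
    rintro t rfl; exact hafter _ ⟨by linarith, by linarith⟩)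
  have f8 := key (isCompact_Icc.diff (isOpen_Ioo (a := -T - τ₁) (b := -T + τ₁)))
    (sdiff_subset.trans (hI (c := -M) (d := 0) le_rfl hτ₁.le)) hDu.isOpen_compl fun t ht hD =>
      ht.2 (by rw [h.eq_neg_T t ht.1.2 hD]; constructor <;> linarith)
  have f9 := key isCompact_singleton (hpt m5)
    (isOpen_interior.preimage base.continuous (t := interior N)) (by
      rintro t rfl
      rw [mem_preimage, h.at_neg_T, base_graphMap]
      exact mem_interior_iff_mem_nhds.2 hN)
  refine ⟨τ₁, hτ₁, M, by linarith, hMT, hsol, ?_⟩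
  filter_upwards [f1, f2, f3, f4, f5, f6, f7, f8, f9, ev_card, hmany]
    with y g1 g2 g3 g4 g5 g6 g7 g8 g9 gc gm γ' hγ' h0
  refine ⟨hγ', g1 γ' hγ' h0, by simpa using g2 γ' hγ' h0 _ rfl, by simpa using g3 γ' hγ' h0 _ rfl,
    g4 γ' hγ' h0, g5 γ' hγ' h0, g6 γ' hγ' h0 _ rfl, g7 γ' hγ' h0 _ rfl, ?_, fun t ht hD => ?_,
    interior_subset (g9 γ' hγ' h0 _ rfl), ?_⟩
  · rw [gc γ' hγ' h0, hcard]
  · by_contra hcon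
    exact g8 γ' hγ' h0 t ⟨ht, hcon⟩ hD
  · obtain ⟨Z, hZ, hZ'⟩ := gm γ' (hγ'.mono (Icc_subset_Icc (neg_le_neg hM0) hτ₁.le)) h0
    exact ⟨Z, hZ, fun t ht => ⟨⟨by linarith [(hZ' t ht).1.1], (hZ' t ht).1.2⟩, (hZ' t ht).2⟩⟩

/-! ### Which crossings near `q` are `k`-th hits -/

section

variable {η δ r : ℝ} {a b : E2 → ℝ} {k : ℕ} {W : Set E4} {N : Set E2} {T τ M : ℝ} {γ : ℝ → E4}
  (h : NearTurning η δ r a b k W N T τ M γ) (hτ : 0 < τ) (hτT : 2 * τ < T) (hTM : T + τ ≤ M)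
include h

theorem NearTurning.x4_pos (hW4 : ∀ x ∈ W, 0 < x 3) : ∀ t ∈ Icc (-τ) τ, 0 < γ t 3 :=
  fun t ht => hW4 _ (h.mem_W t ht)

include hτ hτT hTM

theorem NearTurning.isSol_Icc : IsSol η γ (Icc (-τ) τ) :=
  h.isSol.mono (Icc_subset_Icc (by linarith) le_rfl)

theorem NearTurning.onGraph (hab : IsLocalUnstableGraph η δ a b) {s t : ℝ}
    (hs : s ∈ Icc (-T - τ) (-T + τ)) (hg : OnGraph a b (γ s)) (ht : t ∈ Icc (-T - τ) (-T + τ)) :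
    OnGraph a b (γ t) :=
  onGraph_of_isSol hab ordConnected_Icc (h.isSol.mono (Icc_subset_Icc (by linarith) (by linarith)))
    (fun v hv => by rw [mem_ball_zero_iff]; exact h.norm_lt v hv) hs hg ht

variable (hW4 : ∀ x ∈ W, 0 < x 3)
include hW4

/-- The first of the two crossings near the turning point is a `k`-th crossing. -/
theorem NearTurning.mem_hits (hab : IsLocalUnstableGraph η δ a b) (hr : 0 < r)
    (hg : OnGraph a b (γ (-T))) (h1 : γ 0 1 = 0) (h3 : γ 0 2 < 0) : γ 0 ∈ SigmaU η a b r k := by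
  have hc : ContinuousOn (fun t => ‖base (γ t)‖) (Icc (-T - τ) (-T + τ)) :=
    (base.continuous.comp_continuousOn (h.isSol.continuousOn.mono
      (Icc_subset_Icc (by linarith) (by linarith)))).norm
  -- The starting point on `D^u` is found where the orbit passes the circle near the time `-T`. No
  -- crossing of `S` occurs in that window, so the exact time `s` does not affect the count.
  obtain ⟨s, hs, hsr⟩ := intermediate_value_Icc (by linarith) hc
    (show r ∈ Icc _ _ from ⟨h.inside.le, h.outside.le⟩)
  simp only at hsr
  have hsg := h.onGraph hτ hτT hTM hab ⟨by linarith, by linarith⟩ hg hs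
  have hsD : γ s ∈ Du a b r := by
    rw [du_eq hr]; exact ⟨base (γ s), by simpa using hsr, hsg.graphMap_base⟩
  have hs0 : s < 0 := by linarith [hs.2]
  have hset : {t | t ∈ Ioc 0 (-s) ∧ γ (t + s) ∈ S} =
      (fun t => t - s) '' (insert 0 {t | t ∈ Icc (-T + τ) (-τ) ∧ γ t ∈ S}) := by
    ext t
    simp only [mem_ofPred_eq, mem_image, mem_insert_iff]
    constructor
    · rintro ⟨ht, htS⟩
      refine ⟨t + s, ?_, by ring⟩
      rcases (show t + s ≤ 0 by linarith [ht.2]).eq_or_lt with h0 | h0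
      · exact Or.inl h0
      · refine Or.inr ⟨⟨?_, ?_⟩, htS⟩
        · by_contra! hcon
          exact h.not_mem_S (t + s) ⟨by linarith [ht.1, hs.1], hcon.le⟩ htS
        · by_contra! hcon
          have := x2_lt_of_x3_nonpos (h.isSol_Icc hτ hτT hTM) (h.x4_pos hW4)
            hcon.le h0 hτ.le h3.le
          rw [h1] at this
          exact this.ne' htS
    · rintro ⟨v, rfl | ⟨hv, hvS⟩, rfl⟩
      · exact ⟨⟨by linarith, by linarith⟩, by simpa using show γ 0 ∈ S from h1⟩
      · refine ⟨⟨?_, by linarith [hv.2]⟩, by simpa using hvS⟩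
        by_contra! hcon
        exact h.not_mem_S v ⟨by linarith [hv.1], by linarith [hs.2]⟩ hvS
  obtain ⟨k, rfl⟩ : ∃ n, k = n + 1 := by
    refine ⟨k - 1, ?_⟩
    have : k ≠ 0 := by
      rintro rfl
      simpa using h.encard_add_one
    omega
  rw [sigmaU_eq, mem_hits_iff]
  refine ⟨γ s, hsD, -s, by linarith, fun t => γ (t + s), h.isSol.shift s fun t ht => ?_, by simp,
    by simp, h1, ?_⟩
  · exact ⟨by linarith [ht.1, hs.1], by linarith [ht.2]⟩
  · rw [hset, (sub_left_injective (b := s)).encard_image,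
      encard_insert_of_notMem fun h0 => by linarith [h0.1.2], h.encard_add_one]
    push_cast; rfl

/-- Conversely, a `k`-th crossing near the turning point lies on the unstable manifold and is not
the second of the two crossings. -/
theorem NearTurning.of_mem_hits (hab : IsLocalUnstableGraph η δ a b) (hr : 0 < r)
    (hmem : γ 0 ∈ SigmaU η a b r k) :
    OnGraph a b (γ (-T)) ∧ γ 0 1 = 0 ∧ γ 0 2 ≤ 0 := by
  obtain ⟨k, rfl⟩ : ∃ n, k = n + 1 := by
    refine ⟨k - 1, ?_⟩
    have : k ≠ 0 := by
      rintro rfl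
      simpa using h.encard_add_one
    omega
  rw [sigmaU_eq, mem_hits_iff] at hmem
  obtain ⟨p, hp, T', hT', γ₁, hγ₁, h0, hy, hS, hcard⟩ := hmem
  have hsh : IsSol η (fun t => γ₁ (t + T')) (Icc (-T') 0) := hγ₁.shift T' fun t ht =>
    ⟨by linarith [ht.1], by linarith [ht.2]⟩
  have heq : ∀ t ∈ Icc (-T') 0, -M ≤ t → γ t = γ₁ (t + T') := fun t ht htM =>
    (h.isSol.mono (Icc_subset_Icc htM hτ.le)).eqOn ordConnected_Icc (right_mem_Icc.2 ht.2)
      (hsh.mono (Icc_subset_Icc ht.1 le_rfl)) (by simp [hy]) (left_mem_Icc.2 ht.2)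
  have hle : ∀ Z : Finset ℝ, (∀ t ∈ Z, t ∈ Ioc (-T') 0 ∧ -M ≤ t ∧ γ t ∈ S) → Z.card ≤ k + 1 :=
    fun Z hZ => by
      have hsub : (fun t => t + T') '' (Z : Set ℝ) ⊆ {t | t ∈ Ioc 0 T' ∧ γ₁ t ∈ S} := by
        rintro _ ⟨t, ht, rfl⟩
        obtain ⟨h1, h2, h3⟩ := hZ t ht
        refine ⟨⟨by linarith [h1.1], by linarith [h1.2]⟩, ?_⟩
        rwa [heq t ⟨h1.1.le, h1.2⟩ h2] at h3
      have := encard_le_encard hsub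
      rw [(add_left_injective T').encard_image, encard_coe_eq_coe_finsetCard, hcard] at this
      exact_mod_cast this
  -- An orbit followed for a time `M` or longer already has too many crossings, even without the one
  -- at time `0`.
  have hTM' : T' < M := by
    by_contra! hcon
    obtain ⟨Z, hZ, hZ'⟩ := h.many
    have := hle Z fun t ht => ⟨⟨by linarith [(hZ' t ht).1.1], (hZ' t ht).1.2.le⟩,
      (hZ' t ht).1.1.le, (hZ' t ht).2⟩
    omega
  have hpT : γ (-T') = p := by
    rw [heq (-T') ⟨le_rfl, by linarith⟩ (by linarith), neg_add_cancel, h0]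
  have hnear := h.of_mem_Du (-T') ⟨by linarith, by linarith⟩ (hpT ▸ hp)
  have hpg : OnGraph a b (γ (-T')) := by
    rw [hpT]
    rw [du_eq hr] at hp
    obtain ⟨u, -, rfl⟩ := hp
    exact onGraph_graphMap a b u
  refine ⟨h.onGraph hτ hτT hTM hab (Ioo_subset_Icc_self hnear) hpg ⟨by linarith, by linarith⟩,
    hS, ?_⟩
  -- If `x₃ > 0`, the earlier zero `v` of the pair, the `k` middle crossings and the time `0` make
  -- `k + 2` crossings after leaving `D^u`, one too many (here `k + 1` is the index of the hit).
  by_contra! h3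
  obtain ⟨v, hv, hv0⟩ := exists_previous_crossing (h.isSol_Icc hτ hτT hTM)
    (h.x4_pos hW4) (neg_lt_zero.2 hτ) hτ.le hS h3 h.left_pos
  set Z₀ := {t | t ∈ Icc (-T + τ) (-τ) ∧ γ t ∈ S} with hZ₀
  have hc0 : Z₀.encard = k := by
    have := h.encard_add_one
    push_cast at this
    exact WithTop.add_right_cancel ENat.one_ne_top this
  have hfin : Z₀.Finite := finite_of_encard_eq_coe hc0
  have hn1 : v ∉ hfin.toFinset := fun hm => by
    rw [hfin.mem_toFinset] at hm; linarith [hm.1.2, hv.1]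
  have hn2 : (0 : ℝ) ∉ insert v hfin.toFinset := fun hm => by
    rcases Finset.mem_insert.1 hm with e | hm
    · exact hv.2.ne' e
    · rw [hfin.mem_toFinset] at hm; linarith [hm.1.2]
  have := hle (insert 0 (insert v hfin.toFinset)) fun t ht => by
    have hT1 : -T' < -T + τ := hnear.2
    rcases Finset.mem_insert.1 ht with rfl | ht
    · exact ⟨⟨by linarith, le_rfl⟩, by linarith, hS⟩
    rcases Finset.mem_insert.1 ht with rfl | ht
    · exact ⟨⟨by linarith [hv.1], hv.2.le⟩, by linarith [hv.1], hv0⟩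
    · rw [hfin.mem_toFinset] at ht
      exact ⟨⟨by linarith [ht.1.1], by linarith [ht.1.2]⟩, by linarith [ht.1.1], ht.2⟩
  rw [Finset.card_insert_of_notMem hn2, Finset.card_insert_of_notMem hn1] at this
  have hcf : hfin.toFinset.card = k := by
    rw [hfin.encard_eq_coe_toFinset_card] at hc0
    exact_mod_cast hc0
  omega

end

end LoopCylinder

end

/-! ### The turning point -/

open LoopCylinder
theorem mainTheorem5
    (η : ℝ) (hη : η ∈ Ioo (-2 : ℝ) 2)
    (a b : E2 → ℝ) (δ r : ℝ) (hab : IsLocalUnstableGraph η δ a b)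
    (hr : 0 < r) (hrδ : r < δ)
    (k : ℕ) (hk : 1 ≤ k)
    (q₄ : ℝ) (hq₄ : 0 < q₄) (q : E4) (hq : q = !₂[3 / 2, 0, 0, q₄])
    (hqk : q ∈ SigmaU η a b r k ∩ v₂)
    -- the orbit of `q` crosses the fundamental domain once and only once
    (hfund : ∃! p, p ∈ Du a b r ∧ p ∈ orbit η q)
    -- before `q`, that orbit crosses the section transversally
    (hreg : ∀ p ∈ Du a b r, Disjoint (orbitArc η p q) (v₁ ∪ v₂))
    (htrans : TransverseToV₂At η a b r q) :
    ∀ V ∈ 𝓝 q, ∃ U ⊆ V, IsOpen U ∧ q ∈ U ∧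
      ∃ A₃ A₂ : Set E4,
        (SigmaU η a b r k \ {q}) ∩ U = A₃ ∧
        A₃ ⊆ C₃ η ∧
        IsOpenArcWithEndpoint A₃ q ∧
        A₃ ⊆ poincareDomain η ∧
        A₂ = poincareMap η '' A₃ ∧
        A₂ ⊆ SigmaU η a b r (k + 1) ∩ C₂ η ∩ V ∧
        IsOpenArcWithEndpoint A₂ q := by
  intro V hV
  obtain ⟨γ, T, τ₀, u₀, h⟩ := exists_turningOrbit hη hab hr hrδ hk (q := q) (by rw [hq]; simp)
    hqk.1 hfund hreg
  have hT := h.T_pos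
  obtain ⟨ε, hε, e, w, hec, -, he0, hw0, hcurve, huniq⟩ :=
    h.exists_curve hab hr hrδ hq htrans
  have hWo : IsOpen (interior V ∩ ({x : E4 | 0 < 1 * x 0} ∩ {x : E4 | 0 < 1 * x 3})) :=
    isOpen_interior.inter ((isOpen_coord_lt 1 0).inter (isOpen_coord_lt 1 3))
  set W : Set E4 := interior V ∩ ({x : E4 | 0 < 1 * x 0} ∩ {x : E4 | 0 < 1 * x 3}) with hW
  have hqW : q ∈ W :=
    ⟨mem_interior_iff_mem_nhds.2 hV, by simp [hq], by simpa [hq] using hq₄⟩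
  have hW0 : ∀ x ∈ W, 0 < x 0 := fun x hx => by simpa using hx.2.1
  have hW4 : ∀ x ∈ W, 0 < x 3 := fun x hx => by simpa using hx.2.2
  -- The neighbourhood of `u₀` supplied here is the uniqueness set of the curve `e`: a crossing near
  -- `q` reached in time `T` from the graph over it lies on the curve.
  obtain ⟨τ, hτ, M, hτT, hTM, hγ, hev⟩ := h.eventually_nearTurning hη hab hr hrδ hq hWo hqW hW4 huniq
  set N : Set E2 := {u | ∀ y, FlowsTo η T (graphMap a b u) y → y 1 = 0 → y 2 ∈ Icc (-ε) ε →
    y = e (y 2)} with hN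
  obtain ⟨Ψ, ρ, hρ, L, hΨ, hΨL⟩ := exists_flow_chart (by linarith) hτ.le hγ
  have hΨc := continuousOn_flow_chart hΨ hΨL
  rw [h.at_zero] at hΨ hΨL hΨc
  obtain ⟨O, hO, hOo, hqO⟩ := mem_nhds_iff.1 (hev.and (Metric.ball_mem_nhds q hρ))
  have hOρ : ∀ y ∈ O, y ∈ Metric.ball q ρ := fun y hy => (hO hy).2
  have hgood : ∀ y ∈ O, NearTurning η δ r a b k W N T τ M (Ψ y) := fun y hy =>
    (hO hy).1 (Ψ y) (hΨ y (hOρ y hy)).2 (hΨ y (hOρ y hy)).1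
  have hΨ0 : ∀ y ∈ O, Ψ y 0 = y := fun y hy => (hΨ y (hOρ y hy)).1
  have hm0 : (0 : ℝ) ∈ Icc (-M) τ := ⟨by linarith, hτ.le⟩
  have hmT : -T ∈ Icc (-M) τ := ⟨by linarith, by linarith⟩
  obtain ⟨ε', hε', hε'ε, heO⟩ : ∃ ε' > 0, ε' ≤ ε ∧ ∀ σ ∈ Icc (-ε') 0, e σ ∈ O ∩ interior V := by
    have hc : ContinuousAt e 0 := hec.continuousAt (Icc_mem_nhds (by linarith) hε)
    have := hc.eventually ((hOo.inter isOpen_interior).mem_nhds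
      (by rw [he0]; exact ⟨hqO, mem_interior_iff_mem_nhds.2 hV⟩))
    obtain ⟨ε₁, hε₁, hb⟩ := Metric.eventually_nhds_iff.1 this
    refine ⟨min ε (ε₁ / 2), by positivity, min_le_left _ _, fun σ hσ => hb ?_⟩
    rw [Real.dist_eq, abs_lt]
    constructor <;> linarith [hσ.1, hσ.2, min_le_right ε (ε₁ / 2)]
  have hI : Icc (-ε') 0 ⊆ Icc (-ε) ε := Icc_subset_Icc (by linarith) hε.le
  have heO' : ∀ σ ∈ Icc (-ε') 0, e σ ∈ O := fun σ hσ => (heO σ hσ).1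
  have he1 : ∀ σ ∈ Icc (-ε') 0, e σ 1 = 0 := fun σ hσ => (hcurve σ (hI hσ)).1
  have he2 : ∀ σ ∈ Icc (-ε') 0, e σ 2 = σ := fun σ hσ => (hcurve σ (hI hσ)).2.1
  have heT : ∀ σ ∈ Icc (-ε') 0, Ψ (e σ) (-T) = graphMap a b (w σ) := fun σ hσ => by
    have := (hcurve σ (hI hσ)).2.2.symm.eq_of_isSol (hgood _ (heO' σ hσ)).isSol ordConnected_Icc
      hm0 (by simpa using hmT) (hΨ0 _ (heO' σ hσ))
    rwa [zero_add] at this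
  have heg : ∀ σ ∈ Icc (-ε') 0, OnGraph a b (Ψ (e σ) (-T)) := fun σ hσ => by
    rw [heT σ hσ]; exact onGraph_graphMap a b _
  have hH : ∀ σ ∈ Icc (-ε') 0, ∀ t ∈ Icc (-M) τ, H η (Ψ (e σ) t) = 0 := fun σ hσ t ht => by
    rw [H_eq_of_isSol (hgood _ (heO' σ hσ)).isSol ordConnected_Icc ht hmT, heT σ hσ]
    refine H_eq_zero_of_mem_unstableManifold (hab.subset_unstable _ ?_)
    have := (hgood _ (heO' σ hσ)).norm_lt (-T) ⟨by linarith, by linarith⟩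
    rwa [heT σ hσ, base_graphMap, ← mem_ball_zero_iff] at this
  have hσI : ∀ σ ∈ Ioo (-ε') 0, σ ∈ Icc (-ε') 0 := fun σ hσ => Ioo_subset_Icc_self hσ
  have heSig : ∀ σ ∈ Ico (-ε') 0, e σ ∈ SigmaU η a b r k := fun σ hσ => by
    have hσ' : σ ∈ Icc (-ε') 0 := Ico_subset_Icc_self hσ
    have := (hgood _ (heO' σ hσ')).mem_hits hτ hτT hTM hW4 hab hr (heg σ hσ')
      (by rw [hΨ0 _ (heO' σ hσ')]; exact he1 σ hσ')
      (by rw [hΨ0 _ (heO' σ hσ'), he2 σ hσ']; exact hσ.2)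
    rwa [hΨ0 _ (heO' σ hσ')] at this
  have heC : ∀ σ ∈ Icc (-ε') 0, e σ ∈ C η := fun σ hσ => ⟨he1 σ hσ, by
    have := hH σ hσ 0 hm0
    rwa [hΨ0 _ (heO' σ hσ)] at this⟩
  have hx4 : ∀ σ ∈ Icc (-ε') 0, ∀ t ∈ Icc (-τ) τ, 0 < Ψ (e σ) t 3 := fun σ hσ =>
    (hgood _ (heO' σ hσ)).x4_pos hW4
  have hsolτ : ∀ σ ∈ Icc (-ε') 0, IsSol η (Ψ (e σ)) (Icc (-τ) τ) := fun σ hσ =>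
    (hgood _ (heO' σ hσ)).isSol_Icc hτ hτT hTM
  -- the return time
  have hret : ∀ σ ∈ Icc (-ε') 0, ∃ θ ∈ Icc 0 τ, Ψ (e σ) θ 1 = 0 ∧
      (∀ t ∈ Ioo 0 θ, Ψ (e σ) t 1 < 0) ∧ (∀ t ∈ Ioc θ τ, 0 < Ψ (e σ) t 1) ∧
      (σ < 0 → 0 < θ ∧ 0 < Ψ (e σ) θ 2) ∧ (σ = 0 → θ = 0) := fun σ hσ => by
    have h00 := hΨ0 _ (heO' σ hσ)
    have h10 : Ψ (e σ) 0 1 = 0 := by rw [h00]; exact he1 σ hσ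
    have h20 : Ψ (e σ) 0 2 = σ := by rw [h00]; exact he2 σ hσ
    rcases hσ.2.eq_or_lt with h0 | h0
    · refine ⟨0, ⟨le_rfl, hτ.le⟩, h10, fun t ht => absurd (ht.1.trans ht.2) (lt_irrefl _),
        fun t ht => ?_, fun hlt => absurd h0 hlt.ne, fun _ => rfl⟩
      have := x2_lt_of_x3_nonneg (hsolτ σ hσ) (hx4 σ hσ) (neg_nonpos.2 hτ.le) ht.1 ht.2
        (by rw [h20, h0])
      rwa [h10] at this
    · obtain ⟨θ, hθ, k1, k2, k3, k4⟩ := exists_next_crossing (hsolτ σ hσ) (hx4 σ hσ)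
        (neg_nonpos.2 hτ.le) hτ h10 (by rw [h20]; exact h0) (hgood _ (heO' σ hσ)).right_pos
      exact ⟨θ, Ioo_subset_Icc_self hθ, k1, k3, k4, fun _ => ⟨hθ.1, k2⟩, fun e => absurd e h0.ne⟩
  choose! θ hθI hθ0 hθneg hθpos hθlt hθeq using hret
  have hect : ContinuousOn e (Icc (-ε') 0) := hec.mono hI
  have hft : ∀ t ∈ Icc 0 τ, ContinuousOn (fun σ => Ψ (e σ) t 1) (Icc (-ε') 0) := fun t ht => by
    have h1 : ContinuousOn (fun σ => Ψ (e σ) t) (Icc (-ε') 0) :=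
      (hΨL t ⟨by linarith [ht.1], ht.2⟩).continuousOn.comp hect fun σ hσ => hOρ _ (heO' σ hσ)
    exact (EuclideanSpace.proj 1 : E4 →L[ℝ] ℝ).continuous.comp_continuousOn h1
  -- The return time separates `x₂ < 0` from `x₂ > 0`. The sign at a fixed time on either side of `θ
  -- σ₀` persists for nearby `σ` and so bounds `θ σ` from that side.
  have hθc : ContinuousOn θ (Icc (-ε') 0) := fun σ₀ hσ₀ => by
    refine tendsto_order.2 ⟨fun c hc => ?_, fun c hc => ?_⟩
    · rcases lt_or_ge c 0 with hc0 | hc0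
      · filter_upwards [self_mem_nhdsWithin] with σ hσ
        exact hc0.trans_le (hθI σ hσ).1
      · obtain ⟨t, ht1, ht2⟩ := exists_between hc
        have htI : t ∈ Icc 0 τ := ⟨hc0.trans ht1.le, ht2.le.trans (hθI σ₀ hσ₀).2⟩
        filter_upwards [(hft t htI σ₀ hσ₀).eventually_lt_const
          (hθneg σ₀ hσ₀ t ⟨hc0.trans_lt ht1, ht2⟩), self_mem_nhdsWithin] with σ hlt hσ
        by_contra! hcon
        have := hθpos σ hσ t ⟨hcon.trans_lt ht1, htI.2⟩
        exact lt_asymm this hlt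
    · rcases lt_or_ge τ c with hc0 | hc0
      · filter_upwards [self_mem_nhdsWithin] with σ hσ
        exact (hθI σ hσ).2.trans_lt hc0
      · obtain ⟨t, ht1, ht2⟩ := exists_between hc
        have ht0 : 0 < t := (hθI σ₀ hσ₀).1.trans_lt ht1
        have htI : t ∈ Icc 0 τ := ⟨ht0.le, ht2.le.trans hc0⟩
        filter_upwards [(hft t htI σ₀ hσ₀).eventually_const_lt
          (hθpos σ₀ hσ₀ t ⟨ht1, htI.2⟩), self_mem_nhdsWithin] with σ hlt hσ
        by_contra! hcon
        have := hθneg σ hσ t ⟨ht0, ht2.trans_le hcon⟩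
        exact lt_asymm this hlt
  set e₂ : ℝ → E4 := fun σ => Ψ (e σ) (θ σ) with he₂
  have hθM : ∀ σ ∈ Icc (-ε') 0, θ σ ∈ Icc (-M) τ := fun σ hσ =>
    ⟨by linarith [(hθI σ hσ).1], (hθI σ hσ).2⟩
  have he₂c : ContinuousOn e₂ (Icc (-ε') 0) :=
    hΨc.comp (hect.prodMk hθc) fun σ hσ => ⟨hOρ _ (heO' σ hσ), hθM σ hσ⟩
  have hm00 : (0 : ℝ) ∈ Icc (-ε') 0 := ⟨by linarith, le_rfl⟩
  have he₂0 : e₂ 0 = q := by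
    simp only [he₂]
    rw [hθeq 0 hm00 rfl, he0]
    exact hΨ0 q hqO
  have hhit : ∀ σ ∈ Ico (-ε') 0, FirstHit η (e σ) (e₂ σ) := fun σ hσ => by
    have hσ' : σ ∈ Icc (-ε') 0 := Ico_subset_Icc_self hσ
    refine ⟨θ σ, Ψ (e σ), (hθlt σ hσ' hσ.2).1, (hgood _ (heO' σ hσ')).isSol.mono
      (Icc_subset_Icc (by linarith) (hθI σ hσ').2), hΨ0 _ (heO' σ hσ'), rfl, hθ0 σ hσ', ?_⟩
    exact fun t ht hS => (hθneg σ hσ' t ht).ne hS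
  have he₂3 : ∀ σ ∈ Ico (-ε') 0, 0 < e₂ σ 2 := fun σ hσ =>
    (hθlt σ (Ico_subset_Icc_self hσ) hσ.2).2
  have he_inj : InjOn e (Icc (-ε') 0) := fun σ hσ σ' hσ' heq => by
    rw [← he2 σ hσ, ← he2 σ' hσ', heq]
  have hq2 : q 2 = 0 := by rw [hq]; simp
  -- The end point `q` is distinguished by `x₃ = 0`; the other points have `x₃ > 0` and their
  -- preimages under the first hit are unique.
  have he₂_inj : InjOn e₂ (Icc (-ε') 0) := fun σ hσ σ' hσ' heq => by
    rcases hσ.2.eq_or_lt with h0 | h0 <;> rcases hσ'.2.eq_or_lt with h0' | h0'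
    · rw [h0, h0']
    · have := he₂3 σ' ⟨hσ'.1, h0'⟩
      rw [← heq, h0, he₂0, hq2] at this
      exact absurd this (lt_irrefl _)
    · have := he₂3 σ ⟨hσ.1, h0⟩
      rw [heq, h0', he₂0, hq2] at this
      exact absurd this (lt_irrefl _)
    · refine he_inj hσ hσ' (FirstHit.injective (he1 σ hσ) (he1 σ' hσ') (hhit σ ⟨hσ.1, h0⟩) ?_)
      rw [heq]
      exact hhit σ' ⟨hσ'.1, h0'⟩
  have harc : ∀ f : ℝ → E4, ContinuousOn f (Icc (-ε') 0) → InjOn f (Icc (-ε') 0) → f 0 = q →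
      IsOpenArcWithEndpoint (f '' Ioo (-ε') 0) q := fun f hfc hfi hf0 => by
    have hmaps : MapsTo (fun s : ℝ => -ε' * s) (Icc 0 1) (Icc (-ε') 0) := fun s hs =>
      ⟨by nlinarith [hs.2], by nlinarith [hs.1]⟩
    refine ⟨fun s => f (-ε' * s), hfc.comp (by fun_prop) hmaps, fun s hs s' hs' heq => ?_,
      by simpa using hf0, ?_⟩
    · have := hfi (hmaps hs) (hmaps hs') heq
      exact mul_left_cancel₀ (neg_ne_zero.2 hε'.ne') this
    · ext y
      constructor
      · rintro ⟨σ, hσ, rfl⟩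
        refine ⟨-σ / ε', ⟨div_pos (by linarith [hσ.2]) hε', ?_⟩, ?_⟩
        · rw [div_lt_one hε']; linarith [hσ.1]
        · simp only; congr 1; field_simp
      · rintro ⟨s, hs, rfl⟩
        exact ⟨-ε' * s, ⟨by nlinarith [hs.2], by nlinarith [hs.1]⟩, rfl⟩
  -- The condition `-ε' < x₃` cuts the curve at its far end. A `k`-th hit in the neighbourhood has
  -- `x₃ ≤ 0`, so the half `σ > 0` does not appear.
  have hA₃ : (SigmaU η a b r k \ {q}) ∩ (O ∩ interior V ∩ {x : E4 | -ε' < x 2}) =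
      e '' Ioo (-ε') 0 := by
    ext y
    constructor
    · rintro ⟨⟨hy, hyq⟩, ⟨hyO, -⟩, hy2⟩
      have hg := hgood y hyO
      obtain ⟨k1, k2, k3⟩ := hg.of_mem_hits hτ hτT hTM hW4 hab hr (by rwa [hΨ0 y hyO])
      rw [hΨ0 y hyO] at k2 k3
      have hfl := hg.isSol.flowsTo ordConnected_Icc hmT hm0
      rw [← k1.graphMap_base, hΨ0 y hyO, zero_sub, neg_neg] at hfl
      have hy2' : -ε' < y 2 := hy2
      have hye : y = e (y 2) := hg.base_mem y hfl k2 ⟨by linarith, by linarith⟩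
      refine ⟨y 2, ⟨hy2', lt_of_le_of_ne k3 fun h0 => hyq ?_⟩, hye.symm⟩
      rw [hye, h0, he0]; rfl
    · rintro ⟨σ, hσ, rfl⟩
      have hσ' := hσI σ hσ
      refine ⟨⟨heSig σ ⟨hσ.1.le, hσ.2⟩, fun hmem => ?_⟩, heO σ hσ', ?_⟩
      · have := he2 σ hσ'
        rw [mem_singleton_iff.1 hmem, hq2] at this
        exact hσ.2.ne this.symm
      · simp only [mem_ofPred_eq]; rw [he2 σ hσ']; exact hσ.1
  have hA₂ : poincareMap η '' (e '' Ioo (-ε') 0) = e₂ '' Ioo (-ε') 0 := by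
    rw [image_image]
    exact image_congr fun σ hσ => poincareMap_eq (hhit σ ⟨hσ.1.le, hσ.2⟩)
  refine ⟨O ∩ interior V ∩ {x : E4 | -ε' < x 2}, fun y hy => interior_subset hy.1.2,
    (hOo.inter isOpen_interior).inter (isOpen_lt continuous_const
      (EuclideanSpace.proj 2 : E4 →L[ℝ] ℝ).continuous),
    ⟨⟨hqO, mem_interior_iff_mem_nhds.2 hV⟩, by
      simp only [mem_ofPred_eq]; rw [hq2]; linarith⟩,
    e '' Ioo (-ε') 0, e₂ '' Ioo (-ε') 0, hA₃, ?_, harc e hect he_inj he0, ?_, hA₂.symm, ?_,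
    harc e₂ he₂c he₂_inj he₂0⟩
  · rintro _ ⟨σ, hσ, rfl⟩
    have hσ' := hσI σ hσ
    refine ⟨heC σ hσ', ?_, by rw [he2 σ hσ']; exact hσ.2⟩
    have := hW0 _ ((hgood _ (heO' σ hσ')).mem_W 0 ⟨by linarith, hτ.le⟩)
    rwa [hΨ0 _ (heO' σ hσ')] at this
  · rintro _ ⟨σ, hσ, rfl⟩
    exact ⟨heC σ (hσI σ hσ), e₂ σ, hhit σ ⟨hσ.1.le, hσ.2⟩⟩
  · rintro _ ⟨σ, hσ, rfl⟩
    have hσ' := hσI σ hσ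
    have hσc : σ ∈ Ico (-ε') 0 := ⟨hσ.1.le, hσ.2⟩
    have hmW : e₂ σ ∈ W := (hgood _ (heO' σ hσ')).mem_W (θ σ)
      ⟨by linarith [(hθI σ hσ').1], (hθI σ hσ').2⟩
    refine ⟨⟨?_, ⟨hθ0 σ hσ', hH σ hσ' _ (hθM σ hσ')⟩, hW0 _ hmW, he₂3 σ hσc⟩,
      interior_subset hmW.1⟩
    rw [sigmaU_eq]
    exact ⟨e σ, sigmaU_eq ▸ heSig σ hσc, hhit σ hσc⟩
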